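/- **Setting.** Minkowski space has the metric $\eta=\mathrm{diag}(1,-1,-1,-1)$; $X_{[\mu}Y_{\nu]}=X_\mu Y_\nu-X_\nu Y_\mu$; $\delta_{xx'}=\delta(x-x')$; a prime on a field means that it is taken at $x'$. Let $\xi_1,\dots,\xi_N$ be a basis of a Lie algebra with $[\xi_a,\xi_b]=i f_{abc}\xi_c$, where $f_{abc}$ is real and completely antisymmetric (in particular, the generators of a compact simple Lie algebra), and let $\langle\xi_a|\xi_b\rangle=\delta_{ab}$. Let $F_{\mu\nu}=F^a_{\mu\nu}\xi_a$ be $N$ free Maxwell fields, let $c$ be a smooth compactly supported function on the hyperboloid $H_1=\{e:e^2=-1\}$ with invariant measure $\sigma$ and $\int c\,d\sigma=1$, and let $$A_\mu(x)=A_\mu(x,c)=\int d\sigma(e)\,c(e)\int_0^\infty ds\,F_{\mu\nu}(x+se)e^\nu .$$ A variation $\delta c$ of $c$ is induced by a smooth compactly supported vector field $b$ tangent to $H_1$ through $\int d\sigma\,\delta c\,g=\int d\sigma\,b^\kappa\partial_\kappa g$ for all smooth $g$; $\delta_c$ denotes the induced variation of Wick polynomials, and $$w(x)=\int d\sigma(e)\,b^\kappa(e)\int_0^\infty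 s\,ds\,F_{\kappa\nu}(x+se)e^\nu .$$ Let $I^\nu$ and $I'^\nu$ be the string integration $\int d\sigma(e)\,c(e)e^\nu\int_0^\infty ds$ along $x+se$ resp. $x'+se$ in the arguments $x$ resp. $x'$, $(II')=I^\nu I'_\nu$, and let $T_0=T_0(x-x')$ be the time-ordered two-point function of the free massless scalar field. All derivatives act on $x$. The propagators (diagonal in the Lie algebra index) are $$\langle TF_{\mu\nu}F'_{\kappa\lambda}\rangle=-\partial_{[\mu}\eta_{\nu][\kappa}\partial_{\lambda]}T_0-c_F\,\eta_{\mu[\kappa}\eta_{\lambda]\nu}\,i\delta_{xx'},$$ $$\langle TF_{\mu\nu}A'_\kappa\rangle=-(\partial_{[\mu}\eta_{\nu]\kappa}-\partial_{[\mu}I'_{\nu]}\partial_\kappa)T_0,\qquad \langle TA_\mu F'_{\kappa\lambda}\rangle=-(\eta_{\mu[\kappa}\partial_{\lambda]}+\partial_\mu I_{[\kappa}\partial_{\lambda]})T_0,$$ $$\langle TA_\mu A'_\kappa\rangle=-(\eta_{\mu\kappa}+\partial_\mu I_\kappa-I'_\mu\partial_\kappa-(II')\partial_\mu\partial_\kappa)T_0,$$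 with an arbitrary renormalization constant $c_F$; those of $w$ and $\partial_\mu w$ are the string integrals of the kinematic ($c_F=0$) propagators of $F$ and $\partial_\mu F$. The two-point obstructions are $O_\mu(\varphi,\chi')=\langle T[\partial_\mu\varphi\,\chi']\rangle-\partial_\mu\langle T[\varphi\,\chi']\rangle$, where the field equations $\partial^\mu F_{\mu\nu}=0$, $\partial_\mu A_\nu-\partial_\nu A_\mu=F_{\mu\nu}$, $\partial^\mu A_\mu=0$ are used under the time ordering. For Wick polynomials $Y^\mu$, $X$ the tree-level obstruction is $O_{Y}(X')=\sum_{\varphi,\chi}\frac{\partial Y^\mu}{\partial\varphi}(x)\,O_\mu(\varphi(x),\chi(x'))\,\frac{\partial X}{\partial\chi}(x')$, the sum running over the linear fields $F$, $A$, $w$. All products of fields are Wick ordered, and $\mathfrak S_{xx'}$ is the mean over the permutations of $x,x'$. **Proposition.** Let $$L_1=\tfrac12\langle F^{\mu\nu}\,|\,i[A_\mu,A_\nu]\rangle,\qquad Q_1^\mu=\langle F^{\mu\nu}\,|\,i[w,A_\nu]\rangle .$$ Then the second-order obstruction of string-localized Yang-Mills theory is resolved: $$2\,\mathfrak S_{xx'}\,O_{Q_1}(L_1')=\delta_cL_2(x)\cdot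 i\delta_{xx'}-i\,\mathfrak S_{xx'}\,\partial^x_\mu Q_2^\mu(x;x')$$ with $$L_2=-\tfrac12(1+c_F)\,\langle i[A^\mu,A^\nu]\,|\,i[A_\mu,A_\nu]\rangle,$$ $$Q_2^\mu(x;x')=-2(1+c_F)\,\langle i[A^\mu,A^\nu]\,|\,i[w,A_\nu]\rangle\,\delta_{xx'}-2\,\langle i[F^{\mu\nu},A_\nu](x)\,|\,w_2(x,x')\rangle,\qquad w_2(x,x')=i[w',A'_\nu]\cdot I^\nu\delta_{xx'} .$$ -/

import Mathlib

open MeasureTheory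
open scoped ContDiff

noncomputable section

namespace StringYM

/-! ## Minkowski space -/

/-- Minkowski space; the coordinate `x 0` is the time. Volume is Lebesgue measure. -/
abbrev Mink : Type := Fin 4 → ℝ

/-- The Minkowski metric `diag(1,-1,-1,-1)` (the same matrix with upper and with lower indices). -/
def eta (μ ν : Fin 4) : ℝ := if μ = ν then (if μ = 0 then 1 else -1) else 0

/-- The Minkowski square `x² = x^μ x_μ`. -/
def minkSq (x : Mink) : ℝ := ∑ μ, ∑ ν, eta μ ν * x μ * x ν

/-- The partial derivative `∂_μ` of a function on Minkowski space. -/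
def pd (μ : Fin 4) (f : Mink → ℂ) (x : Mink) : ℂ := fderiv ℝ f x (Pi.single μ 1)

/-- Raising both indices of a tensor. -/
def up2 {V : Type*} [AddCommGroup V] [Module ℝ V] (T : Fin 4 → Fin 4 → V) (μ ν : Fin 4) : V :=
  ∑ κ, ∑ ρ, (eta μ κ * eta ν ρ) • T κ ρ

/-- Raising the index of a vector. -/
def up1 {V : Type*} [AddCommGroup V] [Module ℝ V] (T : Fin 4 → V) (μ : Fin 4) : V :=
  ∑ κ, eta μ κ • T κ

/-! ## Strings -/

/-- The hyperboloid `H₁` of spacelike unit vectors. -/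
def hyperboloid : Set Mink := {e | minkSq e = -1}

/-- The Lorentz invariant measure on `H₁`, as a measure on Minkowski space concentrated on `H₁`.
Writing spacelike vectors as `y = s e` with `s > 0` and `e ∈ H₁`, one has `d⁴y = s³ ds dσ(e)`;
hence `σ(S)` is four times the volume of the cone over `S` cut off at `s ≤ 1`. -/
def sigma : Measure Mink :=
  (4 : ENNReal) • Measure.map (fun y : Mink => (Real.sqrt (-minkSq y))⁻¹ • y)
    (volume.restrict {y | minkSq y < 0 ∧ -1 ≤ minkSq y})

/-- A smooth, compactly supported string smearing function of total weight one. -/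
structure IsSmearing (c : Mink → ℝ) : Prop where
  smooth : ContDiff ℝ ∞ c
  compact : HasCompactSupport c
  weight : ∫ e, c e ∂sigma = 1

/-- `δc` is the variation of the smearing function induced by the vector field `b` tangent to
`H₁`: it is (minus) the divergence of `b` on `H₁`, in the weak form
`∫ dσ δc g = ∫ dσ b^κ ∂_κ g`. -/
structure IsVariation (b : Mink → Fin 4 → ℝ) (δc : Mink → ℝ) : Prop where
  smooth_b : ContDiff ℝ ∞ b
  compact_b : HasCompactSupport b
  tangent : ∀ e ∈ hyperboloid, ∑ μ, ∑ ν, eta μ ν * b e μ * e ν = 0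
  smooth : ContDiff ℝ ∞ δc
  compact : HasCompactSupport δc
  divergence : ∀ g : Mink → ℝ, ContDiff ℝ ∞ g →
    ∫ e, δc e * g e ∂sigma = ∫ e, fderiv ℝ g e (b e) ∂sigma

/-! ## Translation invariant distributions in the difference variable `ξ = x - x'`

They are functionals, to be applied to smooth compactly supported functions of `ξ`. -/

abbrev Dist : Type := (Mink → ℂ) → ℂ

/-- `∂_μ u`, the derivative with respect to `x`. -/
def dD (μ : Fin 4) (u : Dist) : Dist := fun f => - u (pd μ f)

/-- `δ(x - x')`. -/
def delta : Dist := fun f => f 0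

/-- `I_c^ν u`, string integration in the argument `x`:
`∫ dσ(e) c(e) e^ν ∫₀^∞ ds u(ξ + s e)`. -/
def strI (c : Mink → ℝ) (ν : Fin 4) (u : Dist) : Dist := fun f =>
  ∫ e, ((c e * e ν : ℝ) : ℂ) * (∫ s in Set.Ioi (0 : ℝ), u (fun ξ => f (ξ - s • e))) ∂sigma

/-- `I'_c^ν u`, string integration in the argument `x'`:
`∫ dσ(e) c(e) e^ν ∫₀^∞ ds u(ξ - s e)`. -/
def strI' (c : Mink → ℝ) (ν : Fin 4) (u : Dist) : Dist := fun f =>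
  ∫ e, ((c e * e ν : ℝ) : ℂ) * (∫ s in Set.Ioi (0 : ℝ), u (fun ξ => f (ξ + s • e))) ∂sigma

/-- `I_{c,ν} u`. -/
def strILow (c : Mink → ℝ) (ν : Fin 4) (u : Dist) : Dist := ∑ ρ, eta ν ρ • strI c ρ u

/-- `I'_{c,ν} u`. -/
def strILow' (c : Mink → ℝ) (ν : Fin 4) (u : Dist) : Dist := ∑ ρ, eta ν ρ • strI' c ρ u

/-- `(I_c I'_c) u = I_c^ν I'_{c,ν} u`. -/
def strII (c : Mink → ℝ) (u : Dist) : Dist := ∑ ν, strI c ν (strILow' c ν u)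

/-- The weighted string integration in the argument `x` that enters the field `w`:
`∫ dσ(e) b^κ(e) e^ν ∫₀^∞ s ds u(ξ + s e)`. -/
def strJ (b : Mink → Fin 4 → ℝ) (κ ν : Fin 4) (u : Dist) : Dist := fun f =>
  ∫ e, ((b e κ * e ν : ℝ) : ℂ) *
    (∫ s in Set.Ioi (0 : ℝ), (s : ℂ) * u (fun ξ => f (ξ - s • e))) ∂sigma

/-- The time-ordered two-point function `T₀(x - x')` of the free massless scalar field,
`θ(t) W(ξ) + θ(-t) W(-ξ)` with `W(t,x) = ∫ d³k / ((2π)³ 2|k|) e^{-i(|k| t - k·x)}`. -/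
def T0 : Dist := fun f =>
  ∫ t : ℝ, ∫ k : EuclideanSpace ℝ (Fin 3),
    Complex.exp (-Complex.I * (‖k‖ : ℂ) * ((|t| : ℝ) : ℂ)) /
        (((2 * Real.pi) ^ 3 * (2 * ‖k‖) : ℝ) : ℂ) *
      ∫ x : EuclideanSpace ℝ (Fin 3),
        Complex.exp (Complex.I * ((inner ℝ k x : ℝ) : ℂ)) *
          f (Fin.cons t (fun i : Fin 3 => x i))

/-! ## Linear fields, their propagators and two-point obstructions -/

/-- The species of linear gluon fields: `inl (μ, ν)` is `F_{μν}` and `inr μ` is `A_μ(c)`.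
Lorentz indices are lower indices throughout. -/
abbrev Gluon : Type := (Fin 4 × Fin 4) ⊕ Fin 4

/-- The linear fields in `Q`: `some φ` is the gluon field `φ` and `none` is `w`. -/
abbrev GluonW : Type := Option Gluon

abbrev fF (μ ν : Fin 4) : Gluon := Sum.inl (μ, ν)

abbrev fA (μ : Fin 4) : Gluon := Sum.inr μ

/-- The kinematic propagator `⟨T F_{μν} F'_{κρ}⟩ = -∂_{[μ} η_{ν][κ} ∂_{ρ]} T₀`. -/
def kinFF (μ ν κ ρ : Fin 4) : Dist :=
  -(eta ν κ • dD μ (dD ρ T0) - eta μ κ • dD ν (dD ρ T0)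
    - eta ν ρ • dD μ (dD κ T0) + eta μ ρ • dD ν (dD κ T0))

/-- `⟨T F_{μν} A'_κ(c)⟩ = -(∂_{[μ} η_{ν]κ} - ∂_{[μ} I'_{ν]} ∂_κ) T₀`. -/
def propFA (c : Mink → ℝ) (μ ν κ : Fin 4) : Dist :=
  -(eta ν κ • dD μ T0 - eta μ κ • dD ν T0
    - (dD μ (strILow' c ν (dD κ T0)) - dD ν (strILow' c μ (dD κ T0))))

/-- `⟨T A_μ(c) F'_{κρ}⟩ = -(η_{μ[κ} ∂_{ρ]} + ∂_μ I_{[κ} ∂_{ρ]}) T₀`. -/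
def propAF (c : Mink → ℝ) (μ κ ρ : Fin 4) : Dist :=
  -(eta μ κ • dD ρ T0 - eta μ ρ • dD κ T0
    + (dD μ (strILow c κ (dD ρ T0)) - dD μ (strILow c ρ (dD κ T0))))

/-- `⟨T A_μ(c) A'_κ(c)⟩ = -(η_{μκ} + ∂_μ I_κ - I'_μ ∂_κ - (I I') ∂_μ ∂_κ) T₀`. -/
def propAA (c : Mink → ℝ) (μ κ : Fin 4) : Dist :=
  -(eta μ κ • T0 + dD μ (strILow c κ T0) - strILow' c μ (dD κ T0)
    - strII c (dD μ (dD κ T0)))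

/-- The kinematic propagators `⟨T F_{μν} χ'⟩`. -/
def kinF (c : Mink → ℝ) (μ ν : Fin 4) : Gluon → Dist
  | Sum.inl (κ, ρ) => kinFF μ ν κ ρ
  | Sum.inr κ => propFA c μ ν κ

/-- The propagators `⟨T φ χ'⟩`. The one of `F` with `F'` is renormalized by adding
`-c_F η_{μ[κ} η_{ρ]ν} iδ`; all others are kinematic. Those of
`w = ∫ dσ b^κ ∫ s ds F_{κν}(x + s e) e^ν` are the corresponding string integrals. -/
def prop (cF : ℂ) (c : Mink → ℝ) (b : Mink → Fin 4 → ℝ) : GluonW → Gluon → Dist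
  | some (Sum.inl (μ, ν)), Sum.inl (κ, ρ) =>
      kinFF μ ν κ ρ - (cF * Complex.I) • ((eta μ κ * eta ρ ν - eta μ ρ * eta κ ν) • delta)
  | some (Sum.inl (μ, ν)), Sum.inr κ => propFA c μ ν κ
  | some (Sum.inr μ), Sum.inl (κ, ρ) => propAF c μ κ ρ
  | some (Sum.inr μ), Sum.inr κ => propAA c μ κ
  | none, χ => ∑ κ, ∑ ν, strJ b κ ν (kinF c κ ν χ)

/-- `∂^α ⟨T φ_α χ'⟩`. -/
def divProp (u : Fin 4 → Dist) : Dist := ∑ α, ∑ β, eta α β • dD α (u β)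

/-- The propagators `⟨T[∂_μ φ χ']⟩` of the differentiated fields. Those components of `∂_μ φ`
that are fixed by the field equations `∂^μ F_{μν} = 0`, `∂_μ A_ν - ∂_ν A_μ = F_{μν}` and
`∂^μ A_μ = 0` are replaced according to these equations under the time ordering. The derivative is
taken outside for the other components (which do not contribute to `O_{Q₁}`).
The propagators of `∂_μ w` are string integrals of kinematic propagators. -/
def propD (cF : ℂ) (c : Mink → ℝ) (b : Mink → Fin 4 → ℝ) (μ : Fin 4) : GluonW → Gluon → Dist
  | some (Sum.inl (ρ, ν)), χ =>
      dD μ (prop cF c b (some (fF ρ ν)) χ)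
        - (1 / 3 : ℝ) • (eta μ ρ • divProp (fun α => prop cF c b (some (fF α ν)) χ)
            - eta μ ν • divProp (fun α => prop cF c b (some (fF α ρ)) χ))
  | some (Sum.inr ν), χ =>
      (1 / 2 : ℝ) • (dD μ (prop cF c b (some (fA ν)) χ) + dD ν (prop cF c b (some (fA μ)) χ))
        + (1 / 2 : ℝ) • prop cF c b (some (fF μ ν)) χ
        - (1 / 4 : ℝ) • (eta μ ν • divProp (fun α => prop cF c b (some (fA α)) χ))
  | none, χ => ∑ κ, ∑ ν, strJ b κ ν (dD μ (kinF c κ ν χ))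

/-- The two-point obstruction `O_μ(φ, χ') = ⟨T[∂_μ φ χ']⟩ - ∂_μ ⟨T[φ χ']⟩`. -/
def twoPointObs (cF : ℂ) (c : Mink → ℝ) (b : Mink → Fin 4 → ℝ) (μ : Fin 4)
    (φ : GluonW) (χ : Gluon) : Dist :=
  propD cF c b μ φ χ - dD μ (prop cF c b φ χ)

/-! ## Wick polynomials

Wick products of linear free fields commute under the Wick ordering, so Wick polynomials without
derivatives are polynomials in the symbols of the linear fields. They are identified by
their values on the complex classical solutions of the field equations (matrix elements between
coherent states). -/

variable {N : ℕ}

/-- Wick polynomials in `F^a_{μν}`, `A^a_μ(c)`. -/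
abbrev WickGluon (N : ℕ) : Type := MvPolynomial (Gluon × Fin N) ℂ

/-- Wick polynomials in `F^a_{μν}`, `A^a_μ(c)`, `w^a`. -/
abbrev WickGluonW (N : ℕ) : Type := MvPolynomial (GluonW × Fin N) ℂ

/-- `i[X, Y] = -f_{abc} X_a Y_b ξ_c`, in components with respect to the generators `ξ_c`,
where `[ξ_a, ξ_b] = i f_{abc} ξ_c`. -/
def ibr (f : Fin N → Fin N → Fin N → ℝ) {R : Type*} [CommRing R] [Algebra ℂ R]
    (X Y : Fin N → R) : Fin N → R :=
  fun d => -∑ a, ∑ b, (f a b d : ℂ) • (X a * Y b)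

/-- `⟨X | Y⟩`, where `⟨ξ_a | ξ_b⟩ = δ_{ab}`. -/
def ip {R : Type*} [CommRing R] (X Y : Fin N → R) : R := ∑ a, X a * Y a

/-- `L₁ = ½ ⟨F^{μν} | i[A_μ, A_ν]⟩`. -/
def L1 (f : Fin N → Fin N → Fin N → ℝ) : WickGluon N :=
  let F : Fin 4 → Fin 4 → Fin N → WickGluon N := fun μ ν a => MvPolynomial.X (fF μ ν, a)
  let A : Fin 4 → Fin N → WickGluon N := fun μ a => MvPolynomial.X (fA μ, a)
  (1 / 2 : ℂ) • ∑ μ, ∑ ν, ip (up2 F μ ν) (ibr f (A μ) (A ν))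

/-- `Q₁^μ = ⟨F^{μν} | i[w, A_ν]⟩`. -/
def Q1 (f : Fin N → Fin N → Fin N → ℝ) (μ : Fin 4) : WickGluonW N :=
  let F : Fin 4 → Fin 4 → Fin N → WickGluonW N :=
    fun μ ν a => MvPolynomial.X (some (fF μ ν), a)
  let A : Fin 4 → Fin N → WickGluonW N := fun μ a => MvPolynomial.X (some (fA μ), a)
  let w : Fin N → WickGluonW N := fun a => MvPolynomial.X (none, a)
  ∑ ν, ip (up2 F μ ν) (ibr f w (A ν))

/-- `L₂ = -½ (1 + c_F) ⟨i[A^μ, A^ν] | i[A_μ, A_ν]⟩`. -/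
def L2 (f : Fin N → Fin N → Fin N → ℝ) (cF : ℂ) : WickGluon N :=
  let A : Fin 4 → Fin N → WickGluon N := fun μ a => MvPolynomial.X (fA μ, a)
  (-(1 / 2) * (1 + cF)) • ∑ μ, ∑ ν, ip (ibr f (up1 A μ) (up1 A ν)) (ibr f (A μ) (A ν))

/-! ## Classical configurations -/

/-- A complex classical configuration of the gluon field strengths `F^a_{μν}`: a smooth solution
of the free Maxwell equations with spacelike compact support. -/
structure IsMaxwell (F : Fin 4 → Fin 4 → Fin N → Mink → ℂ) : Prop where
  smooth : ∀ μ ν a, ContDiff ℝ ∞ (F μ ν a)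
  antisymm : ∀ μ ν a x, F μ ν a x = -F ν μ a x
  divergence : ∀ ν a x, ∑ μ, ∑ ρ, eta μ ρ • pd μ (F ρ ν a) x = 0
  bianchi : ∀ μ ν κ a x, pd μ (F ν κ a) x + pd ν (F κ μ a) x + pd κ (F μ ν a) x = 0
  support : ∃ r : ℝ, ∀ x : Mink, r + |x 0| < Real.sqrt (∑ i : Fin 3, x i.succ ^ 2) →
    ∀ μ ν a, F μ ν a x = 0

/-- `A_μ(x, c) = ∫ dσ(e) c(e) ∫₀^∞ ds F_{μν}(x + s e) e^ν`. -/
def strA (c : Mink → ℝ) (F : Fin 4 → Fin 4 → Fin N → Mink → ℂ) (μ : Fin 4) (a : Fin N)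
    (x : Mink) : ℂ :=
  ∫ e, (c e : ℂ) * (∫ s in Set.Ioi (0 : ℝ), ∑ ν, F μ ν a (x + s • e) * (e ν : ℂ)) ∂sigma

/-- `w(x) = ∫ dσ(e) b^κ(e) ∫₀^∞ s ds F_{κν}(x + s e) e^ν`. -/
def strW (b : Mink → Fin 4 → ℝ) (F : Fin 4 → Fin 4 → Fin N → Mink → ℂ) (a : Fin N)
    (x : Mink) : ℂ :=
  ∫ e, ∑ κ, (b e κ : ℂ) *
    (∫ s in Set.Ioi (0 : ℝ), (s : ℂ) * ∑ ν, F κ ν a (x + s • e) * (e ν : ℂ)) ∂sigma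

/-- The values at `x` of the linear gluon fields in a configuration. -/
def valG (c : Mink → ℝ) (F : Fin 4 → Fin 4 → Fin N → Mink → ℂ) (x : Mink) :
    Gluon × Fin N → ℂ
  | (Sum.inl (μ, ν), a) => F μ ν a x
  | (Sum.inr μ, a) => strA c F μ a x

/-- The values at `x` of the linear fields, including `w`, in a configuration. -/
def valGW (c : Mink → ℝ) (b : Mink → Fin 4 → ℝ) (F : Fin 4 → Fin 4 → Fin N → Mink → ℂ)
    (x : Mink) : GluonW × Fin N → ℂ
  | (some φ, a) => valG c F x (φ, a)
  | (none, a) => strW b F a x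

/-- The variation `δ_c L = d/dt L(c + t δc)` at `t = 0` of a Wick polynomial,
evaluated at `x`. -/
def deltaC (c δc : Mink → ℝ) (F : Fin 4 → Fin 4 → Fin N → Mink → ℂ) (L : WickGluon N)
    (x : Mink) : ℂ :=
  deriv (fun t : ℝ => MvPolynomial.eval (valG (fun e => c e + t * δc e) F x) L) 0

/-! ## Distributions in two points -/

/-- Distributions in `(x, x')`, to be applied to smooth compactly supported functions. -/
abbrev BiDist : Type := (Mink × Mink → ℂ) → ℂ

/-- The product of a smooth function `Φ(x, x')` and of `u(x - x')`. -/
def mulDist (Φ : Mink → Mink → ℂ) (u : Dist) : BiDist := fun g =>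
  ∫ x', u (fun ξ => Φ (x' + ξ) x' * g (x' + ξ, x'))

/-- Symmetrization `𝔖_{xx'}` (the mean over the permutations of `x`, `x'`). -/
def symm (D : BiDist) : BiDist := fun g => (1 / 2 : ℂ) * (D g + D (fun p => g (p.2, p.1)))

/-- The derivative `∂^x_μ`. -/
def dX (μ : Fin 4) (D : BiDist) : BiDist := fun g =>
  -D (fun p => pd μ (fun x => g (x, p.2)) p.1)

/-- The tree-level obstruction
`O_{Y(x)}(X(x')) = ∑ (∂Y^μ/∂φ)(x) O_μ(φ(x), χ(x')) (∂X/∂χ)(x')`, where the two-point obstructions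
are diagonal in the Lie algebra index. -/
def obstruction (cF : ℂ) (c : Mink → ℝ) (b : Mink → Fin 4 → ℝ)
    (F : Fin 4 → Fin 4 → Fin N → Mink → ℂ) (Y : Fin 4 → WickGluonW N) (X : WickGluon N) :
    BiDist :=
  ∑ μ, ∑ φ : GluonW, ∑ χ : Gluon, ∑ a : Fin N,
    mulDist (fun x x' =>
        MvPolynomial.eval (valGW c b F x) (MvPolynomial.pderiv (φ, a) (Y μ)) *
          MvPolynomial.eval (valG c F x') (MvPolynomial.pderiv (χ, a) X))
      (twoPointObs cF c b μ φ χ)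

/-- The second-order obstruction `O⁽²⁾(x, x') = 2 𝔖_{xx'} O_{Q₁}(L₁')`. -/
def O2 (f : Fin N → Fin N → Fin N → ℝ) (cF : ℂ) (c : Mink → ℝ) (b : Mink → Fin 4 → ℝ)
    (F : Fin 4 → Fin 4 → Fin N → Mink → ℂ) : BiDist :=
  (2 : ℂ) • symm (obstruction cF c b F (Q1 f) (L1 f))

/-- `Q₂^μ(x; x') = -2 (1 + c_F) ⟨i[A^μ, A^ν] | i[w, A_ν]⟩ δ_{xx'} - 2 ⟨i[F^{μν}, A_ν] | w₂(x, x')⟩`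
with `w₂(x, x') = i[w', A'_ν] I^ν δ_{xx'}`. -/
def Q2 (f : Fin N → Fin N → Fin N → ℝ) (cF : ℂ) (c : Mink → ℝ) (b : Mink → Fin 4 → ℝ)
    (F : Fin 4 → Fin 4 → Fin N → Mink → ℂ) (μ : Fin 4) : BiDist :=
  let A : Mink → Fin 4 → Fin N → ℂ := fun x ν a => strA c F ν a x
  let w : Mink → Fin N → ℂ := fun x a => strW b F a x
  let Fx : Mink → Fin 4 → Fin 4 → Fin N → ℂ := fun x κ ρ a => F κ ρ a x
  (-2 * (1 + cF)) •
      mulDist (fun x _ => ∑ ν, ip (ibr f (up1 (A x) μ) (up1 (A x) ν)) (ibr f (w x) (A x ν))) delta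
    - (2 : ℂ) • ∑ ρ, mulDist (fun x x' =>
        ip (∑ ν, ibr f (up2 (Fx x) μ ν) (A x ν)) (ibr f (w x') (A x' ρ))) (strI c ρ delta)

end StringYM

end

noncomputable section

namespace StringYM

open Filter Topology

/-! Everything is tested against a smooth compactly supported `g` and evaluated on a classical
configuration, so the claim is an identity of numbers. The obstruction is computed once the
two-point obstructions are known, and these rest on two properties of the time-ordered function: it
is a Green function, □T₀ = -iδ (`T0_wave`), and its derivative along a spacelike string integrates
back to it (`integral_T0_shift_dirD`), which requires decay along the string.

Both properties come from a cutoff e^{-ε|k|} in momentum space. The cut-off function has the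
explicit kernel 1/(4π²((ε+i|t|)²+|x|²)) (`T0cut_eq`). Away from t = 0 this kernel solves the wave
equation, and its kink at t = 0 produces a Poisson kernel that tends to δ. Along a spacelike
direction it is O(s⁻²) uniformly in ε (`exists_decay_T0_shift`), and dominated convergence removes
the cutoff.

It follows that ∂^α⟨T F_{αν} F'⟩ is 1+c_F times first derivatives of δ (`divProp_FF`), that ∂^α⟨T
F_{αν} A'_κ⟩ consists of δ and a derivative of the string integral of δ (`divProp_FA`), that the
curl relation between A and F fails only by the c_F term (`twoPointObs_A_F`), and that w contributes
nothing (`twoPointObs_w`). Contracted with the derivatives of Q₁ and L₁, this gives three local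
terms and one string-localized term (`obstruction_eq`).

The string-localized pairing is invariant under simultaneous translations of both points, and the
current i[F^{κν},A_ν] of free fields is conserved (`divergence_current`). Hence the derivative can
be moved to the other point without touching the current (`sum_strPair_current`), and after
interchange of the points the result is the divergence of the string-localized part of Q₂.

In the local terms, symmetrization replaces derivatives of δ by densities multiplying g(x,x)
(`diagPair_pd1_symm`). By the Jacobi identity the term with the current becomes a multiple of
⟨i[A^μ,A^ν]|i[w,F_{μν}]⟩, which is also what the c_F obstruction produces, so that all coefficients
combine to 1+c_F (`local_identity`). What is left is the divergence of the local part of Q₂ and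
-2(1+c_F)⟨i[A^μ,A^ν]|i[∂_μ w,A_ν]⟩. The latter is the variation of L₂ (`deltaC_L2`), because δ_c A_μ
= ∂_μ w (`strA_variation`): this uses the divergence formula for δc, the Bianchi identity and an
integration by parts along the string. -/

/-- Smooth compactly supported functions. -/
structure IsTest {E : Type*} [NormedAddCommGroup E] [NormedSpace ℝ E] (f : E → ℂ) : Prop where
  smooth : ContDiff ℝ ∞ f
  compact : HasCompactSupport f

/-! ### Splitting of space-time, translations and partial derivatives of test functions. -/

/-- Spatial three-space. -/
abbrev Space : Type := EuclideanSpace ℝ (Fin 3)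

/-- The space-time point with the given time and position. -/
def toMink (t : ℝ) (x : Space) : Mink := Fin.cons t (fun i : Fin 3 => x i)

@[simp] lemma toMink_zero (t : ℝ) (x : Space) : toMink t x 0 = t := rfl

@[simp] lemma toMink_succ (t : ℝ) (x : Space) (i : Fin 3) : toMink t x i.succ = x i := rfl

/-- The spatial part of a space-time point. -/
def spatial (y : Mink) : Space := WithLp.toLp 2 (fun i : Fin 3 => y i.succ)

@[simp] lemma spatial_apply (y : Mink) (i : Fin 3) : spatial y i = y i.succ := rfl

lemma toMink_add (t : ℝ) (x : Space) (y : Mink) :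
    toMink t x + y = toMink (t + y 0) (x + spatial y) := by
  funext μ
  refine Fin.cases rfl (fun i => rfl) μ

lemma continuous_toMink : Continuous (fun p : ℝ × Space => toMink p.1 p.2) := by
  refine continuous_pi fun μ => ?_
  refine Fin.cases ?_ (fun i => ?_) μ
  · simpa using continuous_fst
  · simp only [toMink_succ]
    fun_prop

lemma continuous_toMink_right (t : ℝ) : Continuous (toMink t) :=
  continuous_toMink.comp (by fun_prop : Continuous fun x : Space => (t, x))

lemma continuous_toMink_left (x : Space) : Continuous (fun t => toMink t x) :=
  continuous_toMink.comp (by fun_prop : Continuous fun t : ℝ => (t, x))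

/-- Translation of a function. -/
def shift (y : Mink) (f : Mink → ℂ) : Mink → ℂ := fun ξ => f (ξ + y)

lemma IsTest.continuous {E : Type*} [NormedAddCommGroup E] [NormedSpace ℝ E] {f : E → ℂ}
    (hf : IsTest f) : Continuous f := hf.smooth.continuous

lemma IsTest.differentiable {E : Type*} [NormedAddCommGroup E] [NormedSpace ℝ E] {f : E → ℂ}
    (hf : IsTest f) : Differentiable ℝ f := hf.smooth.differentiable (by simp)

lemma IsTest.integrable {E : Type*} [NormedAddCommGroup E] [NormedSpace ℝ E] [MeasurableSpace E]
    [OpensMeasurableSpace E] {μ : Measure E} [IsFiniteMeasureOnCompacts μ] {f : E → ℂ}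
    (hf : IsTest f) : Integrable f μ := hf.continuous.integrable_of_hasCompactSupport hf.compact

lemma IsTest.shift {f : Mink → ℂ} (hf : IsTest f) (y : Mink) : IsTest (shift y f) :=
  ⟨hf.smooth.comp (contDiff_id.add contDiff_const),
    hf.compact.comp_homeomorph (Homeomorph.addRight y)⟩

lemma pd_shift (y : Mink) (f : Mink → ℂ) (μ : Fin 4) :
    pd μ (shift y f) = shift y (pd μ f) := by
  funext ξ
  have : fderiv ℝ (shift y f) ξ = fderiv ℝ f (ξ + y) := fderiv_comp_add_right y
  simp only [pd, this, shift]

lemma contDiff_pd {f : Mink → ℂ} (hf : ContDiff ℝ ∞ f) (μ : Fin 4) : ContDiff ℝ ∞ (pd μ f) :=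
  (hf.fderiv_right (m := ∞) (by simp)).clm_apply contDiff_const

lemma IsTest.pd {f : Mink → ℂ} (hf : IsTest f) (μ : Fin 4) : IsTest (pd μ f) :=
  ⟨contDiff_pd hf.smooth μ, hf.compact.fderiv_apply ℝ (Pi.single μ 1)⟩

lemma pd_comm {f : Mink → ℂ} (hf : ContDiff ℝ ∞ f) (μ ν : Fin 4) :
    StringYM.pd μ (StringYM.pd ν f) = StringYM.pd ν (StringYM.pd μ f) := by
  have key : ∀ (α β : Fin 4) (x : Mink), StringYM.pd α (StringYM.pd β f) x =
      fderiv ℝ (fderiv ℝ f) x (Pi.single α 1) (Pi.single β 1) := by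
    intro α β x
    have h1 : DifferentiableAt ℝ (fderiv ℝ f) x :=
      ((hf.fderiv_right (m := ∞) (by simp)).differentiable (by simp)) x
    unfold StringYM.pd
    rw [fderiv_clm_apply h1 (differentiableAt_const _)]
    simp
  funext x
  rw [key, key]
  exact (hf.contDiffAt (x := x)).isSymmSndFDerivAt
    (by simpa using WithTop.coe_le_coe.2 (le_top : (2 : ℕ∞) ≤ ⊤)) _ _

/-! ### Time slices of a test function and their spatial Fourier transforms. -/

lemma exists_bound_slice {f : Mink → ℂ} (hf : IsTest f) :
    ∃ C R : ℝ, 0 ≤ C ∧ 0 ≤ R ∧ ∀ t, ∫ x : Space, ‖f (toMink t x)‖ ≤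
      C * (Set.Icc (-R) R).indicator 1 t := by
  obtain ⟨M, hM⟩ := hf.compact.exists_bound_of_continuous hf.continuous
  obtain ⟨R, hR⟩ := hf.compact.isCompact.isBounded.subset_closedBall (0 : Mink)
  have hM0 : 0 ≤ M := (norm_nonneg _).trans (hM 0)
  have hsupp : ∀ ξ, f ξ ≠ 0 → ∀ μ, |ξ μ| ≤ R := by
    intro ξ hξ μ
    have h1 := hR (subset_tsupport _ hξ)
    rw [mem_closedBall_zero_iff] at h1
    exact (norm_le_pi_norm ξ μ).trans h1
  -- The factor 2 exceeds √3, which compares the Euclidean norm with the supremum norm. The absolute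
  -- value covers a negative R, possible when the support is empty.
  set B : Set Space := Metric.closedBall 0 (2 * |R|) with hB
  have hBfin : volume B < ⊤ := (isCompact_closedBall _ _).measure_lt_top
  have hind : ∀ t x, ‖f (toMink t x)‖ ≤ (Set.Icc (-|R|) |R|).indicator 1 t *
      B.indicator (fun _ => M) x := by
    intro t x
    by_cases h0 : f (toMink t x) = 0
    · rw [h0, norm_zero]
      refine mul_nonneg (Set.indicator_nonneg (fun _ _ => zero_le_one) _)
        (Set.indicator_nonneg (fun _ _ => hM0) _)
    · have h1 := hsupp _ h0
      have ht : t ∈ Set.Icc (-|R|) |R| := by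
        have := (h1 0).trans (le_abs_self R)
        rw [toMink_zero] at this
        exact abs_le.mp this
      have hx : x ∈ B := by
        rw [hB, mem_closedBall_zero_iff, EuclideanSpace.norm_eq]
        refine Real.sqrt_le_iff.mpr ⟨by positivity, ?_⟩
        have h2 : ∀ i : Fin 3, ‖x i‖ ^ 2 ≤ |R| ^ 2 := fun i => by
          have := (h1 i.succ).trans (le_abs_self R)
          rw [toMink_succ] at this
          rw [Real.norm_eq_abs]
          gcongr
        rw [Fin.sum_univ_three]
        nlinarith [h2 0, h2 1, h2 2, sq_nonneg |R|]
      rw [Set.indicator_of_mem ht, Set.indicator_of_mem hx]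
      simpa using hM _
  refine ⟨M * volume.real B, |R|, by positivity, abs_nonneg _, fun t => ?_⟩
  have hi : Integrable (B.indicator (fun _ => M)) (volume : Measure Space) :=
    (integrable_indicator_iff Metric.isClosed_closedBall.measurableSet).2
      (integrableOn_const hBfin.ne)
  calc ∫ x : Space, ‖f (toMink t x)‖
      ≤ ∫ x : Space, (Set.Icc (-|R|) |R|).indicator 1 t * B.indicator (fun _ => M) x :=
        integral_mono_of_nonneg (.of_forall fun _ => norm_nonneg _) (hi.const_mul _)
          (.of_forall fun x => hind t x)
    _ = _ := by
        rw [integral_const_mul, integral_indicator Metric.isClosed_closedBall.measurableSet,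
          setIntegral_const, smul_eq_mul]
        ring

lemma IsTest.slice {f : Mink → ℂ} (hf : IsTest f) (t : ℝ) :
    HasCompactSupport (fun x : Space => f (toMink t x)) := by
  refine HasCompactSupport.of_support_subset_isCompact
    (K := spatial '' tsupport f) (hf.compact.isCompact.image ?_) ?_
  · exact (PiLp.continuous_toLp 2 _).comp (by fun_prop)
  · intro x hx
    refine ⟨toMink t x, subset_tsupport _ hx, ?_⟩
    ext i
    rfl

lemma IsTest.integrable_slice {f : Mink → ℂ} (hf : IsTest f) (t : ℝ) :
    Integrable (fun x : Space => f (toMink t x)) :=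
  (hf.continuous.comp (continuous_toMink_right t)).integrable_of_hasCompactSupport (hf.slice t)

/-- The spatial Fourier transform at fixed time. -/
def sliceHat (f : Mink → ℂ) (t : ℝ) (k : Space) : ℂ :=
  ∫ x : Space, Complex.exp (Complex.I * ((inner ℝ k x : ℝ) : ℂ)) * f (toMink t x)

lemma norm_exp_I_mul (r : ℝ) : ‖Complex.exp (Complex.I * (r : ℂ))‖ = 1 := by
  rw [mul_comm, Complex.norm_exp_ofReal_mul_I]

lemma norm_sliceHat_le (f : Mink → ℂ) (t : ℝ) (k : Space) :
    ‖sliceHat f t k‖ ≤ ∫ x : Space, ‖f (toMink t x)‖ := by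
  refine (norm_integral_le_integral_norm _).trans (le_of_eq ?_)
  simp only [norm_mul, norm_exp_I_mul, one_mul]

lemma hasLineDerivAt_toMink {f : Mink → ℂ} (hf : Differentiable ℝ f) (t : ℝ) (i : Fin 3)
    (x : Space) :
    HasLineDerivAt ℝ (fun x : Space => f (toMink t x)) (pd i.succ f (toMink t x)) x
      (EuclideanSpace.single i 1) := by
  have h := (hf (toMink t x)).hasFDerivAt.hasLineDerivAt (Pi.single i.succ 1)
  unfold HasLineDerivAt at h ⊢
  refine h.congr_of_eventuallyEq (.of_forall fun s => ?_)
  show f _ = f _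
  congr 1
  funext μ
  refine Fin.cases ?_ (fun j => ?_) μ
  · simp
  · simp [Pi.single_apply, Fin.succ_inj]

lemma sliceHat_pd {f : Mink → ℂ} (hf : IsTest f) (i : Fin 3) (t : ℝ) (k : Space) :
    sliceHat (pd i.succ f) t k = -(Complex.I * (k i : ℂ)) * sliceHat f t k := by
  set e : Space → ℂ := fun x => Complex.exp (Complex.I * ((inner ℝ k x : ℝ) : ℂ)) with he
  have hec : Continuous e := by
    rw [he]; fun_prop
  have hd : ∀ x, HasLineDerivAt ℝ e (e x * (Complex.I * (k i : ℂ))) x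
      (EuclideanSpace.single i 1) := by
    intro x
    unfold HasLineDerivAt
    have h1 : HasDerivAt (fun s : ℝ => Complex.I * ((inner ℝ k x + s * k i : ℝ) : ℂ))
        (Complex.I * (k i : ℂ)) 0 := by
      have h2 : HasDerivAt (fun s : ℝ => (inner ℝ k x + s * k i : ℝ)) (k i) 0 := by
        simpa using ((hasDerivAt_id (0 : ℝ)).mul_const (k i)).const_add (inner ℝ k x)
      exact (h2.ofReal_comp).const_mul _
    have h3 := h1.cexp
    simp only [zero_mul, add_zero] at h3
    refine h3.congr_of_eventuallyEq (.of_forall fun s => ?_)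
    simp only [he]
    rw [inner_add_right, inner_smul_right, EuclideanSpace.inner_single_right]
    simp
  have hint : ∀ {h : Mink → ℂ}, IsTest h → Integrable (fun x => e x * h (toMink t x)) :=
    fun {h} hh => (hec.mul (hh.continuous.comp (continuous_toMink_right t))
      ).integrable_of_hasCompactSupport ((hh.slice t).mul_left)
  have key := integral_bilinear_hasLineDerivAt_right_eq_neg_left_of_integrable
    (μ := (volume : Measure Space)) (f := e) (f' := fun x => e x * (Complex.I * (k i : ℂ)))
    (g := fun x => f (toMink t x)) (g' := fun x => pd i.succ f (toMink t x))
    (v := EuclideanSpace.single i 1) (B := ContinuousLinearMap.mul ℝ ℂ)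
    (by simpa [mul_assoc, mul_left_comm] using (hint hf).const_mul (Complex.I * (k i : ℂ)))
    (by simpa using hint (hf.pd i.succ))
    (by simpa using hint hf) (fun x _ => hd x)
    (fun x _ => hasLineDerivAt_toMink hf.differentiable t i x)
  simp only [ContinuousLinearMap.mul_apply'] at key
  unfold sliceHat
  rw [key, neg_mul, ← integral_const_mul]
  congr 2
  funext x
  ring

lemma shift_toMink (y : Mink) (f : Mink → ℂ) (t : ℝ) (x : Space) :
    shift y f (toMink t x) = f (toMink (t + y 0) (x + spatial y)) := by
  rw [shift, toMink_add]

lemma integral_norm_slice_shift (y : Mink) (f : Mink → ℂ) (t : ℝ) :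
    ∫ x : Space, ‖shift y f (toMink t x)‖ = ∫ x : Space, ‖f (toMink (t + y 0) x)‖ := by
  simp only [shift_toMink]
  exact integral_add_right_eq_self (fun x => ‖f (toMink (t + y 0) x)‖) (spatial y)

lemma norm_pow_four_le (k : Space) : ‖k‖ ^ 4 ≤ 3 * ∑ i, (k i) ^ 4 := by
  have h : ‖k‖ ^ 2 = ∑ i, k i ^ 2 := by
    rw [EuclideanSpace.norm_eq, Real.sq_sqrt (by positivity)]
    simp
  have : ‖k‖ ^ 4 = (∑ i, k i ^ 2) ^ 2 := by rw [← h]; ring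
  rw [this]
  simp only [Fin.sum_univ_three]
  nlinarith [sq_nonneg (k 0 ^ 2 - k 1 ^ 2), sq_nonneg (k 0 ^ 2 - k 2 ^ 2),
    sq_nonneg (k 1 ^ 2 - k 2 ^ 2)]

/-- Four derivatives in a coordinate direction become the factor k_i⁴, and the sum of these controls
|k|⁴. The bound is uniform in y, because translating `f` preserves the L¹ norms of its slices and
only shifts their times. The order four makes the integral over k absolutely convergent. -/
lemma exists_bound_sliceHat {f : Mink → ℂ} (hf : IsTest f) :
    ∃ C R : ℝ, 0 ≤ C ∧ 0 ≤ R ∧ ∀ y t k, ‖sliceHat (shift y f) t k‖ * (1 + ‖k‖ ^ 4) ≤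
      C * (Set.Icc (-R) R).indicator 1 (t + y 0) := by
  let D : Fin 3 → Mink → ℂ := fun i =>
    pd i.succ (pd i.succ (pd i.succ (pd i.succ f)))
  have hD : ∀ i, IsTest (D i) := fun i => (((hf.pd _).pd _).pd _).pd _
  obtain ⟨C0, R0, hC0, hR0, h0⟩ := exists_bound_slice hf
  choose C1 R1 hC1 hR1 h1 using fun i => exists_bound_slice (hD i)
  have hR1le : ∀ i, R1 i ≤ ∑ j, R1 j := fun i =>
    Finset.single_le_sum (f := R1) (fun j _ => hR1 j) (Finset.mem_univ i)
  have hR1n : 0 ≤ ∑ j, R1 j := Finset.sum_nonneg fun j _ => hR1 j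
  set R := R0 + ∑ i, R1 i with hR
  have hmono : ∀ {r t : ℝ}, r ≤ R → (Set.Icc (-r) r).indicator (1 : ℝ → ℝ) t ≤
      (Set.Icc (-R) R).indicator 1 t := fun {r t} hr =>
    Set.indicator_le_indicator_of_subset (Set.Icc_subset_Icc (by linarith) hr)
      (fun _ => zero_le_one) t
  refine ⟨C0 + 3 * ∑ i, C1 i, R, ?_, by positivity, fun y t k => ?_⟩
  · have := Finset.sum_nonneg (s := Finset.univ) fun i _ => hC1 i
    linarith
  have hb0 : ‖sliceHat (shift y f) t k‖ ≤ C0 * (Set.Icc (-R) R).indicator 1 (t + y 0) := by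
    refine (norm_sliceHat_le _ _ _).trans ?_
    rw [integral_norm_slice_shift]
    exact (h0 _).trans (mul_le_mul_of_nonneg_left (hmono (by linarith)) hC0)
  have hb1 : ∀ i, ‖sliceHat (shift y f) t k‖ * k i ^ 4 ≤
      C1 i * (Set.Icc (-R) R).indicator 1 (t + y 0) := by
    intro i
    have hf' := hf.shift y
    have e1 : sliceHat (shift y (D i)) t k = (k i : ℂ) ^ 4 * sliceHat (shift y f) t k := by
      simp only [D, ← pd_shift]
      rw [sliceHat_pd (((hf'.pd _).pd _).pd _), sliceHat_pd ((hf'.pd _).pd _),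
        sliceHat_pd (hf'.pd _), sliceHat_pd hf']
      have := Complex.I_pow_four
      linear_combination ((k i : ℂ) ^ 4 * sliceHat (shift y f) t k) * this
    have e2 : ‖sliceHat (shift y f) t k‖ * k i ^ 4 = ‖sliceHat (shift y (D i)) t k‖ := by
      rw [e1, norm_mul, norm_pow, Complex.norm_real, Real.norm_eq_abs, mul_comm,
        Even.pow_abs (by decide)]
    rw [e2]
    refine (norm_sliceHat_le _ _ _).trans ?_
    rw [integral_norm_slice_shift]
    exact (h1 i _).trans (mul_le_mul_of_nonneg_left (hmono (by linarith [hR1le i])) (hC1 i))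
  calc ‖sliceHat (shift y f) t k‖ * (1 + ‖k‖ ^ 4)
      ≤ ‖sliceHat (shift y f) t k‖ * (1 + 3 * ∑ i, (k i) ^ 4) := by
        gcongr; exact norm_pow_four_le k
    _ = ‖sliceHat (shift y f) t k‖ + 3 * ∑ i, ‖sliceHat (shift y f) t k‖ * k i ^ 4 := by
        rw [← Finset.mul_sum]; ring
    _ ≤ C0 * (Set.Icc (-R) R).indicator 1 (t + y 0) +
        3 * ∑ i, C1 i * (Set.Icc (-R) R).indicator 1 (t + y 0) := by
        exact add_le_add hb0 (mul_le_mul_of_nonneg_left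
          (Finset.sum_le_sum fun i _ => hb1 i) (by norm_num))
    _ = _ := by rw [← Finset.sum_mul]; ring

/-! ### The time-ordered function in momentum space and its high-frequency cutoff. -/

/-- The momentum space kernel of the time-ordered function. -/
def modeKernel (t : ℝ) (k : Space) : ℂ :=
  Complex.exp (-Complex.I * (‖k‖ : ℂ) * ((|t| : ℝ) : ℂ)) /
        (((2 * Real.pi) ^ 3 * (2 * ‖k‖) : ℝ) : ℂ)

/-- The time-ordered function with an exponential high-frequency cutoff. -/
def T0cut (ε : ℝ) (f : Mink → ℂ) : ℂ :=
  ∫ t : ℝ, ∫ k : Space, Complex.exp (((-(ε * ‖k‖) : ℝ)) : ℂ) * (modeKernel t k * sliceHat f t k)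

lemma T0_eq (f : Mink → ℂ) : T0 f = ∫ t : ℝ, ∫ k : Space, modeKernel t k * sliceHat f t k := rfl

lemma norm_modeKernel_le (t : ℝ) (k : Space) : ‖modeKernel t k‖ ≤ ‖k‖⁻¹ := by
  have h1 : ‖Complex.exp (-Complex.I * (‖k‖ : ℂ) * ((|t| : ℝ) : ℂ))‖ = 1 := by
    have : -Complex.I * (‖k‖ : ℂ) * ((|t| : ℝ) : ℂ) = Complex.I * ((-(‖k‖ * |t|) : ℝ) : ℂ) := by
      push_cast; ring
    rw [this, norm_exp_I_mul]
  rw [modeKernel, norm_div, h1, Complex.norm_real, Real.norm_eq_abs]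
  rcases eq_or_ne ‖k‖ 0 with h | h
  · simp [h]
  · have hk : 0 < ‖k‖ := lt_of_le_of_ne (norm_nonneg _) h.symm
    rw [abs_of_pos (by positivity), one_div]
    refine inv_anti₀ hk ?_
    have hp := Real.pi_gt_three
    have h3 : (1 : ℝ) ≤ (2 * Real.pi) ^ 3 := one_le_pow₀ (by linarith)
    nlinarith

lemma measurable_modeKernel : Measurable (fun p : ℝ × Space => modeKernel p.1 p.2) := by
  unfold modeKernel
  fun_prop

/-- In polar coordinates the density is r/(1+r⁴), which is at most 1/(1+r²) since 1 - r - r³ + r⁴ =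
(1-r)²(1+r+r²). -/
lemma integrable_weight :
    Integrable (fun k : Space => ‖k‖⁻¹ * (1 + ‖k‖ ^ 4)⁻¹) := by
  refine (integrable_fun_norm_addHaar (E := Space) volume
    (f := fun r : ℝ => r⁻¹ * (1 + r ^ 4)⁻¹)).2 ?_
  have hd : Module.finrank ℝ Space = 3 := by simp
  rw [hd]
  refine Integrable.mono' (integrable_inv_one_add_sq.integrableOn) ?_ ?_
  · exact Measurable.aestronglyMeasurable (by fun_prop)
  · refine (ae_restrict_iff' measurableSet_Ioi).2 (.of_forall fun r hr => ?_)
    have hr : 0 < r := hr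
    rw [smul_eq_mul, Real.norm_of_nonneg (by positivity)]
    have e : r ^ (3 - 1) * (r⁻¹ * (1 + r ^ 4)⁻¹) = r / (1 + r ^ 4) := by
      field_simp
    rw [e, ← one_div, div_le_div_iff₀ (by positivity) (by positivity)]
    nlinarith [mul_nonneg (sq_nonneg (1 - r)) (by positivity : 0 ≤ 1 + r + r ^ 2)]

lemma measurable_sliceHat {f : Mink → ℂ} (hf : Continuous f) :
    StronglyMeasurable (fun p : ℝ × Space => sliceHat f p.1 p.2) := by
  unfold sliceHat
  refine StronglyMeasurable.integral_prod_right (E := ℂ) (f := fun (p : ℝ × Space) (x : Space) =>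
    Complex.exp (Complex.I * ((inner ℝ p.2 x : ℝ) : ℂ)) * f (toMink p.1 x)) ?_
  refine Continuous.stronglyMeasurable ?_
  have h1 : Continuous (fun q : (ℝ × Space) × Space => f (toMink q.1.1 q.2)) :=
    hf.comp (continuous_toMink.comp (by fun_prop : Continuous
      fun q : (ℝ × Space) × Space => (q.1.1, q.2)))
  have h2 : Continuous (fun q : (ℝ × Space) × Space =>
      Complex.exp (Complex.I * ((inner ℝ q.1.2 q.2 : ℝ) : ℂ))) := by fun_prop
  exact h2.mul h1

/-- One integrable majorant serves all cutoffs ε ≥ 0, including ε = 0, and up to a time shift all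
translations. It supplies Fubini, the limit ε → 0 and the bounds uniform in ε and y. -/
lemma exists_dominating {f : Mink → ℂ} (hf : IsTest f) :
    ∃ C R : ℝ, 0 ≤ C ∧ 0 ≤ R ∧ ∀ y, ∀ ε, 0 ≤ ε → ∀ p : ℝ × Space,
      ‖Complex.exp (((-(ε * ‖p.2‖) : ℝ)) : ℂ) *
        (modeKernel p.1 p.2 * sliceHat (shift y f) p.1 p.2)‖ ≤
      (Set.Icc (-R) R).indicator (fun _ => C) (p.1 + y 0) * (‖p.2‖⁻¹ * (1 + ‖p.2‖ ^ 4)⁻¹) := by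
  obtain ⟨C, R, hC, hR, h⟩ := exists_bound_sliceHat hf
  refine ⟨C, R, hC, hR, fun y ε hε p => ?_⟩
  have h1 : ‖Complex.exp (((-(ε * ‖p.2‖) : ℝ)) : ℂ)‖ ≤ 1 := by
    rw [Complex.norm_exp_ofReal]
    exact Real.exp_le_one_iff.2 (neg_nonpos.2 (by positivity))
  have h2 := h y p.1 p.2
  have h3 : (Set.Icc (-R) R).indicator (fun _ => C) (p.1 + y 0) =
      C * (Set.Icc (-R) R).indicator 1 (p.1 + y 0) := by
    by_cases hm : p.1 + y 0 ∈ Set.Icc (-R) R <;> simp [hm]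
  rw [← le_div_iff₀ (by positivity), ← h3] at h2
  calc _ ≤ 1 * (‖p.2‖⁻¹ * ‖sliceHat (shift y f) p.1 p.2‖) := by
        rw [norm_mul, norm_mul]
        gcongr
        exact norm_modeKernel_le _ _
    _ ≤ 1 * (‖p.2‖⁻¹ * ((Set.Icc (-R) R).indicator (fun _ => C) (p.1 + y 0) /
          (1 + ‖p.2‖ ^ 4))) := by gcongr
    _ = _ := by rw [div_eq_mul_inv]; ring

lemma integrable_dominating (C R : ℝ) (y : Mink) :
    Integrable (fun p : ℝ × Space => (Set.Icc (-R) R).indicator (fun _ => C) (p.1 + y 0) *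
      (‖p.2‖⁻¹ * (1 + ‖p.2‖ ^ 4)⁻¹)) := by
  refine Integrable.mul_prod (f := fun t => (Set.Icc (-R) R).indicator (fun _ => C) (t + y 0))
    ?_ integrable_weight
  refine Integrable.comp_add_right (f := (Set.Icc (-R) R).indicator (fun _ => C)) ?_ (y 0)
  exact (integrable_indicator_iff measurableSet_Icc).2 (integrableOn_const (by simp))

lemma shift_zero (f : Mink → ℂ) : shift 0 f = f := by
  funext ξ
  simp [shift]

lemma aestronglyMeasurable_cut {f : Mink → ℂ} (hf : Continuous f) (ε : ℝ) :
    AEStronglyMeasurable (fun p : ℝ × Space => Complex.exp (((-(ε * ‖p.2‖) : ℝ)) : ℂ) *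
      (modeKernel p.1 p.2 * sliceHat f p.1 p.2)) := by
  refine AEStronglyMeasurable.mul ?_ (AEStronglyMeasurable.mul ?_ ?_)
  · exact Continuous.aestronglyMeasurable (by fun_prop)
  · exact measurable_modeKernel.aestronglyMeasurable
  · exact (measurable_sliceHat hf).aestronglyMeasurable

lemma integrable_cut {f : Mink → ℂ} (hf : IsTest f) {ε : ℝ} (hε : 0 ≤ ε) :
    Integrable (fun p : ℝ × Space => Complex.exp (((-(ε * ‖p.2‖) : ℝ)) : ℂ) *
      (modeKernel p.1 p.2 * sliceHat f p.1 p.2)) := by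
  obtain ⟨C, R, -, -, h⟩ := exists_dominating hf
  refine (integrable_dominating C R 0).mono' (aestronglyMeasurable_cut hf.continuous ε)
    (.of_forall fun p => ?_)
  simpa only [shift_zero] using h 0 ε hε p

lemma T0cut_eq_prod {f : Mink → ℂ} (hf : IsTest f) {ε : ℝ} (hε : 0 ≤ ε) :
    T0cut ε f = ∫ p : ℝ × Space, Complex.exp (((-(ε * ‖p.2‖) : ℝ)) : ℂ) *
      (modeKernel p.1 p.2 * sliceHat f p.1 p.2) :=
  (integral_prod _ (integrable_cut hf hε)).symm

lemma T0cut_zero (f : Mink → ℂ) : T0cut 0 f = T0 f := by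
  simp [T0cut, T0_eq]

lemma tendsto_T0cut {f : Mink → ℂ} (hf : IsTest f) :
    Tendsto (fun ε => T0cut ε f) (𝓝[>] 0) (𝓝 (T0 f)) := by
  obtain ⟨C, R, -, -, h⟩ := exists_dominating hf
  rw [← T0cut_zero, T0cut_eq_prod hf le_rfl]
  have : (fun ε => T0cut ε f) =ᶠ[𝓝[>] 0] fun ε => ∫ p : ℝ × Space,
      Complex.exp (((-(ε * ‖p.2‖) : ℝ)) : ℂ) * (modeKernel p.1 p.2 * sliceHat f p.1 p.2) := by
    filter_upwards [self_mem_nhdsWithin] with ε hε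
    exact T0cut_eq_prod hf (le_of_lt hε)
  rw [tendsto_congr' this]
  refine tendsto_integral_filter_of_dominated_convergence _
    (.of_forall fun ε => aestronglyMeasurable_cut hf.continuous ε) ?_
    (integrable_dominating C R 0) ?_
  · filter_upwards [self_mem_nhdsWithin] with ε hε
    refine .of_forall fun p => ?_
    simpa only [shift_zero] using h 0 ε (le_of_lt hε) p
  · refine .of_forall fun p => ?_
    refine Tendsto.mul_const _ (Tendsto.mono_left ?_ nhdsWithin_le_nhds)
    exact Continuous.tendsto (by fun_prop) 0

lemma exists_bound_T0cut {f : Mink → ℂ} (hf : IsTest f) :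
    ∃ C : ℝ, 0 ≤ C ∧ ∀ ε, 0 ≤ ε → ∀ y, ‖T0cut ε (shift y f)‖ ≤ C := by
  obtain ⟨C, R, hC, -, h⟩ := exists_dominating hf
  refine ⟨‖∫ p : ℝ × Space, (Set.Icc (-R) R).indicator (fun _ => C) p.1 *
      (‖p.2‖⁻¹ * (1 + ‖p.2‖ ^ 4)⁻¹)‖, norm_nonneg _, fun ε hε y => ?_⟩
  rw [T0cut_eq_prod (hf.shift y) hε]
  refine (norm_integral_le_of_norm_le (integrable_dominating C R y)
    (.of_forall fun p => h y ε hε p)).trans ?_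
  refine le_trans (le_of_eq ?_) (le_abs_self _)
  rw [Measure.volume_eq_prod, integral_prod_mul (fun t => (Set.Icc (-R) R).indicator (fun _ => C)
    (t + y 0)) (fun k : Space => ‖k‖⁻¹ * (1 + ‖k‖ ^ 4)⁻¹),
    integral_prod_mul (fun t => (Set.Icc (-R) R).indicator (fun _ => C) t)
    (fun k : Space => ‖k‖⁻¹ * (1 + ‖k‖ ^ 4)⁻¹),
    integral_add_right_eq_self (fun t => (Set.Icc (-R) R).indicator (fun _ => C) t) (y 0)]

/-! ### Splitting off a coordinate, and the Fourier transform of e^{-z|k|}/|k|. -/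

/-- The vector in `ℝⁿ⁺¹` with given first coordinate and remaining coordinates. -/
def consE {n : ℕ} (a : ℝ) (p : EuclideanSpace ℝ (Fin n)) : EuclideanSpace ℝ (Fin (n + 1)) :=
  WithLp.toLp 2 (Fin.cons a (fun i => p i))

/-- Splitting off the first coordinate, as a measurable equivalence. -/
def consEquiv (n : ℕ) : ℝ × EuclideanSpace ℝ (Fin n) ≃ᵐ (Fin (n + 1) → ℝ) :=
  ((MeasurableEquiv.refl ℝ).prodCongr (MeasurableEquiv.toLp 2 (Fin n → ℝ)).symm).trans
    (MeasurableEquiv.piFinSuccAbove (fun _ => ℝ) 0).symm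

lemma consEquiv_apply {n : ℕ} (p : ℝ × EuclideanSpace ℝ (Fin n)) :
    consEquiv n p = Fin.cons p.1 (fun i => p.2 i) := by
  simp only [consEquiv, MeasurableEquiv.coe_trans, Function.comp_apply]
  simp only [MeasurableEquiv.piFinSuccAbove, Fin.insertNthEquiv]
  funext i
  refine Fin.cases rfl (fun j => rfl) i

lemma measurePreserving_consEquiv (n : ℕ) : MeasurePreserving (consEquiv n) := by
  refine MeasurePreserving.trans (μb := (volume : Measure (ℝ × (Fin n → ℝ)))) ?_ ?_
  · exact (MeasurePreserving.id (volume : Measure ℝ)).prod (PiLp.volume_preserving_ofLp (Fin n))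
  · exact (volume_preserving_piFinSuccAbove (fun _ : Fin (n + 1) => ℝ) 0).symm _

lemma integrable_comp_toMink {f : Mink → ℂ} (hf : Integrable f) :
    Integrable (fun p : ℝ × Space => f (toMink p.1 p.2)) := by
  have := ((measurePreserving_consEquiv 3).integrable_comp_emb
    (consEquiv 3).measurableEmbedding (g := f)).2 hf
  refine this.congr (.of_forall fun p => ?_)
  simp only [Function.comp_apply, consEquiv_apply]
  rfl

lemma integral_mink {f : Mink → ℂ} (hf : Integrable f) :
    ∫ ξ, f ξ = ∫ t : ℝ, ∫ x : Space, f (toMink t x) := by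
  have h := (measurePreserving_consEquiv 3).integral_comp' (g := f)
  rw [← h, ← integral_prod (fun p : ℝ × Space => f (toMink p.1 p.2)) (integrable_comp_toMink hf)]
  refine integral_congr_ae (.of_forall fun p => ?_)
  simp only [consEquiv_apply]
  rfl

lemma integral_space {n : ℕ} {G : EuclideanSpace ℝ (Fin (n + 1)) → ℂ} (hG : Integrable G) :
    ∫ k, G k = ∫ a : ℝ, ∫ p : EuclideanSpace ℝ (Fin n), G (consE a p) := by
  set e := (consEquiv n).trans (MeasurableEquiv.toLp 2 (Fin (n + 1) → ℝ)) with he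
  have hmp : MeasurePreserving e :=
    (measurePreserving_consEquiv n).trans (PiLp.volume_preserving_toLp (Fin (n + 1)))
  have hap : ∀ p, e p = consE p.1 p.2 := by
    intro p
    simp only [he, MeasurableEquiv.coe_trans, Function.comp_apply, consEquiv_apply]
    rfl
  rw [← hmp.integral_comp' (g := G), ← integral_prod (fun p => G (consE p.1 p.2))]
  · simp only [hap]
    rfl
  · have := (hmp.integrable_comp_emb e.measurableEmbedding (g := G)).2 hG
    exact this.congr (.of_forall fun p => by simp [hap])

lemma norm_consE {n : ℕ} (a : ℝ) (p : EuclideanSpace ℝ (Fin n)) :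
    ‖consE a p‖ = √(a ^ 2 + ‖p‖ ^ 2) := by
  rw [EuclideanSpace.norm_eq, EuclideanSpace.norm_eq p, Real.sq_sqrt (by positivity),
    Fin.sum_univ_succ]
  simp [consE]

/-- The Jacobian r of polar coordinates in the plane, divided by √(a²+r²), is the derivative of that
square root. Hence the radial integral over the plane is elementary. -/
lemma hasDerivAt_exp_sqrt {a : ℝ} (ha : a ≠ 0) {z : ℂ} (hz : z ≠ 0) (r : ℝ) :
    HasDerivAt (fun r : ℝ => -Complex.exp (-z * ((√(a ^ 2 + r ^ 2) : ℝ) : ℂ)) / z)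
      ((r : ℂ) * (Complex.exp (-z * ((√(a ^ 2 + r ^ 2) : ℝ) : ℂ)) /
        ((√(a ^ 2 + r ^ 2) : ℝ) : ℂ))) r := by
  have hpos : 0 < a ^ 2 + r ^ 2 := by positivity
  have h1 : HasDerivAt (fun r : ℝ => √(a ^ 2 + r ^ 2)) (r / √(a ^ 2 + r ^ 2)) r := by
    have := ((hasDerivAt_pow 2 r).const_add (a ^ 2)).sqrt hpos.ne'
    convert this using 1
    field_simp
    simp [mul_comm]
  have h2 := (((h1.ofReal_comp).const_mul (-z)).cexp.neg).div_const z
  refine h2.congr_deriv ?_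
  have hs : ((√(a ^ 2 + r ^ 2) : ℝ) : ℂ) ≠ 0 := by
    exact_mod_cast (Real.sqrt_pos.2 hpos).ne'
  push_cast
  field_simp

lemma norm_exp_neg_mul_ofReal (z : ℂ) (s : ℝ) :
    ‖Complex.exp (-z * (s : ℂ))‖ = Real.exp (-z.re * s) := by
  rw [Complex.norm_exp]
  simp

lemma tendsto_exp_sqrt (a : ℝ) {x : ℝ} (hx : 0 < x) :
    Tendsto (fun r : ℝ => Real.exp (-x * √(a ^ 2 + r ^ 2))) atTop (𝓝 0) := by
  refine Real.tendsto_exp_atBot.comp ?_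
  refine Tendsto.const_mul_atTop_of_neg (by linarith) ?_
  refine tendsto_atTop_mono (fun r => ?_) tendsto_id
  exact (le_abs_self r).trans (Real.abs_le_sqrt (by nlinarith [sq_nonneg a]))

lemma integrableOn_exp_sqrt {a : ℝ} (ha : a ≠ 0) {z : ℂ} (hz : 0 < z.re) :
    IntegrableOn (fun r : ℝ => (r : ℂ) * (Complex.exp (-z * ((√(a ^ 2 + r ^ 2) : ℝ) : ℂ)) /
      ((√(a ^ 2 + r ^ 2) : ℝ) : ℂ))) (Set.Ioi 0) := by
  have hre : IntegrableOn (fun r : ℝ => r * (Real.exp (-z.re * √(a ^ 2 + r ^ 2)) /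
      √(a ^ 2 + r ^ 2))) (Set.Ioi 0) := by
    refine integrableOn_Ioi_deriv_of_nonneg' (g := fun r => -Real.exp (-z.re * √(a ^ 2 + r ^ 2)) /
      z.re) (l := -0 / z.re) (fun r _ => ?_) (fun r hr => ?_) ?_
    · have hpos : 0 < a ^ 2 + r ^ 2 := by positivity
      have h1 : HasDerivAt (fun r : ℝ => √(a ^ 2 + r ^ 2)) (r / √(a ^ 2 + r ^ 2)) r := by
        have := ((hasDerivAt_pow 2 r).const_add (a ^ 2)).sqrt hpos.ne'
        convert this using 1
        field_simp
        simp [mul_comm]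
      have h2 := ((h1.const_mul (-z.re)).exp.neg).div_const z.re
      refine h2.congr_deriv ?_
      field_simp
    · have : (0 : ℝ) < r := hr
      positivity
    · exact (tendsto_exp_sqrt a hz).neg.div_const _
  refine hre.mono' (Measurable.aestronglyMeasurable (by fun_prop)) ?_
  refine (ae_restrict_iff' measurableSet_Ioi).2 (.of_forall fun r hr => ?_)
  have hr : (0 : ℝ) < r := hr
  rw [norm_mul, norm_div, norm_exp_neg_mul_ofReal, Complex.norm_real, Complex.norm_real,
    Real.norm_of_nonneg hr.le, Real.norm_of_nonneg (Real.sqrt_nonneg _)]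

lemma integral_exp_norm_plane {a : ℝ} (ha : a ≠ 0) {z : ℂ} (hz : 0 < z.re) :
    ∫ p : EuclideanSpace ℝ (Fin 2), Complex.exp (-z * ((√(a ^ 2 + ‖p‖ ^ 2) : ℝ) : ℂ)) /
      ((√(a ^ 2 + ‖p‖ ^ 2) : ℝ) : ℂ) =
    2 * Real.pi * Complex.exp (-z * ((|a| : ℝ) : ℂ)) / z := by
  have hz0 : z ≠ 0 := fun h => by simp [h] at hz
  rw [integral_fun_norm_addHaar (E := EuclideanSpace ℝ (Fin 2)) volume
    (fun r => Complex.exp (-z * ((√(a ^ 2 + r ^ 2) : ℝ) : ℂ)) / ((√(a ^ 2 + r ^ 2) : ℝ) : ℂ))]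
  have hd : Module.finrank ℝ (EuclideanSpace ℝ (Fin 2)) = 2 := by simp
  have hv : volume.real (Metric.ball (0 : EuclideanSpace ℝ (Fin 2)) 1) = Real.pi := by
    rw [measureReal_def, EuclideanSpace.volume_ball_fin_two]
    simp [Real.pi_pos.le]
  have hI : ∫ r in Set.Ioi (0 : ℝ), (r : ℂ) * (Complex.exp (-z * ((√(a ^ 2 + r ^ 2) : ℝ) : ℂ)) /
      ((√(a ^ 2 + r ^ 2) : ℝ) : ℂ)) = 0 - -Complex.exp (-z * ((√(a ^ 2 + 0 ^ 2) : ℝ) : ℂ)) / z := by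
    refine integral_Ioi_of_hasDerivAt_of_tendsto' (fun r _ => hasDerivAt_exp_sqrt ha hz0 r)
      (integrableOn_exp_sqrt ha hz) ?_
    rw [tendsto_zero_iff_norm_tendsto_zero]
    have := (tendsto_exp_sqrt a hz).div_const ‖z‖
    rw [zero_div] at this
    refine this.congr fun r => ?_
    rw [norm_div, norm_neg, norm_exp_neg_mul_ofReal]
  rw [hd, hv]
  simp only [Nat.add_one_sub_one, pow_one, Complex.real_smul]
  rw [hI]
  have : √(a ^ 2 + 0 ^ 2) = |a| := by simp [Real.sqrt_sq_eq_abs]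
  rw [this, zero_sub, neg_div, neg_neg, nsmul_eq_mul]
  push_cast
  ring

lemma integrable_exp_norm_div {z : ℂ} (hz : 0 < z.re) :
    Integrable (fun k : Space => Complex.exp (-z * (‖k‖ : ℂ)) / (‖k‖ : ℂ)) := by
  refine (integrable_fun_norm_addHaar (E := Space) volume
    (f := fun r : ℝ => Complex.exp (-z * (r : ℂ)) / (r : ℂ))).2 ?_
  have hd : Module.finrank ℝ Space = 3 := by simp
  rw [hd]
  have hg := Real.GammaIntegral_convergent (s := 2) (by norm_num)
  have hg2 : IntegrableOn (fun r : ℝ => r * Real.exp (-z.re * r)) (Set.Ioi 0) := by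
    have h3 := (integrableOn_Ioi_comp_mul_left_iff (fun x => Real.exp (-x) * x ^ ((2 : ℝ) - 1)) 0
      hz).2 (by simpa using hg)
    refine IntegrableOn.congr_fun (h3.const_mul z.re⁻¹) (fun r _ => ?_) measurableSet_Ioi
    have : (2 : ℝ) - 1 = 1 := by norm_num
    simp only [this, Real.rpow_one]
    field_simp
  refine hg2.mono' (Measurable.aestronglyMeasurable (by fun_prop)) ?_
  refine (ae_restrict_iff' measurableSet_Ioi).2 (.of_forall fun r hr => ?_)
  have hr : (0 : ℝ) < r := hr
  rw [norm_smul, norm_div, norm_exp_neg_mul_ofReal, Complex.norm_real, norm_pow,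
    Real.norm_of_nonneg hr.le]
  refine le_of_eq ?_
  field_simp

lemma integral_exp_neg_abs {z : ℂ} {R : ℝ} (hz : 0 < z.re) :
    ∫ a : ℝ, Complex.exp (-z * ((|a| : ℝ) : ℂ)) * Complex.exp (Complex.I * ((R * a : ℝ) : ℂ)) =
      1 / (z + Complex.I * R) + 1 / (z - Complex.I * R) := by
  have h1 : ∀ a ∈ Set.Iic (0 : ℝ), Complex.exp (-z * ((|a| : ℝ) : ℂ)) *
      Complex.exp (Complex.I * ((R * a : ℝ) : ℂ)) = Complex.exp ((z + Complex.I * R) * a) := by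
    intro a ha
    rw [abs_of_nonpos ha, ← Complex.exp_add]
    congr 1
    push_cast; ring
  have h2 : ∀ a ∈ Set.Ioi (0 : ℝ), Complex.exp (-z * ((|a| : ℝ) : ℂ)) *
      Complex.exp (Complex.I * ((R * a : ℝ) : ℂ)) = Complex.exp (-(z - Complex.I * R) * a) := by
    intro a ha
    rw [abs_of_pos ha, ← Complex.exp_add]
    congr 1
    push_cast; ring
  have r1 : 0 < (z + Complex.I * R).re := by simpa using hz
  have r2 : (-(z - Complex.I * R)).re < 0 := by simpa using hz
  rw [← intervalIntegral.integral_Iic_add_Ioi (b := (0 : ℝ))]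
  · rw [setIntegral_congr_fun measurableSet_Iic h1, setIntegral_congr_fun measurableSet_Ioi h2,
      integral_exp_mul_complex_Iic r1, integral_exp_mul_complex_Ioi r2]
    simp [neg_div]
    rw [← neg_sub, inv_neg, neg_neg]
  · exact (integrableOn_exp_mul_complex_Iic r1 0).congr_fun (fun a ha => (h1 a ha).symm)
      measurableSet_Iic
  · exact (integrableOn_exp_mul_complex_Ioi r2 0).congr_fun (fun a ha => (h2 a ha).symm)
      measurableSet_Ioi

lemma exists_isometry_map {x y : Space} (h : ‖x‖ = ‖y‖) : ∃ L : Space ≃ₗᵢ[ℝ] Space, L x = y :=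
  ⟨_, Submodule.reflection_sub h⟩

/-- The Fourier transform of `e^{-z|k|}/|k|` in three dimensions. -/
lemma integral_exp_norm_div_mul_exp {z : ℂ} (hz : 0 < z.re) (x : Space) :
    ∫ k : Space, Complex.exp (-z * (‖k‖ : ℂ)) / (‖k‖ : ℂ) *
      Complex.exp (Complex.I * ((inner ℝ k x : ℝ) : ℂ)) =
    4 * Real.pi / (z ^ 2 + (‖x‖ : ℂ) ^ 2) := by
  have hz0 : z ≠ 0 := fun h => by simp [h] at hz
  set R := ‖x‖ with hR
  set e0 : Space := EuclideanSpace.single 0 R with he0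
  have hn : ‖e0‖ = ‖x‖ := by simp [he0, hR]
  -- The weight is rotation invariant, so x can be put on the first axis. The phase then depends on
  -- the first coordinate of k only, the other two integrate to 2π e^{-z|a|}/z, and a
  -- one-dimensional Fourier transform remains.
  obtain ⟨L, hL⟩ := exists_isometry_map hn
  have s1 : ∫ k : Space, Complex.exp (-z * (‖k‖ : ℂ)) / (‖k‖ : ℂ) *
      Complex.exp (Complex.I * ((inner ℝ k x : ℝ) : ℂ)) =
      ∫ k : Space, Complex.exp (-z * (‖k‖ : ℂ)) / (‖k‖ : ℂ) *
      Complex.exp (Complex.I * ((inner ℝ k e0 : ℝ) : ℂ)) := by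
    rw [← (L.measurePreserving).integral_comp L.toHomeomorph.measurableEmbedding]
    refine integral_congr_ae (.of_forall fun k => ?_)
    simp only [L.norm_map, ← hL, L.inner_map_map]
  rw [s1, integral_space]
  · have s2 : ∀ᵐ a : ℝ, ∫ p : EuclideanSpace ℝ (Fin 2),
        Complex.exp (-z * (‖consE a p‖ : ℂ)) / (‖consE a p‖ : ℂ) *
          Complex.exp (Complex.I * ((inner ℝ (consE a p) e0 : ℝ) : ℂ)) =
        2 * Real.pi / z * (Complex.exp (-z * ((|a| : ℝ) : ℂ)) *
          Complex.exp (Complex.I * ((R * a : ℝ) : ℂ))) := by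
      have hae : ∀ᵐ a : ℝ, a ≠ 0 := by simp [ae_iff, measure_singleton]
      filter_upwards [hae] with a ha
      have hin : ∀ p : EuclideanSpace ℝ (Fin 2), inner ℝ (consE a p) e0 = R * a := by
        intro p
        rw [he0, EuclideanSpace.inner_single_right]
        simp [consE]
      simp only [hin, norm_consE]
      rw [integral_mul_const, integral_exp_norm_plane ha hz]
      ring
    rw [integral_congr_ae s2, integral_const_mul, integral_exp_neg_abs hz]
    have n1 : z + Complex.I * R ≠ 0 := fun h => by
      have := congrArg Complex.re h
      simp at this; linarith
    have n2 : z - Complex.I * R ≠ 0 := fun h => by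
      have := congrArg Complex.re h
      simp at this; linarith
    have n3 : z ^ 2 + (R : ℂ) ^ 2 = (z + Complex.I * R) * (z - Complex.I * R) := by
      linear_combination ((R : ℂ) ^ 2) * Complex.I_sq
    rw [n3, div_add_div _ _ n1 n2,
      show 1 * (z - Complex.I * R) + (z + Complex.I * R) * 1 = 2 * z by ring]
    generalize (z + Complex.I * (R : ℂ)) * (z - Complex.I * R) = q
    field_simp
    ring
  · refine (integrable_exp_norm_div hz).mul_bdd (c := 1) (Continuous.aestronglyMeasurable
      (by fun_prop)) (.of_forall fun k => (norm_exp_I_mul _).le)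

/-- Differentiation under an integral over a compact set. -/
lemma hasFDerivAt_setIntegral_of_isCompact {E Y : Type*} [NormedAddCommGroup E] [NormedSpace ℝ E]
    [ProperSpace E] [TopologicalSpace Y] [MeasurableSpace Y] [OpensMeasurableSpace Y]
    [SecondCountableTopology Y] [T2Space Y] {μ : Measure Y} {Q : Set Y} (hQ : IsCompact Q)
    {k : Y → ℂ} (hk : IntegrableOn k Q μ) {H : E → Y → ℂ} {H' : E → Y → E →L[ℝ] ℂ}
    (hH : Continuous (Function.uncurry H)) (hH' : Continuous (Function.uncurry H'))
    (hd : ∀ x y, HasFDerivAt (fun x => H x y) (H' x y) x) (x₀ : E) :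
    HasFDerivAt (fun x => ∫ y in Q, k y * H x y ∂μ) (∫ y in Q, k y • H' x₀ y ∂μ) x₀ := by
  obtain ⟨M, hM⟩ := ((isCompact_closedBall x₀ 1).prod hQ).exists_bound_of_continuousOn
    hH'.continuousOn
  have hHx : ∀ x, Continuous (H x) := fun x => hH.comp (by fun_prop : Continuous fun y => (x, y))
  have hmeas : ∀ x, AEStronglyMeasurable (fun y => k y * H x y) (μ.restrict Q) := fun x =>
    hk.aestronglyMeasurable.mul (hHx x).measurable.aestronglyMeasurable
  refine hasFDerivAt_integral_of_dominated_of_fderiv_le (𝕜 := ℝ) (F' := fun x y => k y • H' x y)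
    (bound := fun y => ‖k y‖ * M)
    (Metric.closedBall_mem_nhds x₀ one_pos) (.of_forall hmeas) ?_ ?_ ?_ (hk.norm.mul_const M) ?_
  · obtain ⟨C, hC⟩ := hQ.exists_bound_of_continuousOn (hHx x₀).continuousOn
    refine (hk.norm.mul_const C).mono' (hmeas x₀) ?_
    refine (ae_restrict_iff' hQ.measurableSet).2 (.of_forall fun y hy => ?_)
    rw [norm_mul]
    exact mul_le_mul_of_nonneg_left (hC y hy) (norm_nonneg _)
  · exact hk.aestronglyMeasurable.smul
      (hH'.comp (by fun_prop : Continuous fun y : Y => (x₀, y))).aestronglyMeasurable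
  · refine (ae_restrict_iff' hQ.measurableSet).2 (.of_forall fun y hy x hx => ?_)
    rw [norm_smul]
    exact mul_le_mul_of_nonneg_left (hM (x, y) ⟨hx, hy⟩) (norm_nonneg _)
  · refine .of_forall fun y x _ => ?_
    have := (hd x y).const_mul (k y)
    exact this

/-! ### The cut-off function in position space. -/

/-- The position space kernel of the regularized time-ordered function. -/
def cutKernel (ε : ℝ) (ξ : Mink) : ℂ :=
  (4 * Real.pi ^ 2 * (((ε : ℂ) + Complex.I * (|ξ 0| : ℝ)) ^ 2 +
    ((∑ i : Fin 3, ξ i.succ ^ 2 : ℝ) : ℂ)))⁻¹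

/-- The quadratic expression factors as (ε+i(t-√s))(ε+i(t+√s)), and each factor has real part ε. The
cutoff thus removes the light-cone singularity. -/
lemma sq_le_norm_cut {ε : ℝ} (hε : 0 < ε) (t : ℝ) {s : ℝ} (hs : 0 ≤ s) :
    ε ^ 2 ≤ ‖((ε : ℂ) + Complex.I * t) ^ 2 + (s : ℂ)‖ := by
  have h1 : ((ε : ℂ) + Complex.I * t) ^ 2 + (s : ℂ) =
      ((ε : ℂ) + Complex.I * ((t - √s : ℝ) : ℂ)) * ((ε : ℂ) + Complex.I * ((t + √s : ℝ) : ℂ)) := by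
    have : ((√s : ℝ) : ℂ) ^ 2 = (s : ℂ) := by
      rw [← Complex.ofReal_pow, Real.sq_sqrt hs]
    push_cast
    linear_combination (-1 : ℂ) * this + (-((√s : ℝ) : ℂ) ^ 2 ) * (-1) * Complex.I_sq
  have h2 : ∀ r : ℝ, ε ≤ ‖(ε : ℂ) + Complex.I * (r : ℂ)‖ := by
    intro r
    have := Complex.re_le_norm ((ε : ℂ) + Complex.I * (r : ℂ))
    simpa using this
  rw [h1, norm_mul, sq]
  exact mul_le_mul (h2 _) (h2 _) hε.le (norm_nonneg _)

lemma cut_ne_zero {ε : ℝ} (hε : 0 < ε) (t : ℝ) {s : ℝ} (hs : 0 ≤ s) :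
    ((ε : ℂ) + Complex.I * t) ^ 2 + (s : ℂ) ≠ 0 := by
  intro h
  have := sq_le_norm_cut hε t hs
  rw [h, norm_zero] at this
  nlinarith

lemma sum_sq_succ_nonneg (ξ : Mink) : 0 ≤ ∑ i : Fin 3, ξ i.succ ^ 2 := by positivity

lemma continuous_cutKernel {ε : ℝ} (hε : 0 < ε) : Continuous (cutKernel ε) := by
  unfold cutKernel
  refine Continuous.inv₀ (by fun_prop) fun ξ => ?_
  refine mul_ne_zero ?_ (cut_ne_zero hε _ (sum_sq_succ_nonneg ξ))
  simp [Real.pi_ne_zero]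

lemma cutKernel_toMink (ε t : ℝ) (x : Space) : cutKernel ε (toMink t x) =
    (4 * Real.pi ^ 2 * (((ε : ℂ) + Complex.I * (|t| : ℝ)) ^ 2 + (‖x‖ : ℂ) ^ 2))⁻¹ := by
  have : (∑ i : Fin 3, toMink t x i.succ ^ 2 : ℝ) = ‖x‖ ^ 2 := by
    rw [EuclideanSpace.norm_eq, Real.sq_sqrt (by positivity)]
    simp
  rw [cutKernel, this, toMink_zero]
  push_cast
  rfl

lemma integrable_cutKernel_mul {ε : ℝ} (hε : 0 < ε) {f : Mink → ℂ} (hf : IsTest f) :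
    Integrable (fun ξ => cutKernel ε ξ * f ξ) :=
  ((continuous_cutKernel hε).mul hf.continuous).integrable_of_hasCompactSupport hf.compact.mul_left

/-- At fixed t the cutoff makes e^{-z|k|}/|k|, with z = ε+i|t|, integrable in k, so the k- and
x-integrals may be exchanged and the Fourier transform of this function inserted. The constant is
4π/(16π³) = 1/(4π²). -/
lemma T0cut_eq {ε : ℝ} (hε : 0 < ε) {f : Mink → ℂ} (hf : IsTest f) :
    T0cut ε f = ∫ ξ, cutKernel ε ξ * f ξ := by
  rw [integral_mink (integrable_cutKernel_mul hε hf)]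
  unfold T0cut
  congr 1
  funext t
  set z : ℂ := (ε : ℂ) + Complex.I * (|t| : ℝ) with hz
  have hzre : 0 < z.re := by simpa [hz] using hε
  have hpi : (Real.pi : ℂ) ≠ 0 := by simp [Real.pi_ne_zero]
  have h1 : ∀ k : Space, Complex.exp (((-(ε * ‖k‖) : ℝ)) : ℂ) * (modeKernel t k * sliceHat f t k) =
      ∫ x : Space, (Complex.exp (-z * (‖k‖ : ℂ)) / (‖k‖ : ℂ)) * (((16 * Real.pi ^ 3 : ℂ))⁻¹ *
        (Complex.exp (Complex.I * ((inner ℝ k x : ℝ) : ℂ)) * f (toMink t x))) := by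
    intro k
    rw [integral_const_mul, integral_const_mul, ← sliceHat]
    have : Complex.exp (((-(ε * ‖k‖) : ℝ)) : ℂ) * modeKernel t k =
        (Complex.exp (-z * (‖k‖ : ℂ)) / (‖k‖ : ℂ)) * ((16 * Real.pi ^ 3 : ℂ))⁻¹ := by
      rw [modeKernel, ← mul_div_assoc, ← Complex.exp_add]
      have e1 : (((-(ε * ‖k‖) : ℝ)) : ℂ) + -Complex.I * (‖k‖ : ℂ) * ((|t| : ℝ) : ℂ) =
          -z * (‖k‖ : ℂ) := by rw [hz]; push_cast; ring
      rw [e1]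
      push_cast
      rw [div_mul_eq_mul_div, ← div_eq_mul_inv, div_div]
      congr 1
      ring
    rw [← mul_assoc, this, mul_assoc]
  simp only [h1]
  rw [integral_integral_swap]
  · congr 1
    funext x
    have h2 : ∀ k : Space, (Complex.exp (-z * (‖k‖ : ℂ)) / (‖k‖ : ℂ)) * (((16 * Real.pi ^ 3 : ℂ))⁻¹ *
        (Complex.exp (Complex.I * ((inner ℝ k x : ℝ) : ℂ)) * f (toMink t x))) =
        (Complex.exp (-z * (‖k‖ : ℂ)) / (‖k‖ : ℂ) *
        Complex.exp (Complex.I * ((inner ℝ k x : ℝ) : ℂ))) *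
        (((16 * Real.pi ^ 3 : ℂ))⁻¹ * f (toMink t x)) := fun k => by ring
    simp only [h2]
    rw [integral_mul_const, integral_exp_norm_div_mul_exp hzre, cutKernel_toMink]
    have := cut_ne_zero hε |t| (sq_nonneg ‖x‖)
    push_cast at this
    rw [← hz] at this ⊢
    field_simp
    norm_num
  · have hi : Integrable (fun p : Space × Space => (Complex.exp (-z * (‖p.1‖ : ℂ)) / (‖p.1‖ : ℂ)) *
        f (toMink t p.2)) (volume.prod volume) :=
      (integrable_exp_norm_div hzre).mul_prod (hf.integrable_slice t)
    have hb := hi.mul_bdd (g := fun p : Space × Space => ((16 * Real.pi ^ 3 : ℂ))⁻¹ *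
        Complex.exp (Complex.I * ((inner ℝ p.1 p.2 : ℝ) : ℂ)))
      (c := ‖((16 * Real.pi ^ 3 : ℂ))⁻¹‖) (Continuous.aestronglyMeasurable (by fun_prop))
      (.of_forall fun p => by rw [norm_mul, norm_exp_I_mul, mul_one])
    refine hb.congr (.of_forall fun p => ?_)
    simp only [Function.uncurry]
    ring

/-! ### Translations of the time-ordered function: derivatives, measurability and the fundamental
theorem of calculus. -/

/-- The directional derivative of a function along a fixed vector. -/
def dirD (e : Mink) (f : Mink → ℂ) : Mink → ℂ := fun ξ => fderiv ℝ f ξ e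

lemma dirD_eq_sum (e : Mink) (f : Mink → ℂ) (ξ : Mink) :
    dirD e f ξ = ∑ μ, (e μ : ℂ) * pd μ f ξ := by
  have h : e = ∑ μ, e μ • (Pi.single μ 1 : Mink) := by
    funext ν
    simp [Finset.sum_apply, Pi.single_apply]
  unfold dirD pd
  conv_lhs => rw [h]
  simp

lemma IsTest.dirD {f : Mink → ℂ} (hf : IsTest f) (e : Mink) : IsTest (dirD e f) :=
  ⟨(hf.smooth.fderiv_right (m := ∞) (by simp)).clm_apply contDiff_const,
    hf.compact.fderiv_apply ℝ e⟩

lemma IsTest.exists_support_bound {f : Mink → ℂ} (hf : IsTest f) :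
    ∃ R : ℝ, 0 ≤ R ∧ ∀ ξ, R < ‖ξ‖ → f ξ = 0 ∧ fderiv ℝ f ξ = 0 := by
  obtain ⟨R, hR⟩ := hf.compact.isCompact.isBounded.subset_closedBall (0 : Mink)
  refine ⟨|R|, abs_nonneg _, fun ξ hξ => ?_⟩
  have hξ' : ξ ∉ tsupport f := fun h => by
    have := hR h
    rw [mem_closedBall_zero_iff] at this
    linarith [le_abs_self R]
  exact ⟨image_eq_zero_of_notMem_tsupport hξ',
    image_eq_zero_of_notMem_tsupport fun h => hξ' (tsupport_fderiv_subset ℝ h)⟩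

/-- The translation is carried by the test function, so the kernel, which has a kink at t = 0, need
only be continuous. For y within distance 1 of y₀ all translated supports lie in one compact ball,
which reduces the claim to differentiation under a compact integral. -/
lemma hasFDerivAt_T0cut_shift {ε : ℝ} (hε : 0 < ε) {f : Mink → ℂ} (hf : IsTest f) (y₀ : Mink) :
    ∃ D : Mink →L[ℝ] ℂ, HasFDerivAt (fun y => T0cut ε (shift y f)) D y₀ ∧
      ∀ e, D e = T0cut ε (shift y₀ (dirD e f)) := by
  obtain ⟨R, hR, hsupp⟩ := hf.exists_support_bound
  set Q : Set Mink := Metric.closedBall 0 (R + ‖y₀‖ + 1) with hQ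
  have hQc : IsCompact Q := isCompact_closedBall _ _
  have hout : ∀ y, ‖y - y₀‖ < 1 → ∀ ξ, ξ ∉ Q → R < ‖ξ + y‖ := by
    intro y hy ξ hξ
    rw [hQ, mem_closedBall_zero_iff, not_le] at hξ
    have h1 : ‖y‖ ≤ ‖y - y₀‖ + ‖y₀‖ := by simpa using norm_add_le (y - y₀) y₀
    have h2 : ‖ξ‖ ≤ ‖ξ + y‖ + ‖y‖ := by simpa using norm_sub_le (ξ + y) y
    linarith
  have hcont : Continuous (fderiv ℝ f) := hf.smooth.continuous_fderiv (by simp)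
  have h := hasFDerivAt_setIntegral_of_isCompact (μ := (volume : Measure Mink)) hQc
    (k := cutKernel ε) ((continuous_cutKernel hε).continuousOn.integrableOn_compact hQc)
    (H := fun y ξ => f (ξ + y)) (H' := fun y ξ => fderiv ℝ f (ξ + y))
    (hf.continuous.comp (by fun_prop : Continuous fun p : Mink × Mink => p.2 + p.1))
    (hcont.comp (by fun_prop : Continuous fun p : Mink × Mink => p.2 + p.1))
    (fun y ξ => ((hf.differentiable (ξ + y)).hasFDerivAt.comp y
      ((hasFDerivAt_id y).const_add ξ))) y₀
  refine ⟨_, h.congr_of_eventuallyEq ?_, fun e => ?_⟩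
  · filter_upwards [Metric.ball_mem_nhds y₀ one_pos] with y hy
    rw [mem_ball_iff_norm] at hy
    rw [T0cut_eq hε (hf.shift y)]
    refine (setIntegral_eq_integral_of_forall_compl_eq_zero fun ξ hξ => ?_).symm
    rw [shift, (hsupp _ (hout y hy ξ hξ)).1, mul_zero]
  · have hint : IntegrableOn (fun ξ => cutKernel ε ξ • fderiv ℝ f (ξ + y₀)) Q :=
      ((continuous_cutKernel hε).smul (hcont.comp (by fun_prop))).continuousOn.integrableOn_compact hQc
    rw [ContinuousLinearMap.integral_apply hint, T0cut_eq hε ((hf.dirD e).shift y₀)]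
    refine setIntegral_eq_integral_of_forall_compl_eq_zero fun ξ hξ => ?_
    rw [(hsupp _ (hout y₀ (by simp) ξ hξ)).2]
    simp

lemma continuous_T0cut_shift {ε : ℝ} (hε : 0 < ε) {f : Mink → ℂ} (hf : IsTest f) :
    Continuous (fun y => T0cut ε (shift y f)) :=
  continuous_iff_continuousAt.2 fun y =>
    (hasFDerivAt_T0cut_shift hε hf y).choose_spec.1.continuousAt

lemma tendsto_T0cut_seq {f : Mink → ℂ} (hf : IsTest f) :
    Tendsto (fun n : ℕ => T0cut (1 / ((n : ℝ) + 1)) f) atTop (𝓝 (T0 f)) := by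
  refine (tendsto_T0cut hf).comp ?_
  rw [tendsto_nhdsWithin_iff]
  exact ⟨tendsto_one_div_add_atTop_nhds_zero_nat, .of_forall fun n => by
    show (0 : ℝ) < _
    positivity⟩

lemma measurable_T0_shift {f : Mink → ℂ} (hf : IsTest f) :
    StronglyMeasurable (fun y => T0 (shift y f)) := by
  refine stronglyMeasurable_of_tendsto atTop (f := fun (n : ℕ) y =>
    T0cut (1 / ((n : ℝ) + 1)) (shift y f)) (fun n => ?_) ?_
  · exact (continuous_T0cut_shift (by positivity) hf).stronglyMeasurable
  · exact tendsto_pi_nhds.2 fun y => tendsto_T0cut_seq (hf.shift y)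

lemma exists_bound_T0_shift {f : Mink → ℂ} (hf : IsTest f) :
    ∃ C : ℝ, 0 ≤ C ∧ ∀ y, ‖T0 (shift y f)‖ ≤ C := by
  obtain ⟨C, hC, h⟩ := exists_bound_T0cut hf
  refine ⟨C, hC, fun y => ?_⟩
  simpa only [T0cut_zero] using h 0 le_rfl y

lemma T0cut_shift_sub {ε : ℝ} (hε : 0 < ε) {f : Mink → ℂ} (hf : IsTest f) (e : Mink) (S : ℝ) :
    ∫ s in (0 : ℝ)..S, T0cut ε (shift (s • e) (dirD e f)) =
      T0cut ε (shift (S • e) f) - T0cut ε f := by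
  have hd : ∀ s : ℝ, HasDerivAt (fun s : ℝ => T0cut ε (shift (s • e) f))
      (T0cut ε (shift (s • e) (dirD e f))) s := by
    intro s
    obtain ⟨D, hD, hDe⟩ := hasFDerivAt_T0cut_shift hε hf (s • e)
    have h1 : HasDerivAt (fun s : ℝ => s • e) e s := by
      simpa using (hasDerivAt_id s).smul_const e
    have := hD.comp_hasDerivAt s h1
    rw [hDe e] at this
    exact this
  have := intervalIntegral.integral_eq_sub_of_hasDerivAt (a := 0) (b := S) (fun s _ => hd s)
    (Continuous.intervalIntegrable ((continuous_T0cut_shift hε (hf.dirD e)).comp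
      (by fun_prop : Continuous fun s : ℝ => s • e)) _ _)
  rw [this, zero_smul, shift_zero]

/-- Differentiability in the translation is available only with the cutoff. The integrated form
survives the limit ε → 0, thanks to the bound uniform in ε and in the translation. -/
lemma T0_shift_sub {f : Mink → ℂ} (hf : IsTest f) (e : Mink) (S : ℝ) :
    ∫ s in (0 : ℝ)..S, T0 (shift (s • e) (dirD e f)) = T0 (shift (S • e) f) - T0 f := by
  obtain ⟨C, -, hC⟩ := exists_bound_T0cut (hf.dirD e)
  have h1 : Tendsto (fun n : ℕ => ∫ s in (0 : ℝ)..S,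
      T0cut (1 / ((n : ℝ) + 1)) (shift (s • e) (dirD e f))) atTop
      (𝓝 (∫ s in (0 : ℝ)..S, T0 (shift (s • e) (dirD e f)))) := by
    refine intervalIntegral.tendsto_integral_filter_of_dominated_convergence (fun _ => C)
      (.of_forall fun n => ?_) (.of_forall fun n => .of_forall fun s _ => ?_) ?_
      (.of_forall fun s _ => tendsto_T0cut_seq ((hf.dirD e).shift _))
    · exact ((continuous_T0cut_shift (by positivity) (hf.dirD e)).comp
        (by fun_prop : Continuous fun s : ℝ => s • e)).aestronglyMeasurable
    · exact hC _ (by positivity) _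
    · exact intervalIntegrable_const
  refine tendsto_nhds_unique h1 ?_
  have h2 : ∀ n : ℕ, ∫ s in (0 : ℝ)..S, T0cut (1 / ((n : ℝ) + 1)) (shift (s • e) (dirD e f)) =
      T0cut (1 / ((n : ℝ) + 1)) (shift (S • e) f) - T0cut (1 / ((n : ℝ) + 1)) f :=
    fun n => T0cut_shift_sub (by positivity) hf e S
  simp only [h2]
  exact (tendsto_T0cut_seq (hf.shift _)).sub (tendsto_T0cut_seq hf)

/-! ### Decay along spacelike strings. -/

lemma minkSq_eq (x : Mink) : minkSq x = x 0 ^ 2 - ∑ i : Fin 3, x i.succ ^ 2 := by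
  simp [minkSq, eta, Fin.sum_univ_succ]
  ring

/-- The denominator has real part 4π²(ε² - ξ²), so at spacelike ξ the kernel is bounded
independently of ε. -/
lemma norm_cutKernel_le {ε : ℝ} {ξ : Mink} {a : ℝ} (ha : 0 < a)
    (h : a ≤ 2 * -minkSq ξ) : ‖cutKernel ε ξ‖ ≤ a⁻¹ := by
  rw [cutKernel, norm_inv]
  refine inv_anti₀ ha ?_
  rw [norm_mul]
  have hp : ‖(4 * (Real.pi : ℂ) ^ 2)‖ = 4 * Real.pi ^ 2 := by
    simp [abs_of_pos Real.pi_pos]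
  rw [hp]
  have hre := Complex.re_le_norm (((ε : ℂ) + Complex.I * (|ξ 0| : ℝ)) ^ 2 +
    ((∑ i : Fin 3, ξ i.succ ^ 2 : ℝ) : ℂ))
  have hre' : (((ε : ℂ) + Complex.I * (|ξ 0| : ℝ)) ^ 2 +
    ((∑ i : Fin 3, ξ i.succ ^ 2 : ℝ) : ℂ)).re = ε ^ 2 - minkSq ξ := by
    rw [minkSq_eq, Complex.add_re, Complex.ofReal_re, sq, Complex.mul_re]
    simp
    ring
  rw [hre'] at hre
  have h3 := Real.pi_gt_three
  have h4 : 2 ≤ 4 * Real.pi ^ 2 := by nlinarith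
  have h5 : a / 2 ≤ ‖((ε : ℂ) + Complex.I * (|ξ 0| : ℝ)) ^ 2 +
    ((∑ i : Fin 3, ξ i.succ ^ 2 : ℝ) : ℂ)‖ := by nlinarith [sq_nonneg ε]
  calc a = 2 * (a / 2) := by ring
    _ ≤ _ := mul_le_mul h4 h5 (by positivity) (by positivity)

/-- Since e² = -1, -(η-se)² is s² plus a term linear in s of size at most 8MRs, up to a remainder
bounded below by -R². The threshold for s makes these corrections cost at most half of s². -/
lemma neg_minkSq_shift_ge {e η : Mink} {M R s : ℝ} (he : e ∈ hyperboloid) (hM : ‖e‖ ≤ M)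
    (hη : ‖η‖ ≤ R) (hs : 16 * M * R + 2 * R + 1 ≤ s) : s ^ 2 ≤ 2 * -minkSq (η - s • e) := by
  have he' : minkSq e = -1 := he
  have hM0 : 0 ≤ M := (norm_nonneg _).trans hM
  have hR0 : 0 ≤ R := (norm_nonneg _).trans hη
  have hs0 : 0 ≤ s := le_trans (by positivity) hs
  have hb : ∀ μ, |e μ * η μ| ≤ M * R := fun μ => by
    rw [abs_mul]
    exact mul_le_mul ((norm_le_pi_norm e μ).trans hM) ((norm_le_pi_norm η μ).trans hη)
      (abs_nonneg _) hM0
  have h0 : |η 0| ≤ R := (norm_le_pi_norm η 0).trans hη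
  have h0' : η 0 ^ 2 ≤ R ^ 2 := by rw [← sq_abs]; gcongr
  have key : -minkSq (η - s • e) = s ^ 2 * -minkSq e -
      2 * s * (∑ i : Fin 3, e i.succ * η i.succ - e 0 * η 0) - minkSq η := by
    simp only [minkSq_eq, Pi.sub_apply, Pi.smul_apply, smul_eq_mul, Fin.sum_univ_three]
    ring
  have hη2 : minkSq η ≤ R ^ 2 := by
    rw [minkSq_eq]
    have : 0 ≤ ∑ i : Fin 3, η i.succ ^ 2 := by positivity
    linarith
  have hsum : ∑ i : Fin 3, e i.succ * η i.succ - e 0 * η 0 ≤ 4 * (M * R) := by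
    rw [Fin.sum_univ_three]
    have a1 := (abs_le.1 (hb (Fin.succ 0))).2
    have a2 := (abs_le.1 (hb (Fin.succ 1))).2
    have a3 := (abs_le.1 (hb (Fin.succ 2))).2
    have a0 := (abs_le.1 (hb 0)).1
    linarith
  rw [key, he']
  nlinarith [mul_le_mul_of_nonneg_left hsum hs0, mul_le_mul_of_nonneg_left hs hs0,
    mul_nonneg hM0 hR0]

/-- For large s the translated support lies in the region where the kernel is bounded by s⁻² for
every ε, and the bound passes to the limit. For the remaining s the uniform bound suffices. Decay
like s⁻² makes the string integrals absolutely convergent, uniformly on bounded sets of directions.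
-/
lemma exists_decay_T0_shift {f : Mink → ℂ} (hf : IsTest f) (M : ℝ) :
    ∃ C : ℝ, 0 ≤ C ∧ ∀ e ∈ hyperboloid, ‖e‖ ≤ M → ∀ s : ℝ, 0 ≤ s →
      ‖T0 (shift (s • e) f)‖ ≤ C * (1 + s ^ 2)⁻¹ := by
  obtain ⟨R, hR, hsupp⟩ := hf.exists_support_bound
  obtain ⟨C0, hC0, hb⟩ := exists_bound_T0_shift hf
  rcases lt_or_ge M 0 with hM | hM
  · exact ⟨0, le_rfl, fun e _ he => absurd ((norm_nonneg e).trans he) (not_le.2 hM)⟩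
  set S0 := 16 * M * R + 2 * R + 1 with hS0
  have hS1 : 1 ≤ S0 := by rw [hS0]; nlinarith [mul_nonneg hM hR]
  set N := ∫ ξ, ‖f ξ‖ with hN
  have hN0 : 0 ≤ N := integral_nonneg fun _ => norm_nonneg _
  refine ⟨2 * N + C0 * (1 + S0 ^ 2), by positivity, fun e he heM s hs => ?_⟩
  rw [← div_eq_mul_inv, le_div_iff₀ (by positivity)]
  rcases le_total s S0 with h | h
  · calc _ ≤ C0 * (1 + S0 ^ 2) := by gcongr; exact hb _
      _ ≤ _ := by linarith
  · have hs1 : 1 ≤ s := hS1.trans h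
    have hlim : ‖T0 (shift (s • e) f)‖ ≤ (s ^ 2)⁻¹ * N := by
      refine le_of_tendsto (tendsto_T0cut_seq (hf.shift _)).norm (.of_forall fun n => ?_)
      have hε : (0 : ℝ) < 1 / ((n : ℝ) + 1) := by positivity
      rw [T0cut_eq hε (hf.shift _)]
      have hi : Integrable (fun ξ => (s ^ 2)⁻¹ * ‖f (ξ + s • e)‖) :=
        ((hf.shift (s • e)).integrable.norm).const_mul _
      refine (norm_integral_le_of_norm_le hi (.of_forall fun ξ => ?_)).trans (le_of_eq ?_)
      · rw [norm_mul, shift]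
        rcases le_or_gt ‖ξ + s • e‖ R with hξ | hξ
        · refine mul_le_mul_of_nonneg_right (norm_cutKernel_le (by positivity) ?_) (norm_nonneg _)
          have := neg_minkSq_shift_ge he heM hξ h
          rwa [add_sub_cancel_right] at this
        · simp [(hsupp _ hξ).1]
      · rw [integral_const_mul, integral_add_right_eq_self (fun ξ => ‖f ξ‖)]
    calc _ ≤ ((s ^ 2)⁻¹ * N) * (1 + s ^ 2) := by gcongr
      _ = N * ((s ^ 2)⁻¹ + 1) := by field_simp
      _ ≤ N * (1 + 1) := by
          gcongr
          exact inv_le_one_of_one_le₀ (one_le_pow₀ hs1)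
      _ ≤ _ := by nlinarith [mul_nonneg hC0 (by positivity : 0 ≤ 1 + S0 ^ 2)]

lemma integrableOn_T0_shift {f : Mink → ℂ} (hf : IsTest f) {e : Mink} (he : e ∈ hyperboloid) :
    IntegrableOn (fun s : ℝ => T0 (shift (s • e) f)) (Set.Ioi 0) := by
  obtain ⟨C, -, h⟩ := exists_decay_T0_shift hf ‖e‖
  refine (integrable_inv_one_add_sq.integrableOn.const_mul C).mono' ?_ ?_
  · exact ((measurable_T0_shift hf).comp_measurable
      (by fun_prop : Measurable fun s : ℝ => s • e)).aestronglyMeasurable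
  · exact (ae_restrict_iff' measurableSet_Ioi).2 (.of_forall fun s hs =>
      h e he le_rfl s (le_of_lt hs))

/-- The fundamental theorem of calculus along the string: the end at infinity drops out by decay and
the starting point contributes -T₀. -/
lemma integral_T0_shift_dirD {f : Mink → ℂ} (hf : IsTest f) {e : Mink} (he : e ∈ hyperboloid) :
    ∫ s in Set.Ioi (0 : ℝ), T0 (shift (s • e) (dirD e f)) = - T0 f := by
  have h1 := intervalIntegral_tendsto_integral_Ioi 0 (integrableOn_T0_shift (hf.dirD e) he)
    tendsto_id
  refine tendsto_nhds_unique h1 ?_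
  simp only [id, T0_shift_sub hf]
  have h2 : Tendsto (fun S : ℝ => T0 (shift (S • e) f)) atTop (𝓝 0) := by
    obtain ⟨C, -, h⟩ := exists_decay_T0_shift hf ‖e‖
    have h3 : Tendsto (fun S : ℝ => C * (1 + S ^ 2)⁻¹) atTop (𝓝 0) := by
      have : Tendsto (fun S : ℝ => 1 + S ^ 2) atTop atTop :=
        tendsto_atTop_add_const_left _ _ (tendsto_pow_atTop two_ne_zero)
      simpa using this.inv_tendsto_atTop.const_mul C
    refine squeeze_zero_norm' ?_ h3
    filter_upwards [eventually_ge_atTop 0] with S hS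
    exact h e he le_rfl S hS
  simpa using h2.sub_const (T0 f)

/-- As an iterated integral T₀ is not linear on arbitrary functions. On test functions linearity is
inherited from the integrals against the cut-off kernels. -/
lemma T0_sum {ι : Type*} (s : Finset ι) (a : ι → ℂ) {f : ι → Mink → ℂ}
    (hf : ∀ i ∈ s, IsTest (f i)) :
    T0 (fun ξ => ∑ i ∈ s, a i * f i ξ) = ∑ i ∈ s, a i * T0 (f i) := by
  have hS : IsTest (fun ξ => ∑ i ∈ s, a i * f i ξ) := by
    constructor
    · exact ContDiff.sum fun i hi => contDiff_const.mul (hf i hi).smooth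
    · classical
      induction s using Finset.induction_on with
      | empty =>
        simp only [Finset.sum_empty]
        exact HasCompactSupport.zero
      | insert i s hi ih =>
        simp only [Finset.sum_insert hi]
        exact ((hf i (by simp)).compact.mul_left).add
          (ih fun j hj => hf j (by simp [hj]))
  refine tendsto_nhds_unique (tendsto_T0cut_seq hS) ?_
  have : ∀ n : ℕ, T0cut (1 / ((n : ℝ) + 1)) (fun ξ => ∑ i ∈ s, a i * f i ξ) =
      ∑ i ∈ s, a i * T0cut (1 / ((n : ℝ) + 1)) (f i) := by
    intro n
    have hε : (0 : ℝ) < 1 / ((n : ℝ) + 1) := by positivity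
    rw [T0cut_eq hε hS, Finset.sum_congr rfl fun i hi => by rw [T0cut_eq hε (hf i hi)]]
    simp only [← integral_const_mul, Finset.mul_sum]
    rw [integral_finsetSum]
    · refine Finset.sum_congr rfl fun i _ => integral_congr_ae (.of_forall fun ξ => ?_)
      simp only
      ring
    · intro i hi
      refine ((integrable_cutKernel_mul hε (hf i hi)).const_mul (a i)).congr
        (.of_forall fun ξ => ?_)
      simp only
      ring
  simp only [this]
  exact tendsto_finsetSum _ fun i hi => (tendsto_T0cut_seq (hf i hi)).const_mul _

/-! ### The wave equation for the time-ordered function. -/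

/-- Two integrations by parts against an even function with a kink at the origin. -/
lemma integral_abs_mul_deriv_deriv {κ κ₁ κ₂ φ φ₁ φ₂ : ℝ → ℂ} (hκ : ∀ t, HasDerivAt κ (κ₁ t) t)
    (hκ₁ : ∀ t, HasDerivAt κ₁ (κ₂ t) t) (hκ₂ : Continuous κ₂)
    (hφ : ∀ t, HasDerivAt φ (φ₁ t) t) (hφ₁ : ∀ t, HasDerivAt φ₁ (φ₂ t) t) (hφ₂ : Continuous φ₂)
    (hc : HasCompactSupport φ) (hc₁ : HasCompactSupport φ₁) (hc₂ : HasCompactSupport φ₂) :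
    ∫ t : ℝ, (κ |t| * φ₂ t - κ₂ |t| * φ t) = 2 * κ₁ 0 * φ 0 := by
  have cκ : Continuous κ := continuous_iff_continuousAt.2 fun t => (hκ t).continuousAt
  have cκ₁ : Continuous κ₁ := continuous_iff_continuousAt.2 fun t => (hκ₁ t).continuousAt
  have cφ : Continuous φ := continuous_iff_continuousAt.2 fun t => (hφ t).continuousAt
  have cφ₁ : Continuous φ₁ := continuous_iff_continuousAt.2 fun t => (hφ₁ t).continuousAt
  have hint : Integrable fun t : ℝ => κ |t| * φ₂ t - κ₂ |t| * φ t :=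
    (((cκ.comp continuous_abs).mul hφ₂).sub ((hκ₂.comp continuous_abs).mul cφ)
      ).integrable_of_hasCompactSupport (hc₂.mul_left.sub hc.mul_left)
  have hR : HasCompactSupport fun t => κ t * φ₁ t - κ₁ t * φ t := hc₁.mul_left.sub hc.mul_left
  have hL : HasCompactSupport fun t => κ (-t) * φ₁ t + κ₁ (-t) * φ t :=
    hc₁.mul_left.add hc.mul_left
  have lR : Tendsto (fun t => κ t * φ₁ t - κ₁ t * φ t) atTop (𝓝 0) :=
    hR.is_zero_at_infty.mono_left atTop_le_cocompact
  have lL : Tendsto (fun t => κ (-t) * φ₁ t + κ₁ (-t) * φ t) atBot (𝓝 0) :=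
    hL.is_zero_at_infty.mono_left atBot_le_cocompact
  have h1 : ∫ t in Set.Ioi (0 : ℝ), (κ |t| * φ₂ t - κ₂ |t| * φ t) =
      0 - (κ 0 * φ₁ 0 - κ₁ 0 * φ 0) := by
    refine integral_Ioi_of_hasDerivAt_of_tendsto' (f := fun t => κ t * φ₁ t - κ₁ t * φ t)
      (fun t ht => ?_) hint.integrableOn lR
    have ht : 0 ≤ t := ht
    rw [abs_of_nonneg ht]
    refine (((hκ t).mul (hφ₁ t)).sub ((hκ₁ t).mul (hφ t))).congr_deriv ?_
    ring
  have h2 : ∫ t in Set.Iic (0 : ℝ), (κ |t| * φ₂ t - κ₂ |t| * φ t) =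
      (κ (-0) * φ₁ 0 + κ₁ (-0) * φ 0) - 0 := by
    refine integral_Iic_of_hasDerivAt_of_tendsto' (f := fun t => κ (-t) * φ₁ t + κ₁ (-t) * φ t)
      (fun t ht => ?_) hint.integrableOn lL
    have ht : t ≤ 0 := ht
    rw [abs_of_nonpos ht]
    have d1 : HasDerivAt (fun t => κ (-t)) (-κ₁ (-t)) t := by
      exact ((hκ (-t)).scomp t (hasDerivAt_neg t)).congr_deriv (by simp)
    have d2 : HasDerivAt (fun t => κ₁ (-t)) (-κ₂ (-t)) t := by
      exact ((hκ₁ (-t)).scomp t (hasDerivAt_neg t)).congr_deriv (by simp)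
    refine ((d1.mul (hφ₁ t)).add (d2.mul (hφ t))).congr_deriv ?_
    ring
  rw [← intervalIntegral.integral_Iic_add_Ioi (b := (0 : ℝ)) hint.integrableOn hint.integrableOn,
    h1, h2, neg_zero]
  ring

/-- The denominator of the regularized kernel, without the absolute value of the time. -/
def cutDen (ε : ℝ) (s t : ℝ) : ℂ := ((ε : ℂ) + Complex.I * t) ^ 2 + (s : ℂ)

lemma cutDen_ne_zero {ε : ℝ} (hε : 0 < ε) {s : ℝ} (hs : 0 ≤ s) (t : ℝ) : cutDen ε s t ≠ 0 :=
  cut_ne_zero hε t hs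

lemma hasDerivAt_time (ε t : ℝ) :
    HasDerivAt (fun t : ℝ => (ε : ℂ) + Complex.I * t) Complex.I t := by
  simpa using ((hasDerivAt_id t).ofReal_comp.const_mul Complex.I).const_add (ε : ℂ)

lemma hasDerivAt_cutDen (ε s t : ℝ) :
    HasDerivAt (cutDen ε s) (2 * Complex.I * ((ε : ℂ) + Complex.I * t)) t := by
  refine (((hasDerivAt_time ε t).pow 2).add_const (s : ℂ)).congr_deriv ?_
  simp
  ring

lemma hasDerivAt_cutKernel_time {ε : ℝ} (hε : 0 < ε) {s : ℝ} (hs : 0 ≤ s) (t : ℝ) :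
    HasDerivAt (fun t => (4 * Real.pi ^ 2 * cutDen ε s t)⁻¹)
      (-(4 * Real.pi ^ 2 : ℂ)⁻¹ * (2 * Complex.I * ((ε : ℂ) + Complex.I * t)) *
        (cutDen ε s t ^ 2)⁻¹) t := by
  have hpi : (Real.pi : ℂ) ≠ 0 := by simp [Real.pi_ne_zero]
  have hq := cutDen_ne_zero hε hs t
  refine (((hasDerivAt_cutDen ε s t).const_mul (4 * Real.pi ^ 2 : ℂ)).inv
    (mul_ne_zero (by simp [Real.pi_ne_zero]) hq)).congr_deriv ?_
  field_simp

lemma hasDerivAt_cutKernel_time_two {ε : ℝ} (hε : 0 < ε) {s : ℝ} (hs : 0 ≤ s) (t : ℝ) :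
    HasDerivAt (fun t : ℝ => -(4 * Real.pi ^ 2 : ℂ)⁻¹ * (2 * Complex.I * ((ε : ℂ) + Complex.I * t)) *
        (cutDen ε s t ^ 2)⁻¹)
      ((4 * Real.pi ^ 2 : ℂ)⁻¹ * (2 * (cutDen ε s t ^ 2)⁻¹ -
        8 * ((ε : ℂ) + Complex.I * t) ^ 2 * (cutDen ε s t ^ 3)⁻¹)) t := by
  have hpi : (Real.pi : ℂ) ≠ 0 := by simp [Real.pi_ne_zero]
  have hq := cutDen_ne_zero hε hs t
  refine ((((hasDerivAt_time ε t).const_mul (2 * Complex.I)).const_mul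
    (-(4 * Real.pi ^ 2 : ℂ)⁻¹)).mul (((hasDerivAt_cutDen ε s t).pow 2).inv
    (pow_ne_zero 2 hq))).congr_deriv ?_
  simp only [Pi.pow_apply, Pi.inv_apply]
  generalize (ε : ℂ) + Complex.I * (t : ℂ) = z
  field_simp
  ring_nf
  simp only [Complex.I_sq]
  ring

/-- The wave operator applied to the regularized kernel away from `t = 0`, time part. -/
def cutKernelSnd (ε : ℝ) (ξ : Mink) : ℂ :=
  (4 * Real.pi ^ 2 : ℂ)⁻¹ * (2 * (cutDen ε (∑ i : Fin 3, ξ i.succ ^ 2) |ξ 0| ^ 2)⁻¹ -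
    8 * ((ε : ℂ) + Complex.I * (|ξ 0| : ℝ)) ^ 2 *
      (cutDen ε (∑ i : Fin 3, ξ i.succ ^ 2) |ξ 0| ^ 3)⁻¹)

lemma cutKernel_eq (ε : ℝ) (ξ : Mink) : cutKernel ε ξ =
    (4 * Real.pi ^ 2 * cutDen ε (∑ i : Fin 3, ξ i.succ ^ 2) |ξ 0|)⁻¹ := rfl

lemma continuous_cutDen (ε : ℝ) :
    Continuous (fun ξ : Mink => cutDen ε (∑ i : Fin 3, ξ i.succ ^ 2) |ξ 0|) := by
  unfold cutDen
  fun_prop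

lemma continuous_cutDen_inv_pow {ε : ℝ} (hε : 0 < ε) (n : ℕ) :
    Continuous (fun ξ : Mink => (cutDen ε (∑ i : Fin 3, ξ i.succ ^ 2) |ξ 0| ^ n)⁻¹) :=
  ((continuous_cutDen ε).pow n).inv₀
    fun ξ => pow_ne_zero n (cutDen_ne_zero hε (sum_sq_succ_nonneg ξ) _)

lemma continuous_cutKernelSnd {ε : ℝ} (hε : 0 < ε) : Continuous (cutKernelSnd ε) := by
  have h2 := continuous_cutDen_inv_pow hε 2
  have h3 := continuous_cutDen_inv_pow hε 3
  unfold cutKernelSnd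
  fun_prop

lemma hasLineDerivAt_cutDen (ε : ℝ) (i : Fin 3) (ξ : Mink) :
    HasDerivAt (fun r : ℝ => cutDen ε (∑ j : Fin 3, (ξ + r • (Pi.single i.succ 1 : Mink)) j.succ ^ 2)
      |(ξ + r • (Pi.single i.succ 1 : Mink)) 0|) (2 * (ξ i.succ : ℂ)) 0 := by
  have h0 : ∀ r : ℝ, (ξ + r • (Pi.single i.succ 1 : Mink)) 0 = ξ 0 := fun r => by
    simp
  have hs : HasDerivAt (fun r : ℝ => ∑ j : Fin 3, (ξ + r • (Pi.single i.succ 1 : Mink)) j.succ ^ 2)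
      (2 * ξ i.succ) 0 := by
    have : ∀ j ∈ (Finset.univ : Finset (Fin 3)), HasDerivAt (fun r : ℝ =>
        (ξ + r • (Pi.single i.succ 1 : Mink)) j.succ ^ 2)
        (2 * ξ j.succ * (Pi.single i.succ 1 : Mink) j.succ) 0 := by
      intro j _
      have h1 : HasDerivAt (fun r : ℝ => (ξ + r • (Pi.single i.succ 1 : Mink)) j.succ)
          ((Pi.single i.succ 1 : Mink) j.succ) 0 := by
        simpa using ((hasDerivAt_id (0 : ℝ)).mul_const
          ((Pi.single i.succ 1 : Mink) j.succ)).const_add (ξ j.succ)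
      refine (h1.pow 2).congr_deriv ?_
      simp
    refine (HasDerivAt.fun_sum this).congr_deriv ?_
    simp [Pi.single_apply, Fin.succ_inj]
  simp only [h0]
  unfold cutDen
  have := (hs.ofReal_comp).const_add (((ε : ℂ) + Complex.I * (|ξ 0| : ℝ)) ^ 2)
  refine this.congr_deriv ?_
  push_cast
  ring

lemma hasLineDerivAt_cutKernel {ε : ℝ} (hε : 0 < ε) (i : Fin 3) (ξ : Mink) :
    HasLineDerivAt ℝ (cutKernel ε) (-(4 * Real.pi ^ 2 : ℂ)⁻¹ * (2 * (ξ i.succ : ℂ)) *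
      (cutDen ε (∑ i : Fin 3, ξ i.succ ^ 2) |ξ 0| ^ 2)⁻¹) ξ (Pi.single i.succ 1) := by
  have hpi : (Real.pi : ℂ) ≠ 0 := by simp [Real.pi_ne_zero]
  have hq := cutDen_ne_zero hε (sum_sq_succ_nonneg ξ) |ξ 0|
  refine (((hasLineDerivAt_cutDen ε i ξ).const_mul (4 * Real.pi ^ 2 : ℂ)).inv
    (mul_ne_zero (by simp [Real.pi_ne_zero]) (by simpa using hq))).congr_deriv ?_
  simp only [zero_smul, add_zero]
  field_simp

lemma hasLineDerivAt_cutKernel_two {ε : ℝ} (hε : 0 < ε) (i : Fin 3) (ξ : Mink) :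
    HasLineDerivAt ℝ (fun ξ : Mink => -(4 * Real.pi ^ 2 : ℂ)⁻¹ * (2 * (ξ i.succ : ℂ)) *
      (cutDen ε (∑ i : Fin 3, ξ i.succ ^ 2) |ξ 0| ^ 2)⁻¹)
      (-(4 * Real.pi ^ 2 : ℂ)⁻¹ * (2 * (cutDen ε (∑ i : Fin 3, ξ i.succ ^ 2) |ξ 0| ^ 2)⁻¹ -
        8 * (ξ i.succ : ℂ) ^ 2 * (cutDen ε (∑ i : Fin 3, ξ i.succ ^ 2) |ξ 0| ^ 3)⁻¹))
      ξ (Pi.single i.succ 1) := by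
  have hpi : (Real.pi : ℂ) ≠ 0 := by simp [Real.pi_ne_zero]
  have hq := cutDen_ne_zero hε (sum_sq_succ_nonneg ξ) |ξ 0|
  have h1 : HasDerivAt (fun r : ℝ => (((ξ + r • (Pi.single i.succ 1 : Mink)) i.succ : ℝ) : ℂ))
      1 0 := by
    have : HasDerivAt (fun r : ℝ => (ξ + r • (Pi.single i.succ 1 : Mink)) i.succ) 1 0 := by
      simpa using (hasDerivAt_id (0 : ℝ)).const_add (ξ i.succ)
    simpa using this.ofReal_comp
  refine (((h1.const_mul 2).const_mul (-(4 * Real.pi ^ 2 : ℂ)⁻¹)).mul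
    (((hasLineDerivAt_cutDen ε i ξ).pow 2).inv
      (pow_ne_zero 2 (by simpa using hq)))).congr_deriv ?_
  simp only [Pi.pow_apply, Pi.inv_apply, zero_smul, add_zero]
  field_simp
  ring

lemma hasLineDerivAt_pd {f : Mink → ℂ} (hf : IsTest f) (μ : Fin 4) (ξ : Mink) :
    HasLineDerivAt ℝ f (pd μ f ξ) ξ (Pi.single μ 1) :=
  (hf.differentiable ξ).hasFDerivAt.hasLineDerivAt _

/-- In spatial directions the kernel is smooth, so both derivatives move onto it without boundary
terms. Only the time direction sees the kink. -/
lemma integral_cutKernel_pd_pd {ε : ℝ} (hε : 0 < ε) {f : Mink → ℂ} (hf : IsTest f) (i : Fin 3) :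
    ∫ ξ, cutKernel ε ξ * pd i.succ (pd i.succ f) ξ =
      ∫ ξ : Mink, (-(4 * Real.pi ^ 2 : ℂ)⁻¹ *
        (2 * (cutDen ε (∑ i : Fin 3, ξ i.succ ^ 2) |ξ 0| ^ 2)⁻¹ -
        8 * (ξ i.succ : ℂ) ^ 2 * (cutDen ε (∑ i : Fin 3, ξ i.succ ^ 2) |ξ 0| ^ 3)⁻¹)) * f ξ := by
  have h2 := continuous_cutDen_inv_pow hε 2
  have h3 := continuous_cutDen_inv_pow hε 3
  have hint : ∀ {K h : Mink → ℂ}, Continuous K → IsTest h → Integrable (fun ξ => K ξ * h ξ) :=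
    fun {K h} hK hh => (hK.mul hh.continuous).integrable_of_hasCompactSupport hh.compact.mul_left
  have c0 := continuous_cutKernel hε
  have c1 : Continuous (fun ξ : Mink => -(4 * Real.pi ^ 2 : ℂ)⁻¹ * (2 * (ξ i.succ : ℂ)) *
      (cutDen ε (∑ i : Fin 3, ξ i.succ ^ 2) |ξ 0| ^ 2)⁻¹) := by fun_prop
  have c2 : Continuous (fun ξ : Mink => -(4 * Real.pi ^ 2 : ℂ)⁻¹ *
        (2 * (cutDen ε (∑ i : Fin 3, ξ i.succ ^ 2) |ξ 0| ^ 2)⁻¹ -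
        8 * (ξ i.succ : ℂ) ^ 2 * (cutDen ε (∑ i : Fin 3, ξ i.succ ^ 2) |ξ 0| ^ 3)⁻¹)) := by fun_prop
  have s1 := integral_bilinear_hasLineDerivAt_right_eq_neg_left_of_integrable
    (μ := (volume : Measure Mink)) (B := ContinuousLinearMap.mul ℝ ℂ)
    (by simpa using hint c1 (hf.pd i.succ)) (by simpa using hint c0 ((hf.pd i.succ).pd i.succ))
    (by simpa using hint c0 (hf.pd i.succ)) (fun ξ _ => hasLineDerivAt_cutKernel hε i ξ)
    (fun ξ _ => hasLineDerivAt_pd (hf.pd i.succ) i.succ ξ)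
  have s2 := integral_bilinear_hasLineDerivAt_right_eq_neg_left_of_integrable
    (μ := (volume : Measure Mink)) (B := ContinuousLinearMap.mul ℝ ℂ)
    (by simpa using hint c2 hf) (by simpa using hint c1 (hf.pd i.succ))
    (by simpa using hint c1 hf) (fun ξ _ => hasLineDerivAt_cutKernel_two hε i ξ)
    (fun ξ _ => hasLineDerivAt_pd hf i.succ ξ)
  simp only [ContinuousLinearMap.mul_apply'] at s1 s2
  rw [s1, s2, neg_neg]

lemma hasDerivAt_toMink_left {f : Mink → ℂ} (hf : IsTest f) (t : ℝ) (x : Space) :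
    HasDerivAt (fun t => f (toMink t x)) (pd 0 f (toMink t x)) t := by
  have h1 : HasDerivAt (fun t => toMink t x) (Pi.single 0 1) t := by
    refine hasDerivAt_pi.2 fun μ => ?_
    refine Fin.cases ?_ (fun i => ?_) μ
    · exact hasDerivAt_id t
    · simpa [Pi.single_apply] using hasDerivAt_const t (x i)
  exact (hf.differentiable (toMink t x)).hasFDerivAt.comp_hasDerivAt t h1

lemma IsTest.slice_left {f : Mink → ℂ} (hf : IsTest f) (x : Space) :
    HasCompactSupport (fun t => f (toMink t x)) := by
  refine HasCompactSupport.of_support_subset_isCompact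
    (K := (fun ξ : Mink => ξ 0) '' tsupport f) (hf.compact.isCompact.image (by fun_prop)) ?_
  intro t ht
  exact ⟨toMink t x, subset_tsupport _ ht, rfl⟩

lemma integral_mink_swap {f : Mink → ℂ} (hf : Integrable f) :
    ∫ ξ, f ξ = ∫ x : Space, ∫ t : ℝ, f (toMink t x) := by
  rw [integral_mink hf]
  exact integral_integral_swap (integrable_comp_toMink hf)

/-- The regularized time-ordered function solves the wave equation up to a Poisson kernel at
`t = 0`. -/
lemma T0cut_wave {ε : ℝ} (hε : 0 < ε) {f : Mink → ℂ} (hf : IsTest f) :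
    T0cut ε (pd 0 (pd 0 f)) - ∑ i : Fin 3, T0cut ε (pd i.succ (pd i.succ f)) =
      -Complex.I * ∫ x : Space, ((ε / (Real.pi ^ 2 * (ε ^ 2 + ‖x‖ ^ 2) ^ 2) : ℝ) : ℂ) *
        f (toMink 0 x) := by
  have h2 := continuous_cutDen_inv_pow hε 2
  have h3 := continuous_cutDen_inv_pow hε 3
  have hint : ∀ {K h : Mink → ℂ}, Continuous K → IsTest h → Integrable (fun ξ => K ξ * h ξ) :=
    fun {K h} hK hh => (hK.mul hh.continuous).integrable_of_hasCompactSupport hh.compact.mul_left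
  -- The spatial Laplacian of the kernel equals the second t-derivative of the analytic kernel,
  -- taken at |t|. This is the wave equation away from t = 0; it follows by eliminating (ε+i|t|)² in
  -- favour of the denominator and |x|².
  have hspace : ∑ i : Fin 3, T0cut ε (pd i.succ (pd i.succ f)) =
      ∫ ξ, cutKernelSnd ε ξ * f ξ := by
    rw [Finset.sum_congr rfl fun i _ => by
      rw [T0cut_eq hε ((hf.pd _).pd _), integral_cutKernel_pd_pd hε hf i], ← integral_finsetSum]
    · refine integral_congr_ae (.of_forall fun ξ => ?_)
      have hq := cutDen_ne_zero hε (sum_sq_succ_nonneg ξ) |ξ 0|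
      have hqd : cutDen ε (∑ i : Fin 3, ξ i.succ ^ 2) |ξ 0| =
        ((ε : ℂ) + Complex.I * (|ξ 0| : ℝ)) ^ 2 + ((∑ i : Fin 3, ξ i.succ ^ 2 : ℝ) : ℂ) := rfl
      simp only [cutKernelSnd]
      generalize cutDen ε (∑ i : Fin 3, ξ i.succ ^ 2) |ξ 0| = q at *
      rw [Fin.sum_univ_three] at hqd
      push_cast at hqd
      have hr : ((ε : ℂ) + Complex.I * (|ξ 0| : ℝ)) ^ 2 =
        q - ((ξ 1 : ℂ) ^ 2 + (ξ 2 : ℂ) ^ 2 + (ξ 3 : ℂ) ^ 2) := by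
        rw [hqd]; ring
      rw [hr, Fin.sum_univ_three]
      simp only [show Fin.succ (0 : Fin 3) = 1 from rfl, show Fin.succ (1 : Fin 3) = 2 from rfl,
        show Fin.succ (2 : Fin 3) = 3 from rfl]
      field_simp
      ring
    · intro i _
      exact hint (by fun_prop) hf
  rw [hspace, T0cut_eq hε ((hf.pd _).pd _), ← integral_sub
    (hint (continuous_cutKernel hε) ((hf.pd 0).pd 0)) (hint (continuous_cutKernelSnd hε) hf),
    integral_mink_swap (f := fun ξ => cutKernel ε ξ * pd 0 (pd 0 f) ξ - cutKernelSnd ε ξ * f ξ)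
      ((hint (continuous_cutKernel hε) ((hf.pd 0).pd 0)).sub
      (hint (continuous_cutKernelSnd hε) hf)), ← integral_const_mul]
  refine integral_congr_ae (.of_forall fun x => ?_)
  set s : ℝ := ‖x‖ ^ 2 with hs
  have hs0 : 0 ≤ s := sq_nonneg _
  have hsum : ∀ t : ℝ, ∑ i : Fin 3, toMink t x i.succ ^ 2 = s := fun t => by
    rw [hs, EuclideanSpace.norm_eq, Real.sq_sqrt (by positivity)]
    simp
  simp only [cutKernel_eq, cutKernelSnd, hsum, toMink_zero]
  have hcd : Continuous fun t => cutDen ε s t := by unfold cutDen; fun_prop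
  have e2 : Continuous fun t => (cutDen ε s t ^ 2)⁻¹ := (hcd.pow 2).inv₀ fun t =>
    pow_ne_zero 2 (cutDen_ne_zero hε hs0 t)
  have e3 : Continuous fun t => (cutDen ε s t ^ 3)⁻¹ := (hcd.pow 3).inv₀ fun t =>
    pow_ne_zero 3 (cutDen_ne_zero hε hs0 t)
  -- At fixed x only the jump of the first time derivative at t = 0 survives. It is twice the
  -- one-sided derivative there and yields the Poisson kernel.
  have key := integral_abs_mul_deriv_deriv (hasDerivAt_cutKernel_time hε hs0)
    (hasDerivAt_cutKernel_time_two hε hs0) (by fun_prop)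
    (fun t => hasDerivAt_toMink_left hf t x) (fun t => hasDerivAt_toMink_left (hf.pd 0) t x)
    (((hf.pd 0).pd 0).continuous.comp (continuous_toMink_left x)) (hf.slice_left x)
    ((hf.pd 0).slice_left x) (((hf.pd 0).pd 0).slice_left x)
  rw [key]
  have hq0 : cutDen ε s 0 = ((ε ^ 2 + s : ℝ) : ℂ) := by
    simp [cutDen]
  simp only [hq0, ← hs]
  have hne : ((ε ^ 2 + s : ℝ) : ℂ) ≠ 0 := by
    exact_mod_cast (by positivity : ε ^ 2 + s ≠ 0)
  have hpi : (Real.pi : ℂ) ≠ 0 := by simp [Real.pi_ne_zero]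
  push_cast at hne ⊢
  field_simp
  ring

/-- The radial integral of r²/(π²(1+r²)²) has the antiderivative (arctan r - r/(1+r²))/(2π²) and
equals 1/(4π); the unit sphere has area 4π. -/
lemma integral_poisson :
    ∫ y : Space, (1 / (Real.pi ^ 2 * (1 + ‖y‖ ^ 2) ^ 2) : ℝ) = 1 := by
  rw [integral_fun_norm_addHaar (E := Space) volume
    (fun r => (1 / (Real.pi ^ 2 * (1 + r ^ 2) ^ 2) : ℝ))]
  have hd : Module.finrank ℝ Space = 3 := by simp
  have hv : volume.real (Metric.ball (0 : Space) 1) = Real.pi * 4 / 3 := by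
    rw [measureReal_def, EuclideanSpace.volume_ball_fin_three]
    simp
    positivity
  have hder : ∀ r : ℝ, HasDerivAt (fun r : ℝ => (2 * Real.pi ^ 2)⁻¹ *
      (Real.arctan r - r * (1 + r ^ 2)⁻¹)) (r ^ (3 - 1) • (1 / (Real.pi ^ 2 * (1 + r ^ 2) ^ 2))) r := by
    intro r
    have hp : 0 < 1 + r ^ 2 := by positivity
    have h1 : HasDerivAt (fun r : ℝ => 1 + r ^ 2) (2 * r) r := by
      simpa using (hasDerivAt_pow 2 r).const_add 1
    refine (((Real.hasDerivAt_arctan r).sub ((hasDerivAt_id r).mul (h1.inv hp.ne'))).const_mul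
      (2 * Real.pi ^ 2)⁻¹).congr_deriv ?_
    simp only [id, smul_eq_mul, Pi.inv_apply]
    have := Real.pi_ne_zero
    field_simp
    ring
  have hlim : Tendsto (fun r : ℝ => (2 * Real.pi ^ 2)⁻¹ * (Real.arctan r - r * (1 + r ^ 2)⁻¹))
      atTop (𝓝 ((2 * Real.pi ^ 2)⁻¹ * (Real.pi / 2 - 0))) := by
    refine Tendsto.const_mul _ (Tendsto.sub
      (Real.tendsto_arctan_atTop.mono_right nhdsWithin_le_nhds) ?_)
    refine squeeze_zero_norm' (a := fun r : ℝ => r⁻¹) ?_ tendsto_inv_atTop_zero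
    filter_upwards [eventually_gt_atTop 0] with r hr
    rw [Real.norm_of_nonneg (by positivity), ← div_eq_mul_inv, div_le_iff₀ (by positivity)]
    have : r⁻¹ * (1 + r ^ 2) = r⁻¹ + r := by field_simp
    rw [this]
    linarith [inv_pos.2 hr]
  have hI := integral_Ioi_of_hasDerivAt_of_tendsto' (a := 0) (fun r _ => hder r)
    (integrableOn_Ioi_deriv_of_nonneg' (fun r _ => hder r)
      (fun r hr => smul_nonneg (pow_nonneg (le_of_lt hr) _) (by positivity)) hlim) hlim
  rw [hd, hv, hI]
  have := Real.pi_ne_zero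
  simp
  field_simp
  norm_num

/-- The time-ordered function is a Green function of the wave operator. -/
theorem T0_wave {f : Mink → ℂ} (hf : IsTest f) :
    T0 (pd 0 (pd 0 f)) - ∑ i : Fin 3, T0 (pd i.succ (pd i.succ f)) = -Complex.I * f 0 := by
  have h1 : Tendsto (fun n : ℕ => T0cut (1 / ((n : ℝ) + 1)) (pd 0 (pd 0 f)) -
      ∑ i : Fin 3, T0cut (1 / ((n : ℝ) + 1)) (pd i.succ (pd i.succ f))) atTop
      (𝓝 (T0 (pd 0 (pd 0 f)) - ∑ i : Fin 3, T0 (pd i.succ (pd i.succ f)))) :=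
    (tendsto_T0cut_seq ((hf.pd _).pd _)).sub
      (tendsto_finsetSum _ fun i _ => tendsto_T0cut_seq ((hf.pd _).pd _))
  refine tendsto_nhds_unique h1 ?_
  have h2 : ∀ n : ℕ, T0cut (1 / ((n : ℝ) + 1)) (pd 0 (pd 0 f)) -
      ∑ i : Fin 3, T0cut (1 / ((n : ℝ) + 1)) (pd i.succ (pd i.succ f)) = -Complex.I *
      ∫ y : Space, ((1 / (Real.pi ^ 2 * (1 + ‖y‖ ^ 2) ^ 2) : ℝ) : ℂ) *
        f (toMink 0 ((1 / ((n : ℝ) + 1)) • y)) := by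
    intro n
    have hε : (0 : ℝ) < 1 / ((n : ℝ) + 1) := by positivity
    rw [T0cut_wave hε hf]
    set ε : ℝ := 1 / ((n : ℝ) + 1)
    congr 1
    -- Substituting x = εy makes the kernel independent of ε, so that ε occurs only in the argument
    -- of `f` and dominated convergence gives f(0).
    have hs := Measure.integral_comp_smul (volume : Measure Space) (fun x : Space =>
      ((ε / (Real.pi ^ 2 * (ε ^ 2 + ‖x‖ ^ 2) ^ 2) : ℝ) : ℂ) * f (toMink 0 x)) ε
    have hd : Module.finrank ℝ Space = 3 := by simp
    rw [hd, abs_of_pos (by positivity)] at hs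
    have hs' := congrArg (fun z : ℂ => (ε ^ 3 : ℝ) • z) hs
    simp only [smul_smul, mul_inv_cancel₀ (by positivity : ε ^ 3 ≠ 0), one_smul] at hs'
    rw [← hs', ← integral_smul]
    refine integral_congr_ae (.of_forall fun y => ?_)
    simp only [Complex.real_smul]
    rw [← mul_assoc, ← Complex.ofReal_mul, norm_smul, Real.norm_of_nonneg hε.le]
    congr 2
    have := Real.pi_ne_zero
    have h4 : 1 + ‖y‖ ^ 2 ≠ 0 := by positivity
    have h5 : ε ^ 2 + (ε * ‖y‖) ^ 2 = ε ^ 2 * (1 + ‖y‖ ^ 2) := by ring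
    rw [h5]
    field_simp
  simp only [h2]
  refine Tendsto.const_mul _ ?_
  obtain ⟨M, hM⟩ := hf.compact.exists_bound_of_continuous hf.continuous
  -- The integral of a nonintegrable function is zero by convention, so the value 1 already implies
  -- integrability.
  have hfin : Integrable (fun y : Space => (1 / (Real.pi ^ 2 * (1 + ‖y‖ ^ 2) ^ 2) : ℝ)) := by
    by_contra h
    have := integral_undef h
    rw [integral_poisson] at this
    exact one_ne_zero this
  have h0 : f 0 = ∫ y : Space, ((1 / (Real.pi ^ 2 * (1 + ‖y‖ ^ 2) ^ 2) : ℝ) : ℂ) * f 0 := by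
    rw [integral_mul_const, integral_complex_ofReal, integral_poisson]
    simp
  rw [h0]
  refine tendsto_integral_of_dominated_convergence
    (fun y => (1 / (Real.pi ^ 2 * (1 + ‖y‖ ^ 2) ^ 2) : ℝ) * M) (fun n => ?_)
    (hfin.mul_const M) (fun n => .of_forall fun y => ?_) (.of_forall fun y => ?_)
  · refine AEStronglyMeasurable.mul (Measurable.aestronglyMeasurable (by fun_prop)) ?_
    exact (hf.continuous.comp ((continuous_toMink_right 0).comp (by fun_prop))).aestronglyMeasurable
  · rw [norm_mul, Complex.norm_real, Real.norm_of_nonneg (by positivity)]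
    exact mul_le_mul_of_nonneg_left (hM _) (by positivity)
  · refine Tendsto.const_mul _ ?_
    have hz : toMink 0 (0 : Space) = 0 := by
      funext μ
      refine Fin.cases rfl (fun i => rfl) μ
    have hc : Tendsto (fun r : ℝ => f (toMink 0 (r • y))) (𝓝 0) (𝓝 (f 0)) := by
      have : Continuous fun r : ℝ => f (toMink 0 (r • y)) :=
        hf.continuous.comp ((continuous_toMink_right 0).comp (by fun_prop))
      have h := this.tendsto 0
      rwa [zero_smul, hz] at h
    exact hc.comp tendsto_one_div_add_atTop_nhds_zero_nat

/-! ### The measure on the hyperboloid -/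

lemma continuous_minkSq : Continuous minkSq := by
  unfold minkSq
  fun_prop

lemma minkSq_smul (r : ℝ) (x : Mink) : minkSq (r • x) = r ^ 2 * minkSq x := by
  simp only [minkSq_eq, Pi.smul_apply, smul_eq_mul, mul_pow, ← Finset.mul_sum]
  ring

lemma measurable_radial : Measurable (fun y : Mink => (√(-minkSq y))⁻¹ • y) :=
  ((continuous_minkSq.neg.sqrt).measurable.inv).smul measurable_id

lemma measurableSet_cone : MeasurableSet {y : Mink | minkSq y < 0 ∧ -1 ≤ minkSq y} :=
  (measurableSet_lt continuous_minkSq.measurable measurable_const).inter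
    (measurableSet_le measurable_const continuous_minkSq.measurable)

lemma measurableSet_hyperboloid : MeasurableSet hyperboloid :=
  measurableSet_eq_fun continuous_minkSq.measurable measurable_const

instance : SFinite sigma := by
  unfold sigma
  infer_instance

lemma ae_mem_hyperboloid : ∀ᵐ e ∂sigma, e ∈ hyperboloid := by
  unfold sigma
  refine Measure.ae_smul_measure ?_ _
  refine (ae_map_iff (p := (· ∈ hyperboloid)) measurable_radial.aemeasurable
    measurableSet_hyperboloid).2 ((ae_restrict_iff' measurableSet_cone).2 ?_)
  refine .of_forall fun y hy => ?_
  have h : 0 < -minkSq y := by linarith [hy.1]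
  show minkSq _ = -1
  rw [minkSq_smul, inv_pow, Real.sq_sqrt h.le]
  have h' : minkSq y ≠ 0 := ne_of_lt hy.1
  field_simp

instance : IsFiniteMeasureOnCompacts sigma where
  lt_top_of_isCompact := by
    intro K hK
    obtain ⟨r, hr⟩ := hK.isBounded.subset_closedBall (0 : Mink)
    refine (measure_mono hr).trans_lt ?_
    unfold sigma
    rw [Measure.smul_apply, smul_eq_mul]
    refine ENNReal.mul_lt_top (by simp) ?_
    rw [Measure.map_apply measurable_radial Metric.isClosed_closedBall.measurableSet,
      Measure.restrict_apply (measurable_radial Metric.isClosed_closedBall.measurableSet)]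
    -- On the truncated cone √(-y²) ≤ 1, so y is no longer than its projection to the hyperboloid,
    -- and the preimage of a ball is bounded.
    refine (measure_mono (t := Metric.closedBall (0 : Mink) |r|) ?_).trans_lt
      (isCompact_closedBall _ _).measure_lt_top
    rintro y ⟨hy1, hy2⟩
    rw [Set.mem_preimage, mem_closedBall_zero_iff, norm_smul, norm_inv,
      Real.norm_of_nonneg (Real.sqrt_nonneg _)] at hy1
    rw [mem_closedBall_zero_iff]
    have hpos : 0 < √(-minkSq y) := Real.sqrt_pos.2 (by linarith [hy2.1])
    have hle : √(-minkSq y) ≤ 1 := Real.sqrt_le_one.2 (by linarith [hy2.2])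
    rw [inv_mul_le_iff₀ hpos] at hy1
    calc ‖y‖ ≤ √(-minkSq y) * r := hy1
      _ ≤ √(-minkSq y) * |r| := by gcongr; exact le_abs_self r
      _ ≤ 1 * |r| := by gcongr
      _ = |r| := one_mul _

/-! ### String integrals of the time-ordered function -/

lemma integrable_string_T0 {m : Mink → ℝ} (hm : Continuous m) (hmc : HasCompactSupport m)
    {f : Mink → ℂ} (hf : IsTest f) :
    Integrable (fun e => (m e : ℂ) * ∫ s in Set.Ioi (0 : ℝ), T0 (shift (s • e) f)) sigma := by
  obtain ⟨M, hM⟩ := hmc.isCompact.isBounded.subset_closedBall (0 : Mink)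
  obtain ⟨C, hC, hdec⟩ := exists_decay_T0_shift hf M
  have hmi : Integrable (fun e => (m e : ℂ)) sigma :=
    (Complex.continuous_ofReal.comp hm).integrable_of_hasCompactSupport
      (hmc.comp_left (g := fun r : ℝ => (r : ℂ)) Complex.ofReal_zero)
  have hmeas : StronglyMeasurable (fun e : Mink => ∫ s in Set.Ioi (0 : ℝ), T0 (shift (s • e) f)) := by
    refine StronglyMeasurable.integral_prod_right (E := ℂ)
      (f := fun (e : Mink) (s : ℝ) => T0 (shift (s • e) f)) ?_
    exact (measurable_T0_shift hf).comp_measurable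
      (by fun_prop : Measurable fun p : Mink × ℝ => p.2 • p.1)
  refine (hmi.norm.mul_const (∫ s in Set.Ioi (0 : ℝ), C * (1 + s ^ 2)⁻¹)).mono'
    (hmi.aestronglyMeasurable.mul hmeas.aestronglyMeasurable) ?_
  filter_upwards [ae_mem_hyperboloid] with e he
  rw [norm_mul]
  by_cases h0 : m e = 0
  · simp [h0]
  · refine mul_le_mul_of_nonneg_left ?_ (norm_nonneg _)
    have heM : ‖e‖ ≤ M := by
      have := hM (subset_tsupport _ h0)
      rwa [mem_closedBall_zero_iff] at this
    refine norm_integral_le_of_norm_le (integrable_inv_one_add_sq.integrableOn.const_mul C) ?_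
    exact (ae_restrict_iff' measurableSet_Ioi).2 (.of_forall fun s hs =>
      hdec e he heM s (le_of_lt hs))

/-- The string integral of `T₀`. -/
def strT0 (m : Mink → ℝ) (f : Mink → ℂ) : ℂ :=
  ∫ e, (m e : ℂ) * (∫ s in Set.Ioi (0 : ℝ), T0 (shift (s • e) f)) ∂sigma

/-- The string integral of `δ`. -/
def strDelta (m : Mink → ℝ) (f : Mink → ℂ) : ℂ :=
  ∫ e, (m e : ℂ) * (∫ s in Set.Ioi (0 : ℝ), f (s • e)) ∂sigma

/-- The factors e^μ assemble the derivative along the string, which integrates to -T₀ for every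
direction e. The average over e then uses that c has total weight one. -/
lemma sum_strT0_pd {c : Mink → ℝ} (hc : IsSmearing c) {f : Mink → ℂ} (hf : IsTest f) :
    ∑ μ, strT0 (fun e => c e * e μ) (pd μ f) = -T0 f := by
  unfold strT0
  rw [← integral_finsetSum]
  · have h1 : ∫ e, (c e : ℂ) * -T0 f ∂sigma = -T0 f := by
      rw [integral_mul_const, integral_complex_ofReal, hc.weight]
      simp
    rw [← h1]
    refine integral_congr_ae ?_
    filter_upwards [ae_mem_hyperboloid] with e he
    rw [← integral_T0_shift_dirD hf he]
    have h2 : ∀ s : ℝ, T0 (shift (s • e) (dirD e f)) =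
        ∑ μ, (e μ : ℂ) * T0 (shift (s • e) (pd μ f)) := by
      intro s
      rw [← T0_sum _ _ fun μ _ => (hf.pd μ).shift _]
      congr 1
      funext ξ
      exact dirD_eq_sum e f _
    simp only [h2]
    rw [integral_finsetSum _ fun μ _ => (integrableOn_T0_shift (hf.pd μ) he).const_mul _]
    rw [Finset.mul_sum]
    refine Finset.sum_congr rfl fun μ _ => ?_
    rw [integral_const_mul]
    push_cast
    ring
  · intro μ _
    exact integrable_string_T0 (hc.smooth.continuous.mul (continuous_apply μ))
      hc.compact.mul_right (hf.pd μ)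

lemma T0_wave_eta {f : Mink → ℂ} (hf : IsTest f) :
    ∑ α, (eta α α : ℂ) * T0 (pd α (pd α f)) = -Complex.I * f 0 := by
  rw [← T0_wave hf, Fin.sum_univ_succ]
  simp [eta, Fin.succ_ne_zero, sub_eq_add_neg]

/-- The wave operator commutes with translations, so the wave equation applies at each point of the
string. -/
lemma sum_strT0_wave {m : Mink → ℝ} (hm : Continuous m) (hmc : HasCompactSupport m)
    {f : Mink → ℂ} (hf : IsTest f) :
    ∑ α, (eta α α : ℂ) * strT0 m (pd α (pd α f)) = -Complex.I * strDelta m f := by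
  unfold strT0 strDelta
  rw [Finset.sum_congr rfl fun α _ => (integral_const_mul _ _).symm, ← integral_const_mul,
    ← integral_finsetSum]
  · refine integral_congr_ae ?_
    filter_upwards [ae_mem_hyperboloid] with e he
    have h1 : ∀ s : ℝ, ∑ α, (eta α α : ℂ) * T0 (shift (s • e) (pd α (pd α f))) =
        -Complex.I * f (s • e) := by
      intro s
      have := T0_wave_eta (hf.shift (s • e))
      simp only [pd_shift] at this
      rw [this, shift, zero_add]
    rw [mul_left_comm, ← integral_const_mul]
    simp only [← h1]
    rw [integral_finsetSum _ fun α _ =>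
      (integrableOn_T0_shift ((hf.pd α).pd α) he).const_mul _, Finset.mul_sum]
    refine Finset.sum_congr rfl fun α _ => ?_
    rw [integral_const_mul]
    ring
  · intro α _
    exact (integrable_string_T0 hm hmc ((hf.pd α).pd α)).const_mul _

/-! ### Two-point obstructions on test functions -/

lemma sum_eta_smul {V : Type*} [AddCommGroup V] [Module ℝ V] (α : Fin 4) (x : Fin 4 → V) :
    ∑ β, eta α β • x β = eta α α • x α := by
  refine Finset.sum_eq_single α (fun β _ h => ?_) (fun h => absurd (Finset.mem_univ _) h)
  simp [eta, Ne.symm h]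

lemma sum_eta_mul (α : Fin 4) (x : Fin 4 → ℂ) :
    ∑ β, (eta α β : ℂ) * x β = eta α α * x α := by
  simpa using sum_eta_smul α x

lemma eta_comm (α β : Fin 4) : eta α β = eta β α := by
  unfold eta
  by_cases h : α = β
  · subst h; rfl
  · simp [h, Ne.symm h]

lemma eta_mul_self (α : Fin 4) : eta α α * eta α α = 1 := by
  unfold eta
  by_cases h : α = 0 <;> simp [h]

lemma eta_of_ne {α β : Fin 4} (h : α ≠ β) : eta α β = 0 := by simp [eta, h]

lemma sum_eta_eta_mul (κ : Fin 4) (x : Fin 4 → ℂ) :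
    ∑ α, (eta α α : ℂ) * ((eta α κ : ℂ) * x α) = x κ := by
  rw [Finset.sum_eq_single κ (fun β _ h => by simp [eta_of_ne h])
    (fun h => absurd (Finset.mem_univ _) h), ← mul_assoc, ← Complex.ofReal_mul, eta_mul_self]
  simp

lemma dD_apply (μ : Fin 4) (u : Dist) (f : Mink → ℂ) : dD μ u f = -u (pd μ f) := rfl

lemma divProp_apply (u : Fin 4 → Dist) (f : Mink → ℂ) :
    divProp u f = -∑ α, (eta α α : ℂ) * u α (pd α f) := by
  simp only [divProp, sum_eta_smul]
  simp [Finset.sum_apply, dD_apply]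

lemma strI'_dD_T0 (c : Mink → ℝ) (ν κ : Fin 4) (f : Mink → ℂ) :
    strI' c ν (dD κ T0) f = -strT0 (fun e => c e * e ν) (pd κ f) := by
  unfold strI' strT0
  rw [← integral_neg]
  refine integral_congr_ae (.of_forall fun e => ?_)
  simp only
  rw [← mul_neg, ← integral_neg]
  congr 2
  funext s
  rw [← pd_shift]
  rfl

lemma strILow'_apply (c : Mink → ℝ) (ν : Fin 4) (u : Dist) (f : Mink → ℂ) :
    strILow' c ν u f = eta ν ν * strI' c ν u f := by
  rw [strILow', sum_eta_smul]
  simp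

/-- The divergence `∂^α ⟨T F_{αν} χ'⟩` on test functions. -/
def divF (cF : ℂ) (c : Mink → ℝ) (ν : Fin 4) : Gluon → Dist
  | Sum.inl (κ, ρ) => fun f =>
      -Complex.I * (1 + cF) * (eta ν κ * pd ρ f 0 - eta ν ρ * pd κ f 0)
  | Sum.inr κ => fun f =>
      Complex.I * (eta ν κ * f 0 + eta ν ν * strDelta (fun e => c e * e ν) (pd κ f))

lemma kinFF_apply (μ ν κ ρ : Fin 4) (f : Mink → ℂ) :
    kinFF μ ν κ ρ f = -(eta ν κ * T0 (pd ρ (pd μ f)) - eta μ κ * T0 (pd ρ (pd ν f))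
      - eta ν ρ * T0 (pd κ (pd μ f)) + eta μ ρ * T0 (pd κ (pd ν f))) := by
  simp [kinFF, dD_apply]

/-- Two of the four kinematic terms contain the wave operator. The other two are the same third
derivative of T₀ with opposite signs. The renormalization term has the tensor structure of the
surviving δ-terms and turns their coefficient 1 into 1+c_F. -/
lemma divProp_FF (cF : ℂ) (c : Mink → ℝ) (b : Mink → Fin 4 → ℝ) (ν κ ρ : Fin 4) {f : Mink → ℂ}
    (hf : IsTest f) :
    divProp (fun α => prop cF c b (some (fF α ν)) (fF κ ρ)) f = divF cF c ν (fF κ ρ) f := by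
  have h1 : ∀ α, prop cF c b (some (fF α ν)) (fF κ ρ) (pd α f) =
      -(eta ν κ * T0 (pd α (pd α (pd ρ f)))) + eta α κ * T0 (pd ρ (pd ν (pd α f)))
      + eta ν ρ * T0 (pd α (pd α (pd κ f))) - eta α ρ * T0 (pd κ (pd ν (pd α f)))
      - cF * Complex.I * (eta α κ * (eta ρ ν * pd α f 0) - eta α ρ * (eta κ ν * pd α f 0)) := by
    intro α
    have e1 : pd ρ (pd α (pd α f)) = pd α (pd α (pd ρ f)) := by
      rw [pd_comm (hf.pd α).smooth, pd_comm hf.smooth ρ α]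
    have e2 : pd κ (pd α (pd α f)) = pd α (pd α (pd κ f)) := by
      rw [pd_comm (hf.pd α).smooth, pd_comm hf.smooth κ α]
    have : prop cF c b (some (fF α ν)) (fF κ ρ) = kinFF α ν κ ρ -
        (cF * Complex.I) • ((eta α κ * eta ρ ν - eta α ρ * eta κ ν) • delta) := rfl
    rw [this, Pi.sub_apply, kinFF_apply, e1, e2]
    simp [delta]
    ring
  rw [divProp_apply]
  simp only [h1]
  have h2 : ∑ α, (eta α α : ℂ) * (-(eta ν κ * T0 (pd α (pd α (pd ρ f)))) +
      eta α κ * T0 (pd ρ (pd ν (pd α f))) + eta ν ρ * T0 (pd α (pd α (pd κ f)))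
      - eta α ρ * T0 (pd κ (pd ν (pd α f)))
      - cF * Complex.I * (eta α κ * (eta ρ ν * pd α f 0) - eta α ρ * (eta κ ν * pd α f 0))) =
      -(eta ν κ * ∑ α, (eta α α : ℂ) * T0 (pd α (pd α (pd ρ f))))
      + ∑ α, (eta α α : ℂ) * (eta α κ * T0 (pd ρ (pd ν (pd α f))))
      + eta ν ρ * ∑ α, (eta α α : ℂ) * T0 (pd α (pd α (pd κ f)))
      - ∑ α, (eta α α : ℂ) * (eta α ρ * T0 (pd κ (pd ν (pd α f))))
      - cF * Complex.I * (∑ α, (eta α α : ℂ) * (eta α κ * (eta ρ ν * pd α f 0))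
        - ∑ α, (eta α α : ℂ) * (eta α ρ * (eta κ ν * pd α f 0))) := by
    simp only [Finset.mul_sum, ← Finset.sum_add_distrib, ← Finset.sum_sub_distrib,
      ← Finset.sum_neg_distrib]
    refine Finset.sum_congr rfl fun α _ => ?_
    ring
  rw [h2, T0_wave_eta (hf.pd ρ), T0_wave_eta (hf.pd κ)]
  simp only [sum_eta_eta_mul]
  have e3 : pd ρ (pd ν (pd κ f)) = pd κ (pd ν (pd ρ f)) := by
    rw [pd_comm hf.smooth ν κ, pd_comm (hf.pd ν).smooth ρ κ, pd_comm hf.smooth ρ ν]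
  rw [e3]
  simp only [divF, eta_comm κ ν, eta_comm ρ ν]
  ring

/-- The wave operator produces a local δ and a string-localized δ. The nonlocal remainder ∂_ν∂_κ T₀
cancels against the string integral contracted with its derivative, by `sum_strT0_pd`. -/
lemma divProp_FA (cF : ℂ) {c : Mink → ℝ} (hc : IsSmearing c) (b : Mink → Fin 4 → ℝ)
    (ν κ : Fin 4) {f : Mink → ℂ} (hf : IsTest f) :
    divProp (fun α => prop cF c b (some (fF α ν)) (fA κ)) f = divF cF c ν (fA κ) f := by
  set S : Fin 4 → (Mink → ℂ) → ℂ := fun ν => strT0 (fun e => c e * e ν) with hS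
  have h1 : ∀ α, prop cF c b (some (fF α ν)) (fA κ) (pd α f) =
      eta ν κ * T0 (pd α (pd α f)) - eta α κ * T0 (pd ν (pd α f))
      + (eta ν ν * S ν (pd α (pd α (pd κ f))) - eta α α * S α (pd α (pd κ (pd ν f)))) := by
    intro α
    have e1 : pd κ (pd α (pd α f)) = pd α (pd α (pd κ f)) := by
      rw [pd_comm (hf.pd α).smooth, pd_comm hf.smooth κ α]
    have e2 : pd κ (pd ν (pd α f)) = pd α (pd κ (pd ν f)) := by
      rw [pd_comm hf.smooth ν α, pd_comm (hf.pd ν).smooth κ α]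
    have : prop cF c b (some (fF α ν)) (fA κ) = propFA c α ν κ := rfl
    rw [this, propFA]
    simp only [Pi.neg_apply, Pi.sub_apply, Pi.smul_apply, dD_apply, strILow'_apply, strI'_dD_T0,
      e1, e2, Complex.real_smul, hS]
    ring
  rw [divProp_apply]
  simp only [h1]
  have h2 : ∑ α, (eta α α : ℂ) * (eta ν κ * T0 (pd α (pd α f)) - eta α κ * T0 (pd ν (pd α f))
      + (eta ν ν * S ν (pd α (pd α (pd κ f))) - eta α α * S α (pd α (pd κ (pd ν f))))) =
      eta ν κ * ∑ α, (eta α α : ℂ) * T0 (pd α (pd α f))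
      - ∑ α, (eta α α : ℂ) * (eta α κ * T0 (pd ν (pd α f)))
      + eta ν ν * ∑ α, (eta α α : ℂ) * S ν (pd α (pd α (pd κ f)))
      - ∑ α, S α (pd α (pd κ (pd ν f))) := by
    simp only [Finset.mul_sum, ← Finset.sum_add_distrib, ← Finset.sum_sub_distrib]
    refine Finset.sum_congr rfl fun α _ => ?_
    have : (eta α α : ℂ) * eta α α = 1 := by exact_mod_cast eta_mul_self α
    linear_combination (-S α (pd α (pd κ (pd ν f)))) * this
  have hw : ∑ α, (eta α α : ℂ) * S ν (pd α (pd α (pd κ f))) =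
      -Complex.I * strDelta (fun e => c e * e ν) (pd κ f) :=
    sum_strT0_wave (hc.smooth.continuous.mul (continuous_apply ν)) hc.compact.mul_right (hf.pd κ)
  rw [h2, T0_wave_eta hf, sum_eta_eta_mul, sum_strT0_pd hc ((hf.pd ν).pd κ), hw,
    pd_comm hf.smooth κ ν]
  simp only [divF]
  ring

/-- The derivative of the propagator cancels and only the trace correction is left, expressed
through the divergence. The contraction over μ and ρ of η_{μρ}D_ν - η_{μν}D_ρ is 3D_ν, whence the
factor 1/3. -/
lemma twoPointObs_F (cF : ℂ) {c : Mink → ℝ} (hc : IsSmearing c) (b : Mink → Fin 4 → ℝ)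
    (μ ρ ν : Fin 4) (χ : Gluon) {f : Mink → ℂ} (hf : IsTest f) :
    twoPointObs cF c b μ (some (fF ρ ν)) χ f =
      -(1 / 3) * (eta μ ρ * divF cF c ν χ f - eta μ ν * divF cF c ρ χ f) := by
  have h : ∀ ν, divProp (fun α => prop cF c b (some (fF α ν)) χ) f = divF cF c ν χ f := by
    intro ν
    rcases χ with ⟨κ, σ⟩ | κ
    · exact divProp_FF cF c b ν κ σ hf
    · exact divProp_FA cF hc b ν κ hf
  have e : twoPointObs cF c b μ (some (fF ρ ν)) χ =
      dD μ (prop cF c b (some (fF ρ ν)) χ)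
        - (1 / 3 : ℝ) • (eta μ ρ • divProp (fun α => prop cF c b (some (fF α ν)) χ)
            - eta μ ν • divProp (fun α => prop cF c b (some (fF α ρ)) χ))
        - dD μ (prop cF c b (some (fF ρ ν)) χ) := rfl
  rw [e]
  simp only [Pi.sub_apply, Pi.smul_apply, h, Complex.real_smul]
  push_cast
  ring

/-- The trace correction vanishes off the diagonal, and half the failure of the curl relation
remains. Diagonal components are multiplied by F_{μμ} = 0 in the obstruction. -/
lemma twoPointObs_A_of_ne (cF : ℂ) (c : Mink → ℝ) (b : Mink → Fin 4 → ℝ) {μ ν : Fin 4}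
    (hμν : μ ≠ ν) (χ : Gluon) (f : Mink → ℂ) :
    twoPointObs cF c b μ (some (fA ν)) χ f =
      (1 / 2) * (prop cF c b (some (fF μ ν)) χ f + prop cF c b (some (fA ν)) χ (pd μ f)
        - prop cF c b (some (fA μ)) χ (pd ν f)) := by
  have e : twoPointObs cF c b μ (some (fA ν)) χ =
      (1 / 2 : ℝ) • (dD μ (prop cF c b (some (fA ν)) χ) + dD ν (prop cF c b (some (fA μ)) χ))
        + (1 / 2 : ℝ) • prop cF c b (some (fF μ ν)) χ
        - (1 / 4 : ℝ) • (eta μ ν • divProp (fun α => prop cF c b (some (fA α)) χ))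
        - dD μ (prop cF c b (some (fA ν)) χ) := rfl
  rw [e, eta_of_ne hμν]
  simp only [Pi.sub_apply, Pi.add_apply, Pi.smul_apply, dD_apply, Complex.real_smul]
  push_cast
  ring

lemma pd_comp_sub (y : Mink) (f : Mink → ℂ) (μ : Fin 4) :
    (fun ξ => pd μ f (ξ - y)) = pd μ (fun ξ => f (ξ - y)) := by
  have h : ∀ g : Mink → ℂ, (fun ξ => g (ξ - y)) = shift (-y) g := fun g => by
    funext ξ
    rw [shift, sub_eq_add_neg]
  rw [h, h, pd_shift]

lemma strI_dD_T0_apply (c : Mink → ℝ) (κ ρ : Fin 4) (f : Mink → ℂ) :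
    strILow c κ (dD ρ T0) f = -strILow c κ T0 (pd ρ f) := by
  simp only [strILow, sum_eta_smul, Pi.smul_apply, strI]
  rw [← smul_neg, ← integral_neg]
  congr 2
  funext e
  rw [← mul_neg, ← integral_neg]
  congr 2
  funext s
  have : (fun ξ => pd ρ f (ξ - s • e)) = pd ρ (fun ξ => f (ξ - s • e)) := pd_comp_sub (s • e) f ρ
  rw [this]
  rfl

/-- The kinematic propagators satisfy the curl relation exactly: the string terms are gradients in
the index of A and cancel since partial derivatives commute. Only the renormalization of ⟨T F F'⟩ is
left. -/
lemma twoPointObs_A_F (cF : ℂ) (c : Mink → ℝ) (b : Mink → Fin 4 → ℝ) {μ ν : Fin 4}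
    (hμν : μ ≠ ν) (κ ρ : Fin 4) {f : Mink → ℂ} (hf : IsTest f) :
    twoPointObs cF c b μ (some (fA ν)) (fF κ ρ) f =
      -(cF * Complex.I / 2) * (eta μ κ * eta ρ ν - eta μ ρ * eta κ ν) * f 0 := by
  rw [twoPointObs_A_of_ne cF c b hμν]
  have e1 : prop cF c b (some (fF μ ν)) (fF κ ρ) = kinFF μ ν κ ρ -
        (cF * Complex.I) • ((eta μ κ * eta ρ ν - eta μ ρ * eta κ ν) • delta) := rfl
  have e2 : ∀ ν, prop cF c b (some (fA ν)) (fF κ ρ) = propAF c ν κ ρ := fun _ => rfl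
  rw [e1, e2, e2, Pi.sub_apply, kinFF_apply]
  simp only [propAF, Pi.neg_apply, Pi.sub_apply, Pi.add_apply, Pi.smul_apply, dD_apply,
    strI_dD_T0_apply, Complex.real_smul, pd_comm hf.smooth ν μ, smul_eq_mul, delta]
  push_cast
  ring

/-- Derivatives commute with translations, and a sign passes through integrals unconditionally.
Hence this holds for any functional `u`, without linearity or integrability. -/
lemma strI'_dD_comm (c : Mink → ℝ) (ν κ : Fin 4) (u : Dist) (f : Mink → ℂ) :
    strI' c ν (dD κ u) f = -strI' c ν u (pd κ f) := by
  unfold strI'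
  rw [← integral_neg]
  congr 1
  funext e
  rw [← mul_neg, ← integral_neg]
  congr 2
  funext s
  have : (fun ξ => pd κ f (ξ + s • e)) = pd κ (fun ξ => f (ξ + s • e)) :=
    (pd_shift (s • e) f κ).symm
  rw [this]
  rfl

lemma strI_dD_comm (c : Mink → ℝ) (ν κ : Fin 4) (u : Dist) (f : Mink → ℂ) :
    strI c ν (dD κ u) f = -strI c ν u (pd κ f) := by
  unfold strI
  rw [← integral_neg]
  congr 1
  funext e
  rw [← mul_neg, ← integral_neg]
  congr 2
  funext s
  have : (fun ξ => pd κ f (ξ - s • e)) = pd κ (fun ξ => f (ξ - s • e)) := pd_comp_sub (s • e) f κ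
  rw [this]
  rfl

lemma dD_strII (c : Mink → ℝ) (κ : Fin 4) (u : Dist) (f : Mink → ℂ) :
    strII c (dD κ u) f = -strII c u (pd κ f) := by
  have h : ∀ ν, strILow' c ν (dD κ u) = dD κ (strILow' c ν u) := by
    intro ν
    funext h
    rw [dD_apply, strILow'_apply, strILow'_apply, strI'_dD_comm]
    ring
  simp only [strII, h, Finset.sum_apply, strI_dD_comm, Finset.sum_neg_distrib]

lemma twoPointObs_A_A (cF : ℂ) (c : Mink → ℝ) (b : Mink → Fin 4 → ℝ) {μ ν : Fin 4}
    (hμν : μ ≠ ν) (κ : Fin 4) {f : Mink → ℂ} (hf : IsTest f) :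
    twoPointObs cF c b μ (some (fA ν)) (fA κ) f = 0 := by
  rw [twoPointObs_A_of_ne cF c b hμν]
  have e1 : prop cF c b (some (fF μ ν)) (fA κ) = propFA c μ ν κ := rfl
  have e2 : ∀ ν, prop cF c b (some (fA ν)) (fA κ) = propAA c ν κ := fun _ => rfl
  rw [e1, e2, e2]
  simp only [propFA, propAA, Pi.neg_apply, Pi.sub_apply, Pi.add_apply, Pi.smul_apply, dD_apply,
    dD_strII, strILow'_apply, strI'_dD_comm, Complex.real_smul, pd_comm hf.smooth ν μ]
  ring

lemma twoPointObs_w (cF : ℂ) (c : Mink → ℝ) (b : Mink → Fin 4 → ℝ) (μ : Fin 4) (χ : Gluon) :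
    twoPointObs cF c b μ none χ = 0 := by
  have e : twoPointObs cF c b μ none χ = ∑ κ, ∑ ν, strJ b κ ν (dD μ (kinF c κ ν χ)) -
      dD μ (∑ κ, ∑ ν, strJ b κ ν (kinF c κ ν χ)) := rfl
  have h : ∀ κ ν, strJ b κ ν (dD μ (kinF c κ ν χ)) = dD μ (strJ b κ ν (kinF c κ ν χ)) := by
    intro κ ν
    funext f
    rw [dD_apply]
    unfold strJ
    rw [← integral_neg]
    congr 1
    funext e
    rw [← mul_neg, ← integral_neg]
    congr 2
    funext s
    have : (fun ξ => pd μ f (ξ - s • e)) = pd μ (fun ξ => f (ξ - s • e)) := pd_comp_sub (s • e) f μ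
    rw [this, dD_apply, mul_neg]
  rw [e]
  funext f
  simp only [h, Pi.sub_apply, Finset.sum_apply, dD_apply, Finset.sum_neg_distrib, sub_self,
    Pi.zero_apply]

lemma pd_const_zero (μ : Fin 4) : pd μ (fun _ => 0) = fun _ => 0 := by
  funext x
  simp [pd]

lemma T0_const_zero : T0 (fun _ => 0) = 0 := by
  simp [T0]

/-- Functionals in `Dist` need not vanish at zero. This disposes of the diagonal terms, whose
coefficient F_{μμ} is zero. -/
lemma twoPointObs_A_zero (cF : ℂ) (c : Mink → ℝ) (b : Mink → Fin 4 → ℝ) (μ ν : Fin 4)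
    (χ : Gluon) : twoPointObs cF c b μ (some (fA ν)) χ (fun _ => 0) = 0 := by
  have hp : ∀ φ : Gluon, prop cF c b (some φ) χ (fun _ => 0) = 0 := by
    intro φ
    rcases φ with ⟨α, β⟩ | α <;> rcases χ with ⟨κ, ρ⟩ | κ <;>
    simp [prop, kinFF, propFA, propAF, propAA, dD_apply, strILow, strILow', strI, strI', strII,
      pd_const_zero, T0_const_zero, delta]
  simp [twoPointObs, propD, dD_apply, divProp, pd_const_zero, hp]

/-! ### String integrals of functions of spacelike compact support. -/

/-- Smooth functions of spacelike compact support. -/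
structure IsSpacelikeCompact (h : Mink → ℂ) : Prop where
  smooth : ContDiff ℝ ∞ h
  support : ∃ r : ℝ, ∀ x : Mink, r + |x 0| < √(∑ i : Fin 3, x i.succ ^ 2) → h x = 0

lemma IsSpacelikeCompact.continuous {h : Mink → ℂ} (hh : IsSpacelikeCompact h) : Continuous h :=
  hh.smooth.continuous

lemma IsSpacelikeCompact.dirD {h : Mink → ℂ} (hh : IsSpacelikeCompact h) (v : Mink) :
    IsSpacelikeCompact (dirD v h) := by
  refine ⟨(hh.smooth.fderiv_right (m := ∞) (by simp)).clm_apply contDiff_const, ?_⟩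
  obtain ⟨r, hr⟩ := hh.support
  refine ⟨r, fun x hx => ?_⟩
  have hopen : IsOpen {x : Mink | r + |x 0| < √(∑ i : Fin 3, x i.succ ^ 2)} :=
    isOpen_lt (by fun_prop) (by fun_prop)
  have : h =ᶠ[𝓝 x] fun _ => 0 := by
    filter_upwards [hopen.mem_nhds hx] with y hy
    exact hr y hy
  rw [StringYM.dirD, this.fderiv_eq]
  simp

lemma IsSpacelikeCompact.pd {h : Mink → ℂ} (hh : IsSpacelikeCompact h) (μ : Fin 4) :
    IsSpacelikeCompact (pd μ h) := hh.dirD (Pi.single μ 1)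

/-- For e² = -1 the spatial length of e exceeds |e₀| by the inverse of their sum, hence by at least
1/(2|M|+1) when ‖e‖ ≤ M. So the string leaves the support at a linear rate, uniformly in e and x. -/
lemma IsSpacelikeCompact.exists_cutoff {h : Mink → ℂ} (hh : IsSpacelikeCompact h) (R M : ℝ) :
    ∃ S : ℝ, 0 < S ∧ ∀ x, ‖x‖ ≤ R → ∀ e ∈ hyperboloid, ‖e‖ ≤ M → ∀ s : ℝ, S ≤ s →
      h (x + s • e) = 0 := by
  obtain ⟨r, hr⟩ := hh.support
  refine ⟨(2 * |M| + 1) * (|r| + 3 * |R| + 1), by positivity, fun x hx e he heM s hs => hr _ ?_⟩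
  have hspn : ∀ y : Mink, √(∑ i : Fin 3, y i.succ ^ 2) = ‖spatial y‖ := fun y => by
    rw [EuclideanSpace.norm_eq]
    simp
  have hadd : spatial (x + s • e) = spatial x + s • spatial e := rfl
  have hs0 : 0 ≤ s := le_trans (by positivity) hs
  have hxR : ‖x‖ ≤ |R| := hx.trans (le_abs_self R)
  have hx0 : |x 0| ≤ |R| := (norm_le_pi_norm x 0).trans hxR
  have he0 : |e 0| ≤ |M| := ((norm_le_pi_norm e 0).trans heM).trans (le_abs_self M)
  have hxs : ‖spatial x‖ ≤ 2 * |R| := by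
    rw [← hspn]
    refine Real.sqrt_le_iff.2 ⟨by positivity, ?_⟩
    have h2 : ∀ i : Fin 3, x i.succ ^ 2 ≤ |R| ^ 2 := fun i => by
      have := (norm_le_pi_norm x i.succ).trans hxR
      rw [Real.norm_eq_abs] at this
      rw [← sq_abs]
      gcongr
    rw [Fin.sum_univ_three]
    nlinarith [h2 0, h2 1, h2 2, sq_nonneg |R|]
  have hesq : ‖spatial e‖ ^ 2 = 1 + |e 0| ^ 2 := by
    rw [← hspn, Real.sq_sqrt (by positivity), sq_abs]
    have : minkSq e = -1 := he
    rw [minkSq_eq] at this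
    linarith
  set E := ‖spatial e‖ with hE
  have hE0 : 0 ≤ E := norm_nonneg _
  have ha0 := abs_nonneg (e 0)
  have hE1 : E ≤ |e 0| + 1 := by nlinarith
  have hlt : |e 0| < E := by nlinarith
  have hgap : 1 ≤ (E - |e 0|) * (2 * |M| + 1) := by
    have : (E - |e 0|) * (E + |e 0|) = 1 := by linear_combination hesq
    rw [← this]
    exact mul_le_mul_of_nonneg_left (by linarith) (by linarith)
  have hmain : |r| + 3 * |R| + 1 ≤ s * (E - |e 0|) := by
    calc |r| + 3 * |R| + 1 = 1 * (|r| + 3 * |R| + 1) := (one_mul _).symm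
      _ ≤ ((E - |e 0|) * (2 * |M| + 1)) * (|r| + 3 * |R| + 1) := by gcongr
      _ = (E - |e 0|) * ((2 * |M| + 1) * (|r| + 3 * |R| + 1)) := by ring
      _ ≤ (E - |e 0|) * s := mul_le_mul_of_nonneg_left hs (by linarith)
      _ = _ := mul_comm _ _
  have h3 : s * E ≤ ‖spatial x + s • spatial e‖ + ‖spatial x‖ := by
    have := norm_sub_le (spatial x + s • spatial e) (spatial x)
    rwa [add_sub_cancel_left, norm_smul, Real.norm_of_nonneg hs0] at this
  have h4 : |(x + s • e) 0| ≤ |x 0| + s * |e 0| := by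
    have := abs_add_le (x 0) (s * e 0)
    rwa [abs_mul, abs_of_nonneg hs0] at this
  rw [hspn, hadd]
  linarith [le_abs_self r]

/-- The measure on pairs of a string direction and a string parameter. -/
def strMeasure : Measure (Mink × ℝ) := sigma.prod (volume.restrict (Set.Ioi 0))

instance : SFinite strMeasure := by unfold strMeasure; infer_instance

instance : IsFiniteMeasureOnCompacts (volume.restrict (Set.Ioi (0 : ℝ))) := inferInstance

instance : IsFiniteMeasureOnCompacts strMeasure := by unfold strMeasure; infer_instance

lemma ae_strMeasure : ∀ᵐ p ∂strMeasure, p.1 ∈ hyperboloid ∧ 0 < p.2 := by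
  unfold strMeasure
  refine Filter.Eventually.and ?_ ?_
  · exact Measure.quasiMeasurePreserving_fst.ae ae_mem_hyperboloid
  · exact Measure.quasiMeasurePreserving_snd.ae (ae_restrict_mem measurableSet_Ioi)

/-- A weighted string integral of a function. -/
def strS (m : Mink → ℝ) (n : ℕ) (h : Mink → ℂ) (x : Mink) : ℂ :=
  ∫ p : Mink × ℝ, ((m p.1 : ℂ) * (p.2 : ℂ) ^ n) * h (x + p.2 • p.1) ∂strMeasure

lemma exists_strS_cutoff {m : Mink → ℝ} (hmc : HasCompactSupport m) {h : Mink → ℂ}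
    (hh : IsSpacelikeCompact h) (R : ℝ) :
    ∃ Q : Set (Mink × ℝ), IsCompact Q ∧ ∀ x, ‖x‖ ≤ R → ∀ p : Mink × ℝ, p.1 ∈ hyperboloid →
      0 < p.2 → p ∉ Q → m p.1 = 0 ∨ h (x + p.2 • p.1) = 0 := by
  obtain ⟨M, hM⟩ := hmc.isCompact.isBounded.subset_closedBall (0 : Mink)
  obtain ⟨S, hS, hcut⟩ := hh.exists_cutoff R M
  refine ⟨Metric.closedBall 0 M ×ˢ Set.Icc 0 S, (isCompact_closedBall _ _).prod isCompact_Icc,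
    fun x hx p hp1 hp2 hpQ => ?_⟩
  by_contra hcon
  push Not at hcon
  have h1 : ‖p.1‖ ≤ M := by
    have := hM (subset_tsupport _ hcon.1)
    rwa [mem_closedBall_zero_iff] at this
  refine hpQ ⟨by rwa [mem_closedBall_zero_iff], hp2.le, ?_⟩
  by_contra h2
  exact hcon.2 (hcut x hx p.1 hp1 h1 p.2 (le_of_not_ge h2))

lemma integrable_strS {m : Mink → ℝ} (hm : Continuous m) (hmc : HasCompactSupport m) (n : ℕ)
    {h : Mink → ℂ} (hh : IsSpacelikeCompact h) (x : Mink) :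
    Integrable (fun p : Mink × ℝ => ((m p.1 : ℂ) * (p.2 : ℂ) ^ n) * h (x + p.2 • p.1))
      strMeasure := by
  obtain ⟨Q, hQ, hcut⟩ := exists_strS_cutoff hmc hh ‖x‖
  have hcont : Continuous (fun p : Mink × ℝ =>
      ((m p.1 : ℂ) * (p.2 : ℂ) ^ n) * h (x + p.2 • p.1)) := by
    have := hh.continuous
    fun_prop
  have hi := hcont.continuousOn.integrableOn_compact (μ := strMeasure) hQ
  refine ((integrable_indicator_iff hQ.measurableSet).2 hi).congr ?_
  filter_upwards [ae_strMeasure] with p hp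
  by_cases hpQ : p ∈ Q
  · simp [hpQ]
  · rw [Set.indicator_of_notMem hpQ]
    rcases hcut x le_rfl p hp.1 hp.2 hpQ with h0 | h0 <;> simp [h0]

lemma strS_eq_iterated {m : Mink → ℝ} (hm : Continuous m) (hmc : HasCompactSupport m) (n : ℕ)
    {h : Mink → ℂ} (hh : IsSpacelikeCompact h) (x : Mink) :
    strS m n h x = ∫ e, (m e : ℂ) * (∫ s in Set.Ioi (0 : ℝ), (s : ℂ) ^ n * h (x + s • e)) ∂sigma := by
  unfold strS
  have hi := integrable_strS hm hmc n hh x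
  unfold strMeasure at hi ⊢
  rw [integral_prod _ hi]
  refine integral_congr_ae (.of_forall fun e => ?_)
  simp only [mul_assoc]
  rw [integral_const_mul]

/-- For base points in a bounded set the integrand vanishes almost everywhere outside one compact
set of pairs (e,s). The exceptional null set consists of e off the hyperboloid, where no such cutoff
is available. -/
lemma hasFDerivAt_strS {m : Mink → ℝ} (hm : Continuous m) (hmc : HasCompactSupport m) (n : ℕ)
    {h : Mink → ℂ} (hh : IsSpacelikeCompact h) (x₀ : Mink) :
    ∃ D : Mink →L[ℝ] ℂ, HasFDerivAt (strS m n h) D x₀ ∧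
      ∀ v, D v = strS m n (dirD v h) x₀ := by
  obtain ⟨Q, hQ, hcut⟩ := exists_strS_cutoff hmc hh (‖x₀‖ + 1)
  have hk : Continuous (fun p : Mink × ℝ => (m p.1 : ℂ) * (p.2 : ℂ) ^ n) := by fun_prop
  have hcont : Continuous (fderiv ℝ h) := hh.smooth.continuous_fderiv (by simp)
  have hd := hasFDerivAt_setIntegral_of_isCompact (μ := strMeasure) hQ
    (hk.continuousOn.integrableOn_compact hQ)
    (H := fun x (p : Mink × ℝ) => h (x + p.2 • p.1))
    (H' := fun x (p : Mink × ℝ) => fderiv ℝ h (x + p.2 • p.1))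
    (hh.continuous.comp (by fun_prop : Continuous fun q : Mink × (Mink × ℝ) =>
      q.1 + q.2.2 • q.2.1))
    (hcont.comp (by fun_prop : Continuous fun q : Mink × (Mink × ℝ) => q.1 + q.2.2 • q.2.1))
    (fun x p => ((hh.smooth.differentiable (by simp) _).hasFDerivAt.comp x
      ((hasFDerivAt_id x).add_const _))) x₀
  have hball : ∀ᶠ x in 𝓝 x₀, ‖x‖ ≤ ‖x₀‖ + 1 := by
    filter_upwards [Metric.ball_mem_nhds x₀ one_pos] with x hx
    rw [mem_ball_iff_norm] at hx
    have h1 : ‖x‖ ≤ ‖x - x₀‖ + ‖x₀‖ := by simpa using norm_add_le (x - x₀) x₀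
    linarith
  refine ⟨_, hd.congr_of_eventuallyEq ?_, fun v => ?_⟩
  · filter_upwards [hball] with x hx
    refine (setIntegral_eq_integral_of_ae_compl_eq_zero ?_).symm
    filter_upwards [ae_strMeasure] with p hp hpQ
    rcases hcut x hx p hp.1 hp.2 hpQ with h0 | h0 <;> simp [h0]
  · have hint : IntegrableOn (fun p : Mink × ℝ => ((m p.1 : ℂ) * (p.2 : ℂ) ^ n) •
        fderiv ℝ h (x₀ + p.2 • p.1)) Q strMeasure :=
      (hk.smul (hcont.comp (by fun_prop))).continuousOn.integrableOn_compact hQ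
    rw [ContinuousLinearMap.integral_apply hint]
    refine setIntegral_eq_integral_of_ae_compl_eq_zero ?_
    filter_upwards [ae_strMeasure] with p hp hpQ
    by_cases h0 : m p.1 = 0
    · simp [h0]
    -- The cutoff holds for all base points near x₀, so `h` vanishes on a neighbourhood of the
    -- string point and its derivative vanishes there too.
    · have : h =ᶠ[𝓝 (x₀ + p.2 • p.1)] fun _ => 0 := by
        have hb : ∀ᶠ y in 𝓝 (x₀ + p.2 • p.1), ‖y - p.2 • p.1‖ ≤ ‖x₀‖ + 1 := by
          have ht : Tendsto (fun y => y - p.2 • p.1) (𝓝 (x₀ + p.2 • p.1)) (𝓝 x₀) := by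
            have : Continuous fun y : Mink => y - p.2 • p.1 := by fun_prop
            have := this.tendsto (x₀ + p.2 • p.1)
            rwa [add_sub_cancel_right] at this
          exact ht.eventually hball
        filter_upwards [hb] with y hy
        have := (hcut _ hy p hp.1 hp.2 hpQ).resolve_left h0
        rwa [sub_add_cancel] at this
      rw [this.fderiv_eq]
      simp

lemma pd_strS {m : Mink → ℝ} (hm : Continuous m) (hmc : HasCompactSupport m) (n : ℕ)
    {h : Mink → ℂ} (hh : IsSpacelikeCompact h) (μ : Fin 4) :
    pd μ (strS m n h) = strS m n (pd μ h) := by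
  funext x
  obtain ⟨D, hD, hDv⟩ := hasFDerivAt_strS hm hmc n hh x
  rw [pd, hD.fderiv, hDv]
  rfl

lemma contDiff_strS {m : Mink → ℝ} (hm : Continuous m) (hmc : HasCompactSupport m) (n : ℕ)
    {h : Mink → ℂ} (hh : IsSpacelikeCompact h) : ContDiff ℝ ∞ (strS m n h) := by
  refine contDiff_infty.2 fun k => ?_
  induction k generalizing h with
  | zero =>
    exact contDiff_zero.2 (continuous_iff_continuousAt.2 fun x =>
      (hasFDerivAt_strS hm hmc n hh x).choose_spec.1.continuousAt)
  | succ k ih =>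
    push_cast
    refine contDiff_succ_iff_fderiv_apply.2 ⟨fun x =>
      (hasFDerivAt_strS hm hmc n hh x).choose_spec.1.differentiableAt, by simp, fun v => ?_⟩
    have e : (fun x => fderiv ℝ (strS m n h) x v) = strS m n (dirD v h) := by
      funext x
      obtain ⟨D, hD, hDv⟩ := hasFDerivAt_strS hm hmc n hh x
      rw [hD.fderiv, hDv]
    rw [e]
    exact ih (hh.dirD v)

lemma hasDerivAt_along {h : Mink → ℂ} (hh : ContDiff ℝ ∞ h) (x e : Mink) (s : ℝ) :
    HasDerivAt (fun s : ℝ => h (x + s • e)) (∑ ρ, (e ρ : ℂ) * pd ρ h (x + s • e)) s := by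
  rw [← dirD_eq_sum]
  have h1 : HasDerivAt (fun s : ℝ => x + s • e) e s := by
    simpa using ((hasDerivAt_id s).smul_const e).const_add x
  exact (hh.differentiable (by simp) (x + s • e)).hasFDerivAt.comp_hasDerivAt s h1

lemma integrableOn_along {h : Mink → ℂ} (hh : IsSpacelikeCompact h) (n : ℕ) (x : Mink) {e : Mink}
    (he : e ∈ hyperboloid) :
    IntegrableOn (fun s : ℝ => (s : ℂ) ^ n * h (x + s • e)) (Set.Ioi 0) := by
  obtain ⟨S, hS, hcut⟩ := hh.exists_cutoff ‖x‖ ‖e‖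
  have hcont : Continuous (fun s : ℝ => (s : ℂ) ^ n * h (x + s • e)) := by
    have := hh.continuous
    fun_prop
  have h1 : IntegrableOn (fun s : ℝ => (s : ℂ) ^ n * h (x + s • e)) (Set.Icc 0 S) :=
    hcont.continuousOn.integrableOn_compact isCompact_Icc
  refine h1.of_forall_sdiff_eq_zero measurableSet_Ioi fun s hs => ?_
  have : S ≤ s := by
    by_contra hlt
    exact hs.2 ⟨le_of_lt hs.1, (not_le.1 hlt).le⟩
  rw [hcut x le_rfl e he le_rfl s this, mul_zero]

lemma tendsto_along {h : Mink → ℂ} (hh : IsSpacelikeCompact h) (n : ℕ) (x : Mink) {e : Mink}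
    (he : e ∈ hyperboloid) : Tendsto (fun s : ℝ => (s : ℂ) ^ n * h (x + s • e)) atTop (𝓝 0) := by
  obtain ⟨S, hS, hcut⟩ := hh.exists_cutoff ‖x‖ ‖e‖
  refine tendsto_const_nhds.congr' ?_
  filter_upwards [eventually_ge_atTop S] with s hs
  rw [hcut x le_rfl e he le_rfl s hs, mul_zero]

lemma integral_along_zero {h : Mink → ℂ} (hh : IsSpacelikeCompact h) (x : Mink) {e : Mink}
    (he : e ∈ hyperboloid) :
    ∑ ρ, (e ρ : ℂ) * ∫ s in Set.Ioi (0 : ℝ), (s : ℂ) ^ 0 * pd ρ h (x + s • e) = -h x := by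
  simp only [← integral_const_mul]
  rw [← integral_finsetSum _ fun ρ _ => (integrableOn_along (hh.pd ρ) 0 x he).const_mul _]
  have key := integral_Ioi_of_hasDerivAt_of_tendsto' (a := 0)
    (fun s _ => hasDerivAt_along hh.smooth x e s)
    (f' := fun s => ∑ ρ, (e ρ : ℂ) * pd ρ h (x + s • e)) ?_
    (by simpa using tendsto_along hh 0 x he)
  · simpa using key
  · refine integrable_finsetSum _ fun ρ _ => ?_
    simpa using (integrableOn_along (hh.pd ρ) 0 x he).const_mul (e ρ : ℂ)

/-- Integration by parts along the string. The factor s kills the boundary term at the starting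
point and the support kills the one at infinity. -/
lemma integral_along_one {h : Mink → ℂ} (hh : IsSpacelikeCompact h) (x : Mink) {e : Mink}
    (he : e ∈ hyperboloid) :
    ∑ ρ, (e ρ : ℂ) * ∫ s in Set.Ioi (0 : ℝ), (s : ℂ) ^ 1 * pd ρ h (x + s • e) =
      -∫ s in Set.Ioi (0 : ℝ), (s : ℂ) ^ 0 * h (x + s • e) := by
  have hi := fun ρ => (integrableOn_along (hh.pd ρ) 1 x he).const_mul (e ρ : ℂ)
  simp only [← integral_const_mul]
  rw [← integral_finsetSum _ fun ρ _ => hi ρ, eq_neg_iff_add_eq_zero, ← integral_add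
    (integrable_finsetSum _ fun ρ _ => hi ρ) (integrableOn_along hh 0 x he)]
  have hd : ∀ s : ℝ, HasDerivAt (fun s : ℝ => (s : ℂ) ^ 1 * h (x + s • e))
      (∑ ρ, (e ρ : ℂ) * ((s : ℂ) ^ 1 * pd ρ h (x + s • e)) + (s : ℂ) ^ 0 * h (x + s • e)) s := by
    intro s
    have h1 : HasDerivAt (fun s : ℝ => (s : ℂ) ^ 1) 1 s := by
      simpa using (hasDerivAt_id s).ofReal_comp
    refine (h1.mul (hasDerivAt_along hh.smooth x e s)).congr_deriv ?_
    rw [Finset.mul_sum]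
    simp only [pow_one, pow_zero]
    rw [add_comm]
    congr 1
    refine Finset.sum_congr rfl fun ρ _ => ?_
    ring
  have key := integral_Ioi_of_hasDerivAt_of_tendsto' (a := 0) (fun s _ => hd s)
    ((integrable_finsetSum _ fun ρ _ => hi ρ).add (integrableOn_along hh 0 x he))
    (tendsto_along hh 1 x he)
  rw [key]
  simp

lemma integrable_iterated {m : Mink → ℝ} (hm : Continuous m) (hmc : HasCompactSupport m) (n : ℕ)
    {h : Mink → ℂ} (hh : IsSpacelikeCompact h) (x : Mink) :
    Integrable (fun e => (m e : ℂ) * (∫ s in Set.Ioi (0 : ℝ), (s : ℂ) ^ n * h (x + s • e)))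
      sigma := by
  have hi := integrable_strS hm hmc n hh x
  unfold strMeasure at hi
  refine hi.integral_prod_left.congr (.of_forall fun e => ?_)
  simp only [mul_assoc]
  rw [integral_const_mul]

lemma sum_strS_along {m : Mink → ℝ} (hm : Continuous m) (hmc : HasCompactSupport m) (n : ℕ)
    {h : Mink → ℂ} (hh : IsSpacelikeCompact h) (x : Mink) :
    ∑ ρ, strS (fun e => m e * e ρ) n (pd ρ h) x =
      ∫ e, (m e : ℂ) * (∑ ρ, (e ρ : ℂ) * ∫ s in Set.Ioi (0 : ℝ), (s : ℂ) ^ n * pd ρ h (x + s • e))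
        ∂sigma := by
  have hmρ : ∀ ρ : Fin 4, Continuous fun e : Mink => m e * e ρ :=
    fun ρ => hm.mul (continuous_apply ρ)
  have hmcρ : ∀ ρ : Fin 4, HasCompactSupport fun e : Mink => m e * e ρ := fun ρ => hmc.mul_right
  rw [Finset.sum_congr rfl fun ρ _ => strS_eq_iterated (hmρ ρ) (hmcρ ρ) n (hh.pd ρ) x,
    ← integral_finsetSum _ fun ρ _ => integrable_iterated (hmρ ρ) (hmcρ ρ) n (hh.pd ρ) x]
  refine integral_congr_ae (.of_forall fun e => ?_)
  simp only [Finset.mul_sum]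
  refine Finset.sum_congr rfl fun ρ _ => ?_
  push_cast
  ring

lemma sum_strS_along_zero {m : Mink → ℝ} (hm : Continuous m) (hmc : HasCompactSupport m)
    {h : Mink → ℂ} (hh : IsSpacelikeCompact h) (x : Mink) :
    ∑ ρ, strS (fun e => m e * e ρ) 0 (pd ρ h) x = -(((∫ e, m e ∂sigma : ℝ) : ℂ) * h x) := by
  rw [sum_strS_along hm hmc 0 hh x, ← integral_complex_ofReal, ← integral_mul_const, ← integral_neg]
  refine integral_congr_ae ?_
  filter_upwards [ae_mem_hyperboloid] with e he
  rw [integral_along_zero hh x he]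
  ring

lemma sum_strS_along_one {m : Mink → ℝ} (hm : Continuous m) (hmc : HasCompactSupport m)
    {h : Mink → ℂ} (hh : IsSpacelikeCompact h) (x : Mink) :
    ∑ ρ, strS (fun e => m e * e ρ) 1 (pd ρ h) x = -strS m 0 h x := by
  rw [sum_strS_along hm hmc 1 hh x, strS_eq_iterated hm hmc 0 hh, ← integral_neg]
  refine integral_congr_ae ?_
  filter_upwards [ae_mem_hyperboloid] with e he
  rw [integral_along_one hh x he]
  ring

/-! ### Dependence of string integrals on the direction. -/

/-- Smooth dependence on parameters of integrals over compact intervals. -/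
lemma hasFDerivAt_integral_Icc {H : Mink × ℝ → ℂ} (hH : ContDiff ℝ ∞ H) (S : ℝ) (e₀ : Mink) :
    ∃ D : Mink →L[ℝ] ℂ, HasFDerivAt (fun e => ∫ s in Set.Icc 0 S, H (e, s)) D e₀ ∧
      ∀ v, D v = ∫ s in Set.Icc 0 S, fderiv ℝ H (e₀, s) (v, 0) := by
  have hcont : Continuous (fderiv ℝ H) := hH.continuous_fderiv (by simp)
  have hc' : Continuous fun q : Mink × ℝ => (fderiv ℝ H q).comp (ContinuousLinearMap.inl ℝ Mink ℝ) :=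
    by fun_prop
  have hd := hasFDerivAt_setIntegral_of_isCompact (μ := (volume : Measure ℝ))
    (isCompact_Icc (a := (0 : ℝ)) (b := S)) (k := fun _ => 1)
    (continuous_const.continuousOn.integrableOn_compact isCompact_Icc)
    (H := fun e s => H (e, s))
    (H' := fun e s => (fderiv ℝ H (e, s)).comp (ContinuousLinearMap.inl ℝ Mink ℝ))
    hH.continuous hc' (fun e s => (hH.differentiable (by simp) (e, s)).hasFDerivAt.comp e
      (hasFDerivAt_prodMk_left e s)) e₀
  simp only [one_mul, one_smul] at hd
  refine ⟨_, hd, fun v => ?_⟩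
  rw [ContinuousLinearMap.integral_apply]
  · simp
  · exact (hc'.comp (by fun_prop : Continuous fun s : ℝ => (e₀, s))
      ).continuousOn.integrableOn_compact isCompact_Icc

lemma contDiff_integral_Icc {H : Mink × ℝ → ℂ} (hH : ContDiff ℝ ∞ H) (S : ℝ) :
    ContDiff ℝ ∞ (fun e => ∫ s in Set.Icc 0 S, H (e, s)) := by
  refine contDiff_infty.2 fun k => ?_
  induction k generalizing H with
  | zero =>
    exact contDiff_zero.2 (continuous_iff_continuousAt.2 fun x =>
      (hasFDerivAt_integral_Icc hH S x).choose_spec.1.continuousAt)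
  | succ k ih =>
    push_cast
    refine contDiff_succ_iff_fderiv_apply.2 ⟨fun x =>
      (hasFDerivAt_integral_Icc hH S x).choose_spec.1.differentiableAt, by simp, fun v => ?_⟩
    have hH' : ContDiff ℝ ∞ fun q : Mink × ℝ => fderiv ℝ H q (v, 0) :=
      (hH.fderiv_right (m := ∞) (by simp)).clm_apply contDiff_const
    have e : (fun x => fderiv ℝ (fun e => ∫ s in Set.Icc 0 S, H (e, s)) x v) =
        fun x => ∫ s in Set.Icc 0 S, fderiv ℝ H (x, s) (v, 0) := by
      funext x
      obtain ⟨D, hD, hDv⟩ := hasFDerivAt_integral_Icc hH S x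
      rw [hD.fderiv, hDv]
    rw [e]
    exact ih hH'

/-- The real formula is applied after composing with the real and the imaginary part. -/
lemma IsVariation.divergence_complex {b : Mink → Fin 4 → ℝ} {δc : Mink → ℝ}
    (hb : IsVariation b δc) {g : Mink → ℂ} (hg : ContDiff ℝ ∞ g) :
    ∫ e, (δc e : ℂ) * g e ∂sigma = ∫ e, fderiv ℝ g e (b e) ∂sigma := by
  have hd := hg.differentiable (by simp)
  have i1 : Integrable (fun e => (δc e : ℂ) * g e) sigma :=
    ((Complex.continuous_ofReal.comp hb.smooth.continuous).mul
      hg.continuous).integrable_of_hasCompactSupport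
      (hb.compact.comp_left (g := fun r : ℝ => (r : ℂ)) Complex.ofReal_zero).mul_right
  have i2 : Integrable (fun e => fderiv ℝ g e (b e)) sigma := by
    refine ((hg.continuous_fderiv (by simp)).clm_apply
      hb.smooth_b.continuous).integrable_of_hasCompactSupport ?_
    refine hb.compact_b.mono fun e he => ?_
    intro h0
    exact he (by simp [h0])
  have key : ∀ L : ℂ →L[ℝ] ℝ, L (∫ e, (δc e : ℂ) * g e ∂sigma) =
      L (∫ e, fderiv ℝ g e (b e) ∂sigma) := by
    intro L
    rw [← L.integral_comp_comm i1, ← L.integral_comp_comm i2]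
    have := hb.divergence (fun e => L (g e)) (L.contDiff.comp hg)
    have e1 : ∀ e, L ((δc e : ℂ) * g e) = δc e * L (g e) := fun e => by
      rw [← Complex.real_smul, L.map_smul, smul_eq_mul]
    have e2 : ∀ e, fderiv ℝ (fun e => L (g e)) e (b e) = L (fderiv ℝ g e (b e)) := fun e => by
      have : HasFDerivAt (fun e => L (g e)) (L.comp (fderiv ℝ g e)) e :=
        L.hasFDerivAt.comp e (hd e).hasFDerivAt
      rw [this.fderiv]
      rfl
    simp only [e1, ← e2]
    exact this
  exact Complex.ext (key Complex.reCLM) (key Complex.imCLM)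

/-! ### Potential, field w and variation of a classical configuration. -/

section Configurations

variable {N : ℕ}

lemma IsMaxwell.isSpacelikeCompact {F : Fin 4 → Fin 4 → Fin N → Mink → ℂ} (hF : IsMaxwell F)
    (μ ν : Fin 4) (a : Fin N) : IsSpacelikeCompact (F μ ν a) := by
  obtain ⟨r, hr⟩ := hF.support
  exact ⟨hF.smooth μ ν a, r, fun x hx => hr x hx μ ν a⟩

lemma strS_add {m : Mink → ℝ} (hm : Continuous m) (hmc : HasCompactSupport m) (n : ℕ)
    {h k : Mink → ℂ} (hh : IsSpacelikeCompact h) (hk : IsSpacelikeCompact k) (x : Mink) :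
    strS m n (fun y => h y + k y) x = strS m n h x + strS m n k x := by
  unfold strS
  rw [← integral_add (integrable_strS hm hmc n hh x) (integrable_strS hm hmc n hk x)]
  congr 1
  funext p
  ring

lemma strA_eq {m : Mink → ℝ} (hm : Continuous m) (hmc : HasCompactSupport m)
    {F : Fin 4 → Fin 4 → Fin N → Mink → ℂ} (hF : IsMaxwell F) (μ : Fin 4) (a : Fin N) (x : Mink) :
    strA m F μ a x = ∑ ν, strS (fun e => m e * e ν) 0 (F μ ν a) x := by
  have hmν : ∀ ν : Fin 4, Continuous fun e : Mink => m e * e ν :=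
    fun ν => hm.mul (continuous_apply ν)
  have hmcν : ∀ ν : Fin 4, HasCompactSupport fun e : Mink => m e * e ν := fun ν => hmc.mul_right
  have hs := fun ν => hF.isSpacelikeCompact μ ν a
  rw [Finset.sum_congr rfl fun ν _ => strS_eq_iterated (hmν ν) (hmcν ν) 0 (hs ν) x,
    ← integral_finsetSum _ fun ν _ => integrable_iterated (hmν ν) (hmcν ν) 0 (hs ν) x]
  unfold strA
  refine integral_congr_ae ?_
  filter_upwards [ae_mem_hyperboloid] with e he
  rw [integral_finsetSum]
  · rw [Finset.mul_sum]
    refine Finset.sum_congr rfl fun ν _ => ?_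
    rw [integral_mul_const]
    simp only [pow_zero, one_mul]
    push_cast
    ring
  · intro ν _
    simpa using (integrableOn_along (hs ν) 0 x he).mul_const (e ν : ℂ)

lemma strW_eq {b : Mink → Fin 4 → ℝ} (hb : Continuous b) (hbc : HasCompactSupport b)
    {F : Fin 4 → Fin 4 → Fin N → Mink → ℂ} (hF : IsMaxwell F) (a : Fin N) (x : Mink) :
    strW b F a x = ∑ κ, ∑ ν, strS (fun e => b e κ * e ν) 1 (F κ ν a) x := by
  have hbκ : ∀ κ, HasCompactSupport fun e => b e κ := fun κ =>
    hbc.comp_left (g := fun v : Fin 4 → ℝ => v κ) rfl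
  have hm : ∀ κ ν : Fin 4, Continuous fun e : Mink => b e κ * e ν := by
    intro κ ν; fun_prop
  have hmc : ∀ κ ν : Fin 4, HasCompactSupport fun e : Mink => b e κ * e ν :=
    fun κ ν => (hbκ κ).mul_right
  have hs := fun κ ν => hF.isSpacelikeCompact κ ν a
  rw [Finset.sum_congr rfl fun κ _ => Finset.sum_congr rfl fun ν _ =>
    strS_eq_iterated (hm κ ν) (hmc κ ν) 1 (hs κ ν) x]
  rw [Finset.sum_congr rfl fun κ _ => (integral_finsetSum _ fun ν _ =>
    integrable_iterated (hm κ ν) (hmc κ ν) 1 (hs κ ν) x).symm,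
    ← integral_finsetSum _ fun κ _ => integrable_finsetSum _ fun ν _ =>
      integrable_iterated (hm κ ν) (hmc κ ν) 1 (hs κ ν) x]
  unfold strW
  refine integral_congr_ae ?_
  filter_upwards [ae_mem_hyperboloid] with e he
  refine Finset.sum_congr rfl fun κ _ => ?_
  simp only [Finset.mul_sum]
  rw [integral_finsetSum]
  · rw [Finset.mul_sum]
    refine Finset.sum_congr rfl fun ν _ => ?_
    simp only [← mul_assoc]
    rw [integral_mul_const]
    simp only [pow_one]
    push_cast
    ring
  · intro ν _
    simpa [mul_assoc] using (integrableOn_along (hs κ ν) 1 x he).mul_const (e ν : ℂ)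

lemma contDiff_strA {m : Mink → ℝ} (hm : Continuous m) (hmc : HasCompactSupport m)
    {F : Fin 4 → Fin 4 → Fin N → Mink → ℂ} (hF : IsMaxwell F) (μ : Fin 4) (a : Fin N) :
    ContDiff ℝ ∞ (strA m F μ a) := by
  have : strA m F μ a = fun x => ∑ ν, strS (fun e => m e * e ν) 0 (F μ ν a) x := by
    funext x
    exact strA_eq hm hmc hF μ a x
  rw [this]
  exact ContDiff.sum fun ν _ => contDiff_strS (hm.mul (continuous_apply ν)) hmc.mul_right 0
    (hF.isSpacelikeCompact μ ν a)

lemma pd_sum {ι : Type*} (s : Finset ι) {h : ι → Mink → ℂ} (hh : ∀ i, ContDiff ℝ ∞ (h i))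
    (μ : Fin 4) (x : Mink) : pd μ (fun y => ∑ i ∈ s, h i y) x = ∑ i ∈ s, pd μ (h i) x := by
  unfold pd
  rw [fderiv_fun_sum fun i _ => (hh i).differentiable (by simp) x]
  simp

lemma pd_strA {m : Mink → ℝ} (hm : Continuous m) (hmc : HasCompactSupport m)
    {F : Fin 4 → Fin 4 → Fin N → Mink → ℂ} (hF : IsMaxwell F) (κ μ : Fin 4) (a : Fin N)
    (x : Mink) :
    pd κ (strA m F μ a) x = ∑ ν, strS (fun e => m e * e ν) 0 (pd κ (F μ ν a)) x := by
  have h : strA m F μ a = fun x => ∑ ν, strS (fun e => m e * e ν) 0 (F μ ν a) x := by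
    funext x
    exact strA_eq hm hmc hF μ a x
  have hmν : ∀ ν : Fin 4, Continuous fun e : Mink => m e * e ν :=
    fun ν => hm.mul (continuous_apply ν)
  have hmcν : ∀ ν : Fin 4, HasCompactSupport fun e : Mink => m e * e ν := fun ν => hmc.mul_right
  rw [h, pd_sum _ fun ν => contDiff_strS (hmν ν) (hmcν ν) 0 (hF.isSpacelikeCompact μ ν a)]
  refine Finset.sum_congr rfl fun ν _ => ?_
  rw [pd_strS (hmν ν) (hmcν ν) 0 (hF.isSpacelikeCompact μ ν a)]

lemma contDiff_strW {b : Mink → Fin 4 → ℝ} (hb : Continuous b) (hbc : HasCompactSupport b)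
    {F : Fin 4 → Fin 4 → Fin N → Mink → ℂ} (hF : IsMaxwell F) (a : Fin N) :
    ContDiff ℝ ∞ (strW b F a) := by
  have : strW b F a = fun x => ∑ κ, ∑ ν, strS (fun e => b e κ * e ν) 1 (F κ ν a) x := by
    funext x
    exact strW_eq hb hbc hF a x
  rw [this]
  refine ContDiff.sum fun κ _ => ContDiff.sum fun ν _ => contDiff_strS (by fun_prop)
    (hbc.comp_left (g := fun v : Fin 4 → ℝ => v κ) rfl).mul_right 1
    (hF.isSpacelikeCompact κ ν a)

lemma pd_strW {b : Mink → Fin 4 → ℝ} (hb : Continuous b) (hbc : HasCompactSupport b)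
    {F : Fin 4 → Fin 4 → Fin N → Mink → ℂ} (hF : IsMaxwell F) (μ : Fin 4) (a : Fin N)
    (x : Mink) :
    pd μ (strW b F a) x = ∑ κ, ∑ ν, strS (fun e => b e κ * e ν) 1 (pd μ (F κ ν a)) x := by
  have h : strW b F a = fun x => ∑ κ, ∑ ν, strS (fun e => b e κ * e ν) 1 (F κ ν a) x := by
    funext x
    exact strW_eq hb hbc hF a x
  have hm : ∀ κ ν : Fin 4, Continuous fun e : Mink => b e κ * e ν := by
    intro κ ν; fun_prop
  have hmc : ∀ κ ν : Fin 4, HasCompactSupport fun e : Mink => b e κ * e ν :=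
    fun κ ν => (hbc.comp_left (g := fun v : Fin 4 → ℝ => v κ) rfl).mul_right
  have hsm : ∀ κ ν : Fin 4, ContDiff ℝ ∞ (strS (fun e => b e κ * e ν) 1 (F κ ν a)) :=
    fun κ ν => contDiff_strS (hm κ ν) (hmc κ ν) 1 (hF.isSpacelikeCompact κ ν a)
  rw [h, pd_sum _ fun κ => ContDiff.sum fun ν _ => hsm κ ν]
  refine Finset.sum_congr rfl fun κ _ => ?_
  rw [pd_sum _ (hsm κ)]
  refine Finset.sum_congr rfl fun ν _ => ?_
  rw [pd_strS (hm κ ν) (hmc κ ν) 1 (hF.isSpacelikeCompact κ ν a)]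

/-- The string-localized potential is a potential for the field strength. -/
lemma curl_strA {c : Mink → ℝ} (hc : IsSmearing c)
    {F : Fin 4 → Fin 4 → Fin N → Mink → ℂ} (hF : IsMaxwell F) (μ ν : Fin 4) (a : Fin N) (x : Mink) :
    pd μ (strA c F ν a) x - pd ν (strA c F μ a) x = F μ ν a x := by
  have hm := hc.smooth.continuous
  rw [pd_strA hm hc.compact hF, pd_strA hm hc.compact hF, ← Finset.sum_sub_distrib]
  -- The Bianchi identity turns the curl under the string integral into a derivative along the
  -- string. This integrates to the value at the starting point, with total weight one.
  have h1 : ∀ ρ : Fin 4, strS (fun e => c e * e ρ) 0 (pd μ (F ν ρ a)) x -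
      strS (fun e => c e * e ρ) 0 (pd ν (F μ ρ a)) x =
      -strS (fun e => c e * e ρ) 0 (pd ρ (F μ ν a)) x := by
    intro ρ
    have hmρ : Continuous fun e : Mink => c e * e ρ := hm.mul (continuous_apply ρ)
    have hmcρ : HasCompactSupport fun e : Mink => c e * e ρ := hc.compact.mul_right
    rw [sub_eq_iff_eq_add, neg_add_eq_sub, eq_sub_iff_add_eq,
      ← strS_add hmρ hmcρ 0 ((hF.isSpacelikeCompact ν ρ a).pd μ)
        ((hF.isSpacelikeCompact μ ν a).pd ρ)]
    congr 1
    funext y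
    have hb := hF.bianchi μ ν ρ a y
    have ha : pd ν (F ρ μ a) y = -pd ν (F μ ρ a) y := by
      have : F ρ μ a = fun z => -F μ ρ a z := funext fun z => hF.antisymm ρ μ a z
      rw [this]
      simp [pd]
    linear_combination hb - ha
  rw [Finset.sum_congr rfl fun ρ _ => h1 ρ, Finset.sum_neg_distrib,
    sum_strS_along_zero hm hc.compact (hF.isSpacelikeCompact μ ν a), hc.weight]
  simp

lemma setIntegral_Icc_eq_Ioi {f : ℝ → ℂ} {S : ℝ} (h : ∀ s, S ≤ s → f s = 0) :
    ∫ s in Set.Icc 0 S, f s = ∫ s in Set.Ioi 0, f s := by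
  rw [integral_Icc_eq_integral_Ioc]
  refine (setIntegral_eq_of_subset_of_forall_sdiff_eq_zero measurableSet_Ioi
    (fun s hs => hs.1) fun s hs => h s ?_).symm
  by_contra hlt
  exact hs.2 ⟨hs.1, (not_le.1 hlt).le⟩

lemma integral_sum_sum_add {α : Type*} [MeasurableSpace α] {τ : Measure α}
    {f : Fin 4 → Fin 4 → α → ℂ} {g : Fin 4 → α → ℂ} (hf : ∀ κ ν, Integrable (f κ ν) τ)
    (hg : ∀ κ, Integrable (g κ) τ) :
    ∫ e, ∑ κ, (∑ ν, f κ ν e + g κ e) ∂τ = ∑ κ, (∑ ν, ∫ e, f κ ν e ∂τ + ∫ e, g κ e ∂τ) := by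
  have h1 : ∀ κ, Integrable (fun e => ∑ ν, f κ ν e) τ :=
    fun κ => integrable_finsetSum _ fun ν _ => hf κ ν
  rw [integral_finsetSum _ fun κ _ => show Integrable (fun e => ∑ ν, f κ ν e + g κ e) τ from
    (h1 κ).add (hg κ)]
  refine Finset.sum_congr rfl fun κ _ => ?_
  rw [integral_add (h1 κ) (hg κ), integral_finsetSum _ fun ν _ => hf κ ν]

/-- The weak divergence formula is applied to the string integral as a function of e;
differentiation in e hits either the argument x+se, with a factor s, or the explicit e^ν. The
formula asks for a function smooth on all of Minkowski space, whereas the infinite string integral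
is controlled only on the hyperboloid. It is therefore truncated at a parameter S beyond which
nothing contributes for relevant e on the hyperboloid. -/
lemma strA_variation_eq {b : Mink → Fin 4 → ℝ} {δc : Mink → ℝ} (hb : IsVariation b δc)
    {F : Fin 4 → Fin 4 → Fin N → Mink → ℂ} (hF : IsMaxwell F) (μ : Fin 4) (a : Fin N) (x : Mink) :
    strA δc F μ a x = ∑ κ, (∑ ν, strS (fun e => b e κ * e ν) 1 (pd κ (F μ ν a)) x +
      strS (fun e => b e κ) 0 (F μ κ a) x) := by
  have hbc := hb.smooth_b.continuous
  have hbκ : ∀ κ, HasCompactSupport fun e => b e κ := fun κ =>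
    hb.compact_b.comp_left (g := fun v : Fin 4 → ℝ => v κ) rfl
  have hbκc : ∀ κ, Continuous fun e => b e κ := fun κ => by fun_prop
  have hm : ∀ κ ν : Fin 4, Continuous fun e : Mink => b e κ * e ν := by
    intro κ ν; fun_prop
  have hmc : ∀ κ ν : Fin 4, HasCompactSupport fun e : Mink => b e κ * e ν :=
    fun κ ν => (hbκ κ).mul_right
  have hs := fun ν => hF.isSpacelikeCompact μ ν a
  obtain ⟨M1, hM1⟩ := hb.compact.isCompact.isBounded.subset_closedBall (0 : Mink)
  obtain ⟨M2, hM2⟩ := hb.compact_b.isCompact.isBounded.subset_closedBall (0 : Mink)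
  have hM1' : ∀ e, δc e ≠ 0 → ‖e‖ ≤ max M1 M2 := fun e he => by
    have := hM1 (subset_tsupport _ he)
    rw [mem_closedBall_zero_iff] at this
    exact this.trans (le_max_left _ _)
  have hM2' : ∀ e, b e ≠ 0 → ‖e‖ ≤ max M1 M2 := fun e he => by
    have := hM2 (subset_tsupport _ he)
    rw [mem_closedBall_zero_iff] at this
    exact this.trans (le_max_right _ _)
  choose S1 hS1 hcut1 using fun ν => (hs ν).exists_cutoff ‖x‖ (max M1 M2)
  choose S2 hS2 hcut2 using fun κ ν => ((hs ν).pd κ).exists_cutoff ‖x‖ (max M1 M2)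
  set S : ℝ := ∑ ν, S1 ν + ∑ κ, ∑ ν, S2 κ ν with hS
  have hSn : ∀ ν, S1 ν ≤ S := fun ν => by
    have h1 := Finset.single_le_sum (f := S1) (fun i _ => (hS1 i).le) (Finset.mem_univ ν)
    have h2 : 0 ≤ ∑ κ, ∑ ν, S2 κ ν :=
      Finset.sum_nonneg fun κ _ => Finset.sum_nonneg fun ν _ => (hS2 κ ν).le
    linarith
  have hSkn : ∀ κ ν, S2 κ ν ≤ S := fun κ ν => by
    have h1 := Finset.single_le_sum (f := fun κ => ∑ ν, S2 κ ν)
      (fun i _ => Finset.sum_nonneg fun ν _ => (hS2 i ν).le) (Finset.mem_univ κ)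
    have h2 := Finset.single_le_sum (f := S2 κ) (fun i _ => (hS2 κ i).le) (Finset.mem_univ ν)
    have h3 : 0 ≤ ∑ ν, S1 ν := Finset.sum_nonneg fun ν _ => (hS1 ν).le
    linarith
  set H : Mink × ℝ → ℂ := fun q => ∑ ν, F μ ν a (x + q.2 • q.1) * (q.1 ν : ℂ) with hH
  have hFd : ∀ ν, Differentiable ℝ (F μ ν a) := fun ν => (hF.smooth μ ν a).differentiable (by simp)
  have hHs : ContDiff ℝ ∞ H := by
    refine ContDiff.sum fun ν _ => ((hF.smooth μ ν a).comp (by fun_prop)).mul ?_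
    exact Complex.ofRealCLM.contDiff.comp (by fun_prop)
  have hHd : ∀ e s v, fderiv ℝ H (e, s) (v, 0) = ∑ ν, ((s : ℂ) * (∑ κ, (v κ : ℂ) *
      pd κ (F μ ν a) (x + s • e)) * (e ν : ℂ) + F μ ν a (x + s • e) * (v ν : ℂ)) := by
    intro e s v
    have hline : HasDerivAt (fun r : ℝ => H ((e, s) + r • (v, 0))) (∑ ν, ((s : ℂ) * (∑ κ, (v κ : ℂ) *
      pd κ (F μ ν a) (x + s • e)) * (e ν : ℂ) + F μ ν a (x + s • e) * (v ν : ℂ))) 0 := by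
      have e1 : (fun r : ℝ => H ((e, s) + r • (v, 0))) = fun r : ℝ => ∑ ν,
          F μ ν a ((x + s • e) + r • (s • v)) * ((e ν + r * v ν : ℝ) : ℂ) := by
        funext r
        simp only [hH, Prod.smul_mk, smul_zero, Prod.mk_add_mk, add_zero]
        refine Finset.sum_congr rfl fun ν _ => ?_
        congr 2
        rw [smul_add, smul_comm s r v, add_assoc]
      rw [e1]
      refine HasDerivAt.fun_sum fun ν _ => ?_
      have d1 := hasDerivAt_along (hF.smooth μ ν a) (x + s • e) (s • v) 0
      have d2 : HasDerivAt (fun r : ℝ => ((e ν + r * v ν : ℝ) : ℂ)) (v ν : ℂ) 0 := by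
        have : HasDerivAt (fun r : ℝ => (e ν + r * v ν : ℝ)) (v ν) 0 := by
          simpa using ((hasDerivAt_id (0 : ℝ)).mul_const (v ν)).const_add (e ν)
        exact this.ofReal_comp
      refine (d1.mul d2).congr_deriv ?_
      simp only [zero_smul, add_zero, zero_mul, Pi.smul_apply, smul_eq_mul]
      push_cast
      simp only [Finset.mul_sum, mul_assoc]
    have := (hHs.differentiable (by simp) (e, s)).hasFDerivAt.hasLineDerivAt (v, 0)
    exact HasDerivAt.unique this hline
  have hdiv := hb.divergence_complex (contDiff_integral_Icc hHs S)
  have hL : strA δc F μ a x = ∫ e, (δc e : ℂ) * (∫ s in Set.Icc 0 S, H (e, s)) ∂sigma := by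
    unfold strA
    refine integral_congr_ae ?_
    filter_upwards [ae_mem_hyperboloid] with e he
    by_cases h0 : δc e = 0
    · simp [h0]
    · congr 1
      refine (setIntegral_Icc_eq_Ioi fun s hs' => ?_).symm
      refine Finset.sum_eq_zero fun ν _ => ?_
      rw [hcut1 ν x le_rfl e he (hM1' e h0) s ((hSn ν).trans hs'), zero_mul]
  have i1 := fun κ ν => integrable_iterated (hm κ ν) (hmc κ ν) 1 ((hs ν).pd κ) x
  have i2 := fun κ => integrable_iterated (hbκc κ) (hbκ κ) 0 (hs κ) x
  rw [hL, hdiv]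
  simp only [strS_eq_iterated (hm _ _) (hmc _ _) 1 ((hs _).pd _),
    strS_eq_iterated (hbκc _) (hbκ _) 0 (hs _)]
  rw [← integral_sum_sum_add i1 i2]
  refine integral_congr_ae ?_
  filter_upwards [ae_mem_hyperboloid] with e he
  by_cases h0 : b e = 0
  · simp [h0]
  obtain ⟨D, hD, hDv⟩ := hasFDerivAt_integral_Icc hHs S e
  rw [hD.fderiv, hDv]
  simp only [hHd]
  rw [setIntegral_Icc_eq_Ioi fun s hs' => Finset.sum_eq_zero fun ν _ => by
    rw [hcut1 ν x le_rfl e he (hM2' e h0) s ((hSn ν).trans hs'),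
      Finset.sum_eq_zero fun κ _ => by
        rw [hcut2 κ ν x le_rfl e he (hM2' e h0) s ((hSkn κ ν).trans hs'), mul_zero]]
    simp]
  have j1 := fun κ ν => (integrableOn_along ((hs ν).pd κ) 1 x he).const_mul ((b e κ : ℂ) * e ν)
  have j2 := fun ν => (integrableOn_along (hs ν) 0 x he).const_mul (b e ν : ℂ)
  have hre : ∀ s : ℝ, ∑ ν, ((s : ℂ) * (∑ κ, (b e κ : ℂ) * pd κ (F μ ν a) (x + s • e)) * (e ν : ℂ) +
      F μ ν a (x + s • e) * (b e ν : ℂ)) =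
      ∑ κ, (∑ ν, ((b e κ : ℂ) * e ν) * ((s : ℂ) ^ 1 * pd κ (F μ ν a) (x + s • e)) +
        (b e κ : ℂ) * ((s : ℂ) ^ 0 * F μ κ a (x + s • e))) := by
    intro s
    rw [Finset.sum_add_distrib, Finset.sum_add_distrib, Finset.sum_comm (s := Finset.univ (α := Fin 4))
      (f := fun κ ν => ((b e κ : ℂ) * e ν) * ((s : ℂ) ^ 1 * pd κ (F μ ν a) (x + s • e)))]
    congr 1
    · refine Finset.sum_congr rfl fun ν _ => ?_
      rw [Finset.mul_sum, Finset.sum_mul]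
      refine Finset.sum_congr rfl fun κ _ => ?_
      ring
    · refine Finset.sum_congr rfl fun ν _ => ?_
      ring
  simp only [hre]
  rw [integral_sum_sum_add j1 j2]
  simp only [integral_const_mul]
  push_cast
  rfl

/-- The variation of the string-localized potential is the gradient of `w`. -/
lemma strA_variation {b : Mink → Fin 4 → ℝ} {δc : Mink → ℝ} (hb : IsVariation b δc)
    {F : Fin 4 → Fin 4 → Fin N → Mink → ℂ} (hF : IsMaxwell F) (μ : Fin 4) (a : Fin N) (x : Mink) :
    strA δc F μ a x = pd μ (strW b F a) x := by
  have hbc := hb.smooth_b.continuous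
  have hbκ : ∀ κ, HasCompactSupport fun e => b e κ := fun κ =>
    hb.compact_b.comp_left (g := fun v : Fin 4 → ℝ => v κ) rfl
  rw [strA_variation_eq hb hF, pd_strW hbc hb.compact_b hF]
  refine Finset.sum_congr rfl fun κ _ => ?_
  have h1 := sum_strS_along_one (m := fun e => b e κ) (by fun_prop) (hbκ κ)
    (hF.isSpacelikeCompact μ κ a) x
  rw [eq_neg_iff_add_eq_zero] at h1
  -- The term without the factor s is the boundary contribution of an integration by parts along the
  -- string. Once it is rewritten, the Bianchi identity in κ, μ, ν matches the integrands.
  rw [← add_zero (∑ ν, strS (fun e => b e κ * e ν) 1 (pd μ (F κ ν a)) x), ← h1, ← add_assoc,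
    ← Finset.sum_add_distrib]
  congr 1
  refine Finset.sum_congr rfl fun ν _ => ?_
  rw [← strS_add (m := fun e => b e κ * e ν) (by fun_prop) (hbκ κ).mul_right 1 ((hF.isSpacelikeCompact κ ν a).pd μ)
    ((hF.isSpacelikeCompact μ κ a).pd ν)]
  congr 1
  funext y
  have hbi := hF.bianchi κ μ ν a y
  have ha : pd μ (F ν κ a) y = -pd μ (F κ ν a) y := by
    have : F ν κ a = fun z => -F κ ν a z := funext fun z => hF.antisymm ν κ a z
    rw [this]
    simp [pd]
  have ha' : pd ν (F κ μ a) y = -pd ν (F μ κ a) y := by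
    have : F κ μ a = fun z => -F μ κ a z := funext fun z => hF.antisymm κ μ a z
    rw [this]
    simp [pd]
  linear_combination hbi - ha - ha'

end Configurations

/-! ### Structure constants, and derivatives of the vertices. -/

section WickPolynomials

variable {N : ℕ}

/-- The properties of the structure constants of a Lie algebra with an invariant inner product. -/
structure IsStructureConstants (f : Fin N → Fin N → Fin N → ℝ) : Prop where
  antisymm_left : ∀ a b d, f a b d = -f b a d
  antisymm_right : ∀ a b d, f a b d = -f a d b
  jacobi : ∀ a b d k, ∑ e, (f a b e * f d k e + f b d e * f a k e + f d a e * f b k e) = 0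

/-- Coefficients of nested brackets in the basis give the Jacobi identity for f; the sign from i² is
absorbed by the antisymmetry in the last two indices. -/
lemma isStructureConstants {𝔤 : Type*} [LieRing 𝔤] [LieAlgebra ℂ 𝔤]
    (ξ : Module.Basis (Fin N) ℂ 𝔤) (f : Fin N → Fin N → Fin N → ℝ)
    (hξ : ∀ a b, ⁅ξ a, ξ b⁆ = ∑ d, (Complex.I * (f a b d : ℂ)) • ξ d)
    (hf : ∀ a b d, f a b d = -f a d b) : IsStructureConstants f := by
  have hr : ∀ a b d, ξ.repr ⁅ξ a, ξ b⁆ d = Complex.I * (f a b d : ℂ) := by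
    intro a b d
    rw [hξ, ← Module.Basis.equivFun_apply, map_sum]
    simp [Finsupp.single_apply]
  refine ⟨fun a b d => ?_, hf, fun a b d k => ?_⟩
  · have h := hr a b d
    rw [← lie_skew, map_neg, Finsupp.neg_apply, hr b a d, ← mul_neg] at h
    have := mul_left_cancel₀ Complex.I_ne_zero h
    exact_mod_cast this.symm
  · have h3 : ∀ a b d, ξ.repr ⁅ξ a, ⁅ξ b, ξ d⁆⁆ k = ∑ e, (f b d e * f a k e : ℂ) := by
      intro a b d
      rw [hξ b d, lie_sum, map_sum, Finsupp.finsetSum_apply]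
      refine Finset.sum_congr rfl fun e _ => ?_
      rw [lie_smul, map_smul, Finsupp.smul_apply, hr, hf a e k, smul_eq_mul]
      push_cast
      linear_combination (-(f b d e * f a k e : ℂ)) * Complex.I_sq
    have h := congrArg (fun v => ξ.repr v k) (lie_jacobi (ξ a) (ξ b) (ξ d))
    simp only [map_add, Finsupp.add_apply, h3, map_zero, Finsupp.zero_apply,
      ← Finset.sum_add_distrib] at h
    have h' : (∑ e, (f a b e * f d k e + f b d e * f a k e + f d a e * f b k e) : ℝ) = (0 : ℂ) := by
      rw [← h]
      push_cast
      exact Finset.sum_congr rfl fun e _ => by ring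
    exact_mod_cast h'

section Bilinear

variable {f : Fin N → Fin N → Fin N → ℝ}

/-- The bracket as a bilinear map. -/
def ibrL (f : Fin N → Fin N → Fin N → ℝ) :
    (Fin N → ℂ) →ₗ[ℂ] (Fin N → ℂ) →ₗ[ℂ] (Fin N → ℂ) :=
  LinearMap.mk₂ ℂ (ibr f)
    (fun X X' Y => by
      funext d
      simp only [ibr, Pi.add_apply, ← neg_add, ← Finset.sum_add_distrib, add_mul, smul_add])
    (fun r X Y => by
      funext d
      simp only [ibr, Pi.smul_apply, smul_eq_mul, mul_neg, Finset.mul_sum]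
      simp only [mul_assoc, mul_left_comm])
    (fun X Y Y' => by
      funext d
      simp only [ibr, Pi.add_apply, ← neg_add, ← Finset.sum_add_distrib, mul_add, smul_add])
    (fun r X Y => by
      funext d
      simp only [ibr, Pi.smul_apply, smul_eq_mul, mul_neg, Finset.mul_sum]
      simp only [mul_left_comm])

/-- The inner product as a bilinear map. -/
def ipL (N : ℕ) : (Fin N → ℂ) →ₗ[ℂ] (Fin N → ℂ) →ₗ[ℂ] ℂ :=
  LinearMap.mk₂ ℂ ip
    (fun X X' Y => by simp only [ip, Pi.add_apply, ← Finset.sum_add_distrib, add_mul])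
    (fun r X Y => by simp only [ip, Pi.smul_apply, smul_eq_mul, Finset.mul_sum, mul_assoc])
    (fun X Y Y' => by simp only [ip, Pi.add_apply, ← Finset.sum_add_distrib, mul_add])
    (fun r X Y => by simp only [ip, Pi.smul_apply, smul_eq_mul, Finset.mul_sum, mul_left_comm])

lemma ibr_eq (X Y : Fin N → ℂ) : ibr f X Y = ibrL f X Y := rfl

lemma ip_eq (X Y : Fin N → ℂ) : ip X Y = ipL N X Y := rfl

lemma ipL_comm (X Y : Fin N → ℂ) : ipL N X Y = ipL N Y X :=
  show ip X Y = ip Y X from Finset.sum_congr rfl fun _ _ => mul_comm _ _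

lemma ibrL_antisymm (hf : IsStructureConstants f) (X Y : Fin N → ℂ) :
    ibrL f X Y = -ibrL f Y X := by
  funext d
  change -∑ a, ∑ b, (f a b d : ℂ) • (X a * Y b) = - -∑ a, ∑ b, (f a b d : ℂ) • (Y a * X b)
  rw [neg_neg, Finset.sum_comm, ← Finset.sum_neg_distrib]
  refine Finset.sum_congr rfl fun a _ => ?_
  rw [← Finset.sum_neg_distrib]
  refine Finset.sum_congr rfl fun b _ => ?_
  rw [hf.antisymm_left b a d]
  simp only [smul_eq_mul]
  push_cast
  ring

lemma ibrL_self (hf : IsStructureConstants f) (X : Fin N → ℂ) : ibrL f X X = 0 := by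
  have := ibrL_antisymm hf X X
  exact self_eq_neg.1 this

lemma ipL_ibrL_ibrL (X Y Z W : Fin N → ℂ) : ipL N (ibrL f X Y) (ibrL f Z W) =
    ∑ a, ∑ b, ∑ d, ∑ k, (∑ e, f a b e * f d k e : ℝ) * (X a * Y b * Z d * W k) := by
  change ∑ e, (-∑ a, ∑ b, (f a b e : ℂ) • (X a * Y b)) * (-∑ d, ∑ k, (f d k e : ℂ) • (Z d * W k)) = _
  push_cast
  simp only [neg_mul_neg, smul_eq_mul, Finset.sum_mul]
  simp only [Finset.mul_sum]
  rw [Finset.sum_comm]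
  refine Finset.sum_congr rfl fun a _ => ?_
  rw [Finset.sum_comm]
  refine Finset.sum_congr rfl fun b _ => ?_
  rw [Finset.sum_comm]
  refine Finset.sum_congr rfl fun d _ => ?_
  rw [Finset.sum_comm]
  refine Finset.sum_congr rfl fun k _ => ?_
  refine Finset.sum_congr rfl fun e _ => ?_
  ring

/-- The Jacobi identity, combined with the invariance of the inner product. -/
lemma ipL_jacobi (hf : IsStructureConstants f) (X Y Z W : Fin N → ℂ) :
    ipL N (ibrL f X Y) (ibrL f Z W) + ipL N (ibrL f Y Z) (ibrL f X W) +
      ipL N (ibrL f Z X) (ibrL f Y W) = 0 := by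
  have h2 : ipL N (ibrL f Y Z) (ibrL f X W) =
      ∑ a, ∑ b, ∑ d, ∑ k, (∑ e, f b d e * f a k e : ℝ) * (X a * Y b * Z d * W k : ℂ) := by
    rw [ipL_ibrL_ibrL]
    have : ∀ b d a : Fin N, ∑ k, ((∑ e, f b d e * f a k e : ℝ) : ℂ) * (Y b * Z d * X a * W k) =
        ∑ k, ((∑ e, f b d e * f a k e : ℝ) : ℂ) * (X a * Y b * Z d * W k) :=
      fun b d a => Finset.sum_congr rfl fun k _ => by ring
    simp only [this]
    rw [Finset.sum_congr rfl fun b _ => Finset.sum_comm, Finset.sum_comm]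
  have h3 : ipL N (ibrL f Z X) (ibrL f Y W) =
      ∑ a, ∑ b, ∑ d, ∑ k, (∑ e, f d a e * f b k e : ℝ) * (X a * Y b * Z d * W k : ℂ) := by
    rw [ipL_ibrL_ibrL]
    have : ∀ d a b : Fin N, ∑ k, ((∑ e, f d a e * f b k e : ℝ) : ℂ) * (Z d * X a * Y b * W k) =
        ∑ k, ((∑ e, f d a e * f b k e : ℝ) : ℂ) * (X a * Y b * Z d * W k) :=
      fun d a b => Finset.sum_congr rfl fun k _ => by ring
    simp only [this]
    rw [Finset.sum_comm]
    exact Finset.sum_congr rfl fun a _ => Finset.sum_comm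
  rw [ipL_ibrL_ibrL, h2, h3]
  simp only [← Finset.sum_add_distrib, ← add_mul]
  refine Finset.sum_eq_zero fun a _ => Finset.sum_eq_zero fun b _ =>
    Finset.sum_eq_zero fun d _ => Finset.sum_eq_zero fun k _ => ?_
  have h := hf.jacobi a b d k
  rw [Finset.sum_add_distrib, Finset.sum_add_distrib] at h
  rw [← Complex.ofReal_add, ← Complex.ofReal_add, h, Complex.ofReal_zero, zero_mul]

end Bilinear

section Derivations

variable {f : Fin N → Fin N → Fin N → ℝ} {R S : Type*} [CommRing R] [Algebra ℂ R] [CommRing S]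
  [Algebra ℂ S]

lemma map_ip (φ : R →ₐ[ℂ] S) (X Y : Fin N → R) :
    φ (ip X Y) = ip (fun a => φ (X a)) (fun a => φ (Y a)) := by
  simp [ip]

lemma map_ibr (φ : R →ₐ[ℂ] S) (X Y : Fin N → R) (d : Fin N) :
    φ (ibr f X Y d) = ibr f (fun a => φ (X a)) (fun a => φ (Y a)) d := by
  simp only [ibr, map_neg, map_sum, map_smul, map_mul]

lemma derivation_ip (D : Derivation ℂ R R) (X Y : Fin N → R) :
    D (ip X Y) = ip (fun a => D (X a)) Y + ip X (fun a => D (Y a)) := by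
  simp only [ip, map_sum, Derivation.leibniz, smul_eq_mul, ← Finset.sum_add_distrib]
  exact Finset.sum_congr rfl fun a _ => by ring

lemma derivation_ibr (D : Derivation ℂ R R) (X Y : Fin N → R) (d : Fin N) :
    D (ibr f X Y d) = ibr f (fun a => D (X a)) Y d + ibr f X (fun a => D (Y a)) d := by
  simp only [ibr, map_neg, map_sum, Derivation.map_smul, Derivation.leibniz, smul_eq_mul,
    ← neg_add, ← Finset.sum_add_distrib, ← smul_add]
  refine congrArg _ (Finset.sum_congr rfl fun a _ => Finset.sum_congr rfl fun b _ => ?_)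
  congr 1
  ring

lemma up1_eq {V : Type*} [AddCommGroup V] [Module ℝ V] (T : Fin 4 → V) (μ : Fin 4) :
    up1 T μ = eta μ μ • T μ := sum_eta_smul μ T

lemma up2_eq {V : Type*} [AddCommGroup V] [Module ℝ V] (T : Fin 4 → Fin 4 → V) (μ ν : Fin 4) :
    up2 T μ ν = (eta μ μ * eta ν ν) • T μ ν := by
  simp only [up2, mul_smul, ← Finset.smul_sum, sum_eta_smul]

end Derivations

section Vertices

variable (f : Fin N → Fin N → Fin N → ℝ)

lemma up2_smul_ip {σ : Type*} (T : Fin 4 → Fin 4 → Fin N → MvPolynomial σ ℂ) (μ ν : Fin 4)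
    (Y : Fin N → MvPolynomial σ ℂ) :
    ip (up2 T μ ν) Y = (eta μ μ * eta ν ν : ℂ) • ip (T μ ν) Y := by
  rw [up2_eq, ip, ip, Finset.smul_sum]
  refine Finset.sum_congr rfl fun a _ => ?_
  rw [Pi.smul_apply, RCLike.real_smul_eq_coe_smul (K := ℂ), smul_mul_assoc]
  congr 1
  simp

lemma Q1_eq (μ : Fin 4) : Q1 f μ = ∑ ν, (eta μ μ * eta ν ν : ℂ) •
    ip (fun a => MvPolynomial.X (some (fF μ ν), a)) (ibr f (fun a => MvPolynomial.X (none, a))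
      (fun a => MvPolynomial.X (some (fA ν), a))) :=
  Finset.sum_congr rfl fun _ _ => up2_smul_ip _ _ _ _

lemma L1_eq : L1 f = (1 / 2 : ℂ) • ∑ μ, ∑ ν, (eta μ μ * eta ν ν : ℂ) •
    ip (fun a => MvPolynomial.X (fF μ ν, a)) (ibr f (fun a => MvPolynomial.X (fA μ, a))
      (fun a => MvPolynomial.X (fA ν, a))) := by
  simp only [L1, up2_smul_ip]

lemma aeval_pderiv_X {σ : Type*} [DecidableEq σ] (v : σ → ℂ) (i j : σ) :
    MvPolynomial.aeval v (MvPolynomial.pderiv i (MvPolynomial.X j : MvPolynomial σ ℂ)) =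
      if j = i then 1 else 0 := by
  rw [MvPolynomial.pderiv_X, Pi.single_apply]
  split_ifs <;> simp [*]

lemma indicator_eq {τ : Type*} [DecidableEq τ] (p q : τ) (a : Fin N) :
    (fun d : Fin N => if (p, d) = (q, a) then (1 : ℂ) else 0) =
      (if p = q then 1 else 0 : ℂ) • Pi.single a 1 := by
  funext d
  by_cases h : p = q <;> simp [h, Pi.single_apply]

lemma ipL_single (Y : Fin N → ℂ) (a : Fin N) : ipL N (Pi.single a 1) Y = Y a := by
  rw [← ip_eq]
  simp [ip, Pi.single_apply]

/-- Invariance of the inner product, i.e. cyclicity of f: the slot being differentiated is isolated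
as a component of a bracket. -/
lemma ipL_ibrL_single_right {f : Fin N → Fin N → Fin N → ℝ} (hf : IsStructureConstants f)
    (Z X : Fin N → ℂ) (a : Fin N) : ipL N Z (ibrL f X (Pi.single a 1)) = ibrL f Z X a := by
  rw [← ip_eq, ← ibr_eq, ← ibr_eq]
  simp only [ip, ibr, Pi.single_apply, mul_ite, mul_one, mul_zero, smul_ite, smul_zero,
    Finset.sum_ite_eq', Finset.mem_univ, if_true, ← Finset.sum_neg_distrib, Finset.mul_sum]
  refine Finset.sum_congr rfl fun d _ => Finset.sum_congr rfl fun b _ => ?_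
  rw [hf.antisymm_right b a d, hf.antisymm_left b d a, smul_eq_mul, smul_eq_mul]
  push_cast
  ring

lemma ipL_ibrL_single_left {f : Fin N → Fin N → Fin N → ℝ} (hf : IsStructureConstants f)
    (Z X : Fin N → ℂ) (a : Fin N) : ipL N Z (ibrL f (Pi.single a 1) X) = -ibrL f Z X a := by
  rw [ibrL_antisymm hf, map_neg, ipL_ibrL_single_right hf]

lemma eval_pderiv_Q1_F (v : GluonW × Fin N → ℂ) (μ ρ ν : Fin 4) (a : Fin N) :
    MvPolynomial.eval v (MvPolynomial.pderiv (some (fF ρ ν), a) (Q1 f μ)) =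
      if μ = ρ then (eta μ μ * eta ν ν : ℂ) *
        ibrL f (fun b => v (none, b)) (fun b => v (some (fA ν), b)) a else 0 := by
  rw [← MvPolynomial.coe_aeval_eq_eval, RingHom.coe_coe, Q1_eq]
  simp only [map_sum, Derivation.map_smul, derivation_ip, derivation_ibr, map_smul, map_add, map_ip,
    map_ibr, aeval_pderiv_X, MvPolynomial.aeval_X, indicator_eq]
  simp only [ip_eq, ibr_eq, map_smul, LinearMap.smul_apply, ipL_single]
  simp [ite_and, ← Pi.zero_def]

lemma eval_pderiv_Q1_A {f : Fin N → Fin N → Fin N → ℝ} (hf : IsStructureConstants f)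
    (v : GluonW × Fin N → ℂ) (μ ν : Fin 4) (a : Fin N) :
    MvPolynomial.eval v (MvPolynomial.pderiv (some (fA ν), a) (Q1 f μ)) =
      (eta μ μ * eta ν ν : ℂ) *
        ibrL f (fun b => v (some (fF μ ν), b)) (fun b => v (none, b)) a := by
  rw [← MvPolynomial.coe_aeval_eq_eval, RingHom.coe_coe, Q1_eq]
  simp only [map_sum, Derivation.map_smul, derivation_ip, derivation_ibr, map_smul, map_add, map_ip,
    map_ibr, aeval_pderiv_X, MvPolynomial.aeval_X, indicator_eq]
  simp only [ip_eq, ibr_eq, ← Pi.add_def]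
  simp only [map_smul, map_add, ipL_ibrL_single_right hf]
  simp

lemma eval_pderiv_L1_F (v : Gluon × Fin N → ℂ) (κ ρ : Fin 4) (a : Fin N) :
    MvPolynomial.eval v (MvPolynomial.pderiv (fF κ ρ, a) (L1 f)) =
      (1 / 2) * (eta κ κ * eta ρ ρ : ℂ) *
        ibrL f (fun b => v (fA κ, b)) (fun b => v (fA ρ, b)) a := by
  rw [← MvPolynomial.coe_aeval_eq_eval, RingHom.coe_coe, L1_eq]
  simp only [map_sum, Derivation.map_smul, derivation_ip, derivation_ibr, map_smul, map_add, map_ip,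
    map_ibr, aeval_pderiv_X, MvPolynomial.aeval_X, indicator_eq]
  simp only [ip_eq, ibr_eq, map_smul, LinearMap.smul_apply, ipL_single]
  simp [ite_and, mul_assoc, ← Pi.zero_def]

/-- A occurs in both slots of the bracket. The two contributions agree by the antisymmetries of F
and of the bracket, which absorbs the factor ½ of L₁. The antisymmetry of F is one of values: the
symbols themselves are independent. -/
lemma eval_pderiv_L1_A {f : Fin N → Fin N → Fin N → ℝ} (hf : IsStructureConstants f)
    (v : Gluon × Fin N → ℂ) (hv : ∀ μ ν, (fun a => v (fF μ ν, a)) = -fun a => v (fF ν μ, a))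
    (κ : Fin 4) (a : Fin N) :
    MvPolynomial.eval v (MvPolynomial.pderiv (fA κ, a) (L1 f)) =
      -∑ ν, (eta κ κ * eta ν ν : ℂ) *
        ibrL f (fun b => v (fF κ ν, b)) (fun b => v (fA ν, b)) a := by
  rw [← MvPolynomial.coe_aeval_eq_eval, RingHom.coe_coe, L1_eq]
  simp only [map_sum, Derivation.map_smul, derivation_ip, derivation_ibr, map_smul, map_add, map_ip,
    map_ibr, aeval_pderiv_X, MvPolynomial.aeval_X, indicator_eq]
  simp only [ip_eq, ibr_eq, map_smul, map_add, LinearMap.smul_apply, ipL_ibrL_single_right hf, ipL_ibrL_single_left hf, ← Pi.add_def]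
  simp [mul_add, Finset.sum_add_distrib, ← Pi.zero_def]
  have h : ∀ ν, (eta ν ν * eta κ κ : ℂ) *
      ibrL f (fun a => v (fF ν κ, a)) (fun a => v (fA ν, a)) a =
      -((eta κ κ * eta ν ν : ℂ) * ibrL f (fun a => v (fF κ ν, a)) (fun a => v (fA ν, a)) a) := by
    intro ν
    rw [hv ν κ, map_neg, LinearMap.neg_apply, Pi.neg_apply]
    ring
  rw [Finset.sum_congr rfl fun ν _ => h ν, Finset.sum_neg_distrib]
  ring

end Vertices

end WickPolynomials

/-! ### Test functions of two points -/

lemma IsTest.comp_of_leftInverse {E E' : Type*} [NormedAddCommGroup E] [NormedSpace ℝ E]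
    [NormedAddCommGroup E'] [NormedSpace ℝ E'] {G : E → ℂ} (hG : IsTest G) {φ : E' → E}
    (hφ : ContDiff ℝ ∞ φ) {ψ : E → E'} (hψ : Continuous ψ) (h : Function.LeftInverse ψ φ) :
    IsTest (fun x => G (φ x)) :=
  ⟨hG.smooth.comp hφ, hG.compact.comp_isClosedEmbedding (h.isClosedEmbedding hψ hφ.continuous)⟩

lemma IsTest.mul_left {E : Type*} [NormedAddCommGroup E] [NormedSpace ℝ E] {p G : E → ℂ}
    (hp : ContDiff ℝ ∞ p) (hG : IsTest G) : IsTest (fun x => p x * G x) :=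
  ⟨hp.mul hG.smooth, hG.compact.mul_left⟩

lemma IsTest.add {E : Type*} [NormedAddCommGroup E] [NormedSpace ℝ E] {f g : E → ℂ}
    (hf : IsTest f) (hg : IsTest g) : IsTest (fun x => f x + g x) :=
  ⟨hf.smooth.add hg.smooth, hf.compact.add hg.compact⟩

lemma isTest_zero {E : Type*} [NormedAddCommGroup E] [NormedSpace ℝ E] :
    IsTest (fun _ : E => (0 : ℂ)) :=
  ⟨contDiff_const, HasCompactSupport.zero⟩

lemma IsTest.sum {E ι : Type*} [NormedAddCommGroup E] [NormedSpace ℝ E] (s : Finset ι)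
    {f : ι → E → ℂ} (hf : ∀ i, IsTest (f i)) : IsTest (fun x => ∑ i ∈ s, f i x) := by
  classical
  induction s using Finset.induction_on with
  | empty => simpa using isTest_zero
  | insert i s hi ih =>
    simp only [Finset.sum_insert hi]
    exact (hf i).add ih

/-- The partial derivative with respect to the first point. -/
def pd1 (μ : Fin 4) (G : Mink × Mink → ℂ) : Mink × Mink → ℂ :=
  fun p => pd μ (fun x => G (x, p.2)) p.1

/-- The partial derivative with respect to the second point. -/
def pd2 (μ : Fin 4) (G : Mink × Mink → ℂ) : Mink × Mink → ℂ :=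
  fun p => pd μ (fun x => G (p.1, x)) p.2

lemma pd_comp {G : Mink × Mink → ℂ} (hG : Differentiable ℝ G) {φ : Mink → Mink × Mink}
    {φ' : Mink →L[ℝ] Mink × Mink} {x : Mink} (hφ : HasFDerivAt φ φ' x) (μ : Fin 4) :
    pd μ (fun y => G (φ y)) x = fderiv ℝ G (φ x) (φ' (Pi.single μ 1)) := by
  have h : HasFDerivAt (fun y => G (φ y)) ((fderiv ℝ G (φ x)).comp φ') x :=
    (hG _).hasFDerivAt.comp x hφ
  rw [pd, h.fderiv]
  rfl

lemma pd1_eq {G : Mink × Mink → ℂ} (hG : Differentiable ℝ G) (μ : Fin 4) :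
    pd1 μ G = fun p => fderiv ℝ G p (Pi.single μ 1, 0) := by
  funext p
  exact pd_comp hG ((hasFDerivAt_id _).prodMk (hasFDerivAt_const _ _)) μ

lemma pd2_eq {G : Mink × Mink → ℂ} (hG : Differentiable ℝ G) (μ : Fin 4) :
    pd2 μ G = fun p => fderiv ℝ G p (0, Pi.single μ 1) := by
  funext p
  exact pd_comp hG ((hasFDerivAt_const _ _).prodMk (hasFDerivAt_id _)) μ

lemma IsTest.pd1 {G : Mink × Mink → ℂ} (hG : IsTest G) (μ : Fin 4) : IsTest (pd1 μ G) := by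
  rw [pd1_eq hG.differentiable]
  exact ⟨(hG.smooth.fderiv_right (m := ∞) (by simp)).clm_apply contDiff_const,
    hG.compact.fderiv_apply ℝ _⟩

lemma IsTest.pd2 {G : Mink × Mink → ℂ} (hG : IsTest G) (μ : Fin 4) : IsTest (pd2 μ G) := by
  rw [pd2_eq hG.differentiable]
  exact ⟨(hG.smooth.fderiv_right (m := ∞) (by simp)).clm_apply contDiff_const,
    hG.compact.fderiv_apply ℝ _⟩

lemma IsTest.swap {G : Mink × Mink → ℂ} (hG : IsTest G) : IsTest (fun p : Mink × Mink => G (p.2, p.1)) :=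
  hG.comp_of_leftInverse (φ := fun p : Mink × Mink => (p.2, p.1)) (by fun_prop)
    (ψ := fun p : Mink × Mink => (p.2, p.1)) (by fun_prop) fun _ => rfl

lemma IsTest.fiber {G : Mink × Mink → ℂ} (hG : IsTest G) (x' : Mink) :
    IsTest (fun ξ => G (x' + ξ, x')) :=
  hG.comp_of_leftInverse (φ := fun ξ : Mink => (x' + ξ, x')) (by fun_prop)
    (ψ := fun p => p.1 - x') (by fun_prop) fun _ => by simp

lemma IsTest.translate {G : Mink × Mink → ℂ} (hG : IsTest G) (y : Mink) :
    IsTest (fun x => G (x + y, x)) :=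
  hG.comp_of_leftInverse (φ := fun x : Mink => (x + y, x)) (by fun_prop)
    (ψ := fun p => p.2) (by fun_prop) fun _ => rfl

lemma IsTest.diag {G : Mink × Mink → ℂ} (hG : IsTest G) : IsTest (fun x => G (x, x)) :=
  hG.comp_of_leftInverse (φ := fun x : Mink => (x, x)) (by fun_prop)
    (ψ := fun p => p.2) (by fun_prop) fun _ => rfl

lemma pd_fiber {G : Mink × Mink → ℂ} (hG : Differentiable ℝ G) (μ : Fin 4) (x' : Mink) :
    pd μ (fun ξ => G (x' + ξ, x')) = fun ξ => pd1 μ G (x' + ξ, x') := by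
  funext ξ
  rw [pd1_eq hG]
  exact pd_comp hG (((hasFDerivAt_id ξ).const_add x').prodMk (hasFDerivAt_const _ _)) μ

lemma pd_translate {G : Mink × Mink → ℂ} (hG : Differentiable ℝ G) (μ : Fin 4) (y x : Mink) :
    pd μ (fun x => G (x + y, x)) x = pd1 μ G (x + y, x) + pd2 μ G (x + y, x) := by
  rw [pd1_eq hG, pd2_eq hG, ← map_add]
  simpa using pd_comp hG (((hasFDerivAt_id x).add_const y).prodMk (hasFDerivAt_id x)) μ

lemma pd_diag {G : Mink × Mink → ℂ} (hG : Differentiable ℝ G) (μ : Fin 4) (x : Mink) :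
    pd μ (fun x => G (x, x)) x = pd1 μ G (x, x) + pd2 μ G (x, x) := by
  simpa using pd_translate hG μ 0 x

lemma integral_pd {f : Mink → ℂ} (hf : IsTest f) (μ : Fin 4) : ∫ x, pd μ f x = 0 := by
  have h := integral_bilinear_hasLineDerivAt_right_eq_neg_left_of_integrable
    (μ := (volume : Measure Mink)) (B := ContinuousLinearMap.mul ℝ ℂ) (f := fun _ => 1)
    (f' := fun _ => 0) (g := f) (g' := pd μ f) (v := Pi.single μ 1)
    (by simp) (by simpa using (hf.pd μ).integrable)
    (by simpa using hf.integrable)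
    (fun x _ => by simpa using (hasFDerivAt_const (1 : ℂ) x).hasLineDerivAt (Pi.single μ 1))
    (fun x _ => hasLineDerivAt_pd hf μ x)
  simpa using h

lemma pd_mul {f g : Mink → ℂ} (hf : Differentiable ℝ f) (hg : Differentiable ℝ g) (μ : Fin 4)
    (x : Mink) : pd μ (fun y => f y * g y) x = pd μ f x * g x + f x * pd μ g x := by
  rw [pd, fderiv_fun_mul (hf x) (hg x)]
  simp only [add_apply, smul_apply, smul_eq_mul, pd]
  ring

lemma integral_mul_pd {f g : Mink → ℂ} (hf : ContDiff ℝ ∞ f) (hg : IsTest g) (μ : Fin 4) :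
    ∫ x, f x * pd μ g x = -∫ x, pd μ f x * g x := by
  have h := integral_pd (hg.mul_left hf) μ
  simp only [pd_mul (hf.differentiable (by simp)) hg.differentiable] at h
  rw [integral_add ((hg.mul_left (contDiff_pd hf μ)).integrable)
    (((hg.pd μ).mul_left hf).integrable)] at h
  exact eq_neg_of_add_eq_zero_right h

/-! ### The smeared string distribution in two points -/

/-- Needed since the string integrands have compact support only up to null sets: off the
hyperboloid e may be arbitrarily short and s unbounded. -/
lemma integrable_of_ae_zero {X : Type*} [TopologicalSpace X] [T2Space X] [MeasurableSpace X]
    [OpensMeasurableSpace X] {τ : Measure X} [IsFiniteMeasureOnCompacts τ] {f : X → ℂ}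
    (hf : Continuous f) {K : Set X} (hK : IsCompact K) (h : ∀ᵐ x ∂τ, x ∉ K → f x = 0) :
    Integrable f τ := by
  refine ((integrable_indicator_iff hK.measurableSet).2
    (hf.continuousOn.integrableOn_compact' hK hK.measurableSet)).congr ?_
  filter_upwards [h] with x hx
  by_cases hxK : x ∈ K
  · simp [hxK]
  · rw [Set.indicator_of_notMem hxK, hx hxK]

/-- The three spatial squares sum to at least 1. This lower bound lets a bound on the displacement
se bound the parameter s. -/
lemma half_le_norm {e : Mink} (he : e ∈ hyperboloid) : 1 / 2 ≤ ‖e‖ := by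
  have h : e 0 ^ 2 - ∑ i : Fin 3, e i.succ ^ 2 = -1 := by
    rw [← minkSq_eq]; exact he
  have h1 : ∀ i, e i ^ 2 ≤ ‖e‖ ^ 2 := fun i => by
    rw [← sq_abs (e i)]
    exact pow_le_pow_left₀ (abs_nonneg _) (norm_le_pi_norm e i) 2
  rw [Fin.sum_univ_three] at h
  nlinarith [sq_nonneg (e 0), h1 (Fin.succ 0), h1 (Fin.succ 1), h1 (Fin.succ 2), norm_nonneg e]

lemma integrable_string_of_abs {m : Mink → ℝ} (hm : Continuous m) (hmc : HasCompactSupport m)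
    {G : Mink × Mink → ℂ} (hG : IsTest G) {r : ℝ} (hr : |r| = 1) :
    Integrable (fun q : Mink × (Mink × ℝ) => (m q.2.1 : ℂ) * G (q.1 + r • q.2.2 • q.2.1, q.1))
      (volume.prod strMeasure) := by
  obtain ⟨R, hR⟩ := hG.compact.isCompact.isBounded.subset_closedBall (0 : Mink × Mink)
  obtain ⟨M, hM⟩ := hmc.isCompact.isBounded.subset_closedBall (0 : Mink)
  have hcont : Continuous fun q : Mink × (Mink × ℝ) =>
      (m q.2.1 : ℂ) * G (q.1 + r • q.2.2 • q.2.1, q.1) := by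
    have := hG.continuous
    fun_prop
  refine integrable_of_ae_zero hcont (K := Metric.closedBall 0 R ×ˢ (Metric.closedBall 0 M ×ˢ
    Set.Icc 0 (4 * R))) ((isCompact_closedBall _ _).prod
      ((isCompact_closedBall _ _).prod isCompact_Icc)) ?_
  filter_upwards [Measure.quasiMeasurePreserving_snd.ae ae_strMeasure] with q hq hqK
  by_contra hcon
  rw [← ne_eq, mul_ne_zero_iff] at hcon
  have h1 : ‖q.2.1‖ ≤ M := by
    have := hM (subset_tsupport m (by exact_mod_cast hcon.1))
    rwa [mem_closedBall_zero_iff] at this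
  have h2 := hR (subset_tsupport _ hcon.2)
  rw [mem_closedBall_zero_iff, Prod.norm_def, max_le_iff] at h2
  refine hqK ⟨by simpa using h2.2, by simpa using h1, hq.2.le, ?_⟩
  have h3 : ‖r • q.2.2 • q.2.1‖ ≤ 2 * R := by
    have : r • q.2.2 • q.2.1 = (q.1 + r • q.2.2 • q.2.1) - q.1 := by abel
    rw [this]
    linarith [norm_sub_le (q.1 + r • q.2.2 • q.2.1) q.1, h2.1, h2.2]
  rw [norm_smul, Real.norm_eq_abs, hr, one_mul, norm_smul, Real.norm_of_nonneg hq.2.le] at h3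
  nlinarith [half_le_norm hq.1, hq.2]

lemma integrable_string {m : Mink → ℝ} (hm : Continuous m) (hmc : HasCompactSupport m)
    {G : Mink × Mink → ℂ} (hG : IsTest G) :
    Integrable (fun q : Mink × (Mink × ℝ) => (m q.2.1 : ℂ) * G (q.1 + q.2.2 • q.2.1, q.1))
      (volume.prod strMeasure) := by
  simpa using integrable_string_of_abs hm hmc hG (r := 1) (by simp)

lemma IsTest.isSpacelikeCompact {f : Mink → ℂ} (hf : IsTest f) : IsSpacelikeCompact f := by
  refine ⟨hf.smooth, ?_⟩
  obtain ⟨R, hR⟩ := hf.compact.isCompact.isBounded.subset_closedBall (0 : Mink)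
  refine ⟨3 * |R|, fun x hx => ?_⟩
  by_contra hcon
  have h1 := hR (subset_tsupport f hcon)
  rw [mem_closedBall_zero_iff] at h1
  refine absurd hx (not_lt.2 ((Real.sqrt_le_sqrt (y := (3 * |R|) ^ 2) ?_).trans ?_))
  · have h2 : ∀ i, x i ^ 2 ≤ |R| ^ 2 := fun i => by
      rw [← sq_abs (x i)]
      exact pow_le_pow_left₀ (abs_nonneg _)
        (((norm_le_pi_norm x i).trans h1).trans (le_abs_self R)) 2
    rw [Fin.sum_univ_three]
    nlinarith [h2 (Fin.succ 0), h2 (Fin.succ 1), h2 (Fin.succ 2), sq_nonneg (|R|)]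
  · rw [Real.sqrt_sq (by positivity)]
    linarith [abs_nonneg (x 0)]

/-- The distribution `∫ dσ m(e) ∫₀^∞ ds δ(x - x' - s e)`. -/
def strPair (m : Mink → ℝ) (G : Mink × Mink → ℂ) : ℂ :=
  ∫ x', strDelta m (fun ξ => G (x' + ξ, x'))

lemma strDelta_eq {m : Mink → ℝ} (hm : Continuous m) (hmc : HasCompactSupport m)
    {f : Mink → ℂ} (hf : IsTest f) :
    strDelta m f = ∫ p, (m p.1 : ℂ) * f (p.2 • p.1) ∂strMeasure := by
  have h := strS_eq_iterated hm hmc 0 hf.isSpacelikeCompact 0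
  simpa [strS, strDelta] using h.symm

lemma strPair_eq {m : Mink → ℝ} (hm : Continuous m) (hmc : HasCompactSupport m)
    {G : Mink × Mink → ℂ} (hG : IsTest G) :
    strPair m G = ∫ q : Mink × (Mink × ℝ), (m q.2.1 : ℂ) * G (q.1 + q.2.2 • q.2.1, q.1)
      ∂(volume.prod strMeasure) := by
  rw [integral_prod _ (integrable_string hm hmc hG)]
  refine integral_congr_ae (.of_forall fun x' => ?_)
  exact strDelta_eq hm hmc (hG.fiber x')

lemma integrable_strDelta {m : Mink → ℝ} (hm : Continuous m) (hmc : HasCompactSupport m)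
    {G : Mink × Mink → ℂ} (hG : IsTest G) :
    Integrable fun x' => strDelta m (fun ξ => G (x' + ξ, x')) := by
  refine (integrable_string hm hmc hG).integral_prod_left.congr (.of_forall fun x' => ?_)
  exact (strDelta_eq hm hmc (hG.fiber x')).symm

/-- With the base point integrated first, translation invariance of Lebesgue measure can be used at
a fixed string displacement. -/
lemma strPair_eq_swap {m : Mink → ℝ} (hm : Continuous m) (hmc : HasCompactSupport m)
    {G : Mink × Mink → ℂ} (hG : IsTest G) :
    strPair m G = ∫ p, (m p.1 : ℂ) * (∫ x, G (x + p.2 • p.1, x)) ∂strMeasure := by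
  rw [strPair_eq hm hmc hG, integral_prod_symm _ (integrable_string hm hmc hG)]
  simp only [integral_const_mul]

lemma strPair_add {m : Mink → ℝ} (hm : Continuous m) (hmc : HasCompactSupport m)
    {G H : Mink × Mink → ℂ} (hG : IsTest G) (hH : IsTest H) :
    strPair m (fun p => G p + H p) = strPair m G + strPair m H := by
  rw [strPair_eq hm hmc hG, strPair_eq hm hmc hH, strPair_eq hm hmc (hG.add hH),
    ← integral_add (integrable_string hm hmc hG) (integrable_string hm hmc hH)]
  simp only [mul_add]

lemma strPair_zero (m : Mink → ℝ) : strPair m (fun _ => 0) = 0 := by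
  simp [strPair, strDelta]

lemma strPair_sum {m : Mink → ℝ} (hm : Continuous m) (hmc : HasCompactSupport m) {ι : Type*}
    (s : Finset ι) {G : ι → Mink × Mink → ℂ} (hG : ∀ i, IsTest (G i)) :
    strPair m (fun p => ∑ i ∈ s, G i p) = ∑ i ∈ s, strPair m (G i) := by
  classical
  induction s using Finset.induction_on with
  | empty => simpa using strPair_zero m
  | insert i s hi ih =>
    simp only [Finset.sum_insert hi]
    rw [strPair_add hm hmc (hG i) (IsTest.sum s hG), ih]

/-- The string distribution is invariant under translations of both points. -/
lemma strPair_pd {m : Mink → ℝ} (hm : Continuous m) (hmc : HasCompactSupport m)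
    {G : Mink × Mink → ℂ} (hG : IsTest G) (μ : Fin 4) :
    strPair m (fun p => pd1 μ G p + pd2 μ G p) = 0 := by
  rw [strPair_eq_swap hm hmc ((hG.pd1 μ).add (hG.pd2 μ))]
  simp only [← pd_translate hG.differentiable, integral_pd (hG.translate _), mul_zero,
    integral_zero]

/-- The reflected string distribution. -/
lemma integral_strI_delta {c : Mink → ℝ} (hm : Continuous c) (hmc : HasCompactSupport c) (ρ : Fin 4)
    {H : Mink × Mink → ℂ} (hH : IsTest H) :
    ∫ x', strI c ρ delta (fun ξ => H (x' + ξ, x')) =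
      strPair (fun e => c e * e ρ) fun p => H (p.2, p.1) := by
  have hm' : Continuous fun e : Mink => c e * e ρ := by fun_prop
  have hmc' : HasCompactSupport fun e : Mink => c e * e ρ := hmc.mul_right
  rw [strPair_eq_swap hm' hmc' hH.swap]
  have e1 : ∀ x', strI c ρ delta (fun ξ => H (x' + ξ, x')) =
      ∫ p, ((c p.1 * p.1 ρ : ℝ) : ℂ) * H (x' + (-1 : ℝ) • p.2 • p.1, x') ∂strMeasure := by
    intro x'
    have ht : IsTest fun ξ => H (x' + (-1 : ℝ) • ξ, x') :=
      (hH.fiber x').comp_of_leftInverse (φ := fun ξ : Mink => (-1 : ℝ) • ξ) (by fun_prop)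
        (ψ := fun ξ => (-1 : ℝ) • ξ) (by fun_prop) fun _ => by simp
    rw [← strDelta_eq hm' hmc' ht]
    simp [strI, strDelta, delta]
  simp only [e1]
  rw [← integral_prod _ (integrable_string_of_abs hm' hmc' hH (r := -1) (by simp)),
    integral_prod_symm _ (integrable_string_of_abs hm' hmc' hH (r := -1) (by simp))]
  simp only [integral_const_mul]
  refine integral_congr_ae (.of_forall fun p => ?_)
  simp only
  congr 1
  -- Moving the base point by se replaces (x-se, x) by (x, x+se), the reflected pair.
  rw [← integral_add_right_eq_self (fun x => H (x + (-1 : ℝ) • p.2 • p.1, x)) (p.2 • p.1)]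
  simp

section IntegratedObstructions

variable {N : ℕ}

/-! ### Integrated two-point obstructions -/

/-- The distribution `δ(x - x')`. -/
def diagPair (G : Mink × Mink → ℂ) : ℂ := ∫ x, G (x, x)

lemma pd1_const_mul (k : ℂ) {G : Mink × Mink → ℂ} (hG : Differentiable ℝ G) (μ : Fin 4) :
    pd1 μ (fun p => k * G p) = fun p => k * pd1 μ G p := by
  rw [pd1_eq hG, pd1_eq (hG.const_mul k)]
  funext p
  rw [fderiv_const_mul (hG p)]
  rfl

lemma diagPair_const_mul (k : ℂ) (G : Mink × Mink → ℂ) :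
    diagPair (fun p => k * G p) = k * diagPair G := integral_const_mul _ _

lemma strPair_const_mul (m : Mink → ℝ) (k : ℂ) (G : Mink × Mink → ℂ) :
    strPair m (fun p => k * G p) = k * strPair m G := by
  simp only [strPair, strDelta, integral_const_mul, mul_left_comm _ k]

variable (cF : ℂ) {c : Mink → ℝ}

lemma divF_fiber_F (ν κ ρ : Fin 4) {G : Mink × Mink → ℂ} (hG : IsTest G) (x' : Mink) :
    divF cF c ν (fF κ ρ) (fun ξ => G (x' + ξ, x')) = -Complex.I * (1 + cF) *
      (eta ν κ * pd1 ρ G (x', x') - eta ν ρ * pd1 κ G (x', x')) := by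
  simp [divF, pd_fiber hG.differentiable]

lemma divF_fiber_A (ν κ : Fin 4) {G : Mink × Mink → ℂ} (hG : IsTest G) (x' : Mink) :
    divF cF c ν (fA κ) (fun ξ => G (x' + ξ, x')) = Complex.I * (eta ν κ * G (x', x') +
      eta ν ν * strDelta (fun e => c e * e ν) (fun ξ => pd1 κ G (x' + ξ, x'))) := by
  simp [divF, pd_fiber hG.differentiable]

lemma integrable_divF (hc : IsSmearing c) (ν : Fin 4) (χ : Gluon) {G : Mink × Mink → ℂ}
    (hG : IsTest G) : Integrable fun x' => divF cF c ν χ (fun ξ => G (x' + ξ, x')) := by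
  rcases χ with ⟨κ, ρ⟩ | κ
  · simp only [divF_fiber_F cF ν κ ρ hG]
    exact (((hG.pd1 ρ).diag.integrable.const_mul _).sub
      ((hG.pd1 κ).diag.integrable.const_mul _)).const_mul _
  · simp only [divF_fiber_A cF ν κ hG]
    have hm : Continuous fun e : Mink => c e * e ν := by
      have := hc.smooth.continuous
      fun_prop
    exact ((hG.diag.integrable.const_mul _).add
      ((integrable_strDelta hm hc.compact.mul_right (hG.pd1 κ)).const_mul _)).const_mul _

lemma integral_divF_F (ν κ ρ : Fin 4) {G : Mink × Mink → ℂ} (hG : IsTest G) :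
    ∫ x', divF cF c ν (fF κ ρ) (fun ξ => G (x' + ξ, x')) = -Complex.I * (1 + cF) *
      (eta ν κ * diagPair (pd1 ρ G) - eta ν ρ * diagPair (pd1 κ G)) := by
  simp only [divF_fiber_F cF ν κ ρ hG]
  rw [integral_const_mul, integral_sub ((hG.pd1 ρ).diag.integrable.const_mul _)
    ((hG.pd1 κ).diag.integrable.const_mul _), integral_const_mul, integral_const_mul]
  rfl

lemma integral_divF_A (hc : IsSmearing c) (ν κ : Fin 4) {G : Mink × Mink → ℂ} (hG : IsTest G) :
    ∫ x', divF cF c ν (fA κ) (fun ξ => G (x' + ξ, x')) = Complex.I *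
      (eta ν κ * diagPair G + eta ν ν * strPair (fun e => c e * e ν) (pd1 κ G)) := by
  simp only [divF_fiber_A cF ν κ hG]
  have hm : Continuous fun e : Mink => c e * e ν := by
    have := hc.smooth.continuous
    fun_prop
  rw [integral_const_mul, integral_add (hG.diag.integrable.const_mul _)
    ((integrable_strDelta hm hc.compact.mul_right (hG.pd1 κ)).const_mul _), integral_const_mul,
    integral_const_mul]
  rfl

/-- Elements of `Dist` carry no linearity, so scalars are pulled out through the explicit local and
string pairings. -/
lemma integral_divF_const_mul (hc : IsSmearing c) (ν : Fin 4) (χ : Gluon) (k : ℂ)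
    {G : Mink × Mink → ℂ} (hG : IsTest G) :
    ∫ x', divF cF c ν χ (fun ξ => k * G (x' + ξ, x')) =
      k * ∫ x', divF cF c ν χ (fun ξ => G (x' + ξ, x')) := by
  have hk : IsTest fun p => k * G p := hG.mul_left contDiff_const
  rcases χ with ⟨κ, ρ⟩ | κ
  · rw [integral_divF_F cF ν κ ρ hG, integral_divF_F cF ν κ ρ hk,
      pd1_const_mul k hG.differentiable, pd1_const_mul k hG.differentiable, diagPair_const_mul,
      diagPair_const_mul]
    ring
  · rw [integral_divF_A cF hc ν κ hG, integral_divF_A cF hc ν κ hk,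
      pd1_const_mul k hG.differentiable, diagPair_const_mul, strPair_const_mul]
    ring

lemma eta_mul_self_complex (μ : Fin 4) : (eta μ μ : ℂ) * eta μ μ = 1 := by
  exact_mod_cast eta_mul_self μ

/-- The contribution of the derivatives with respect to `F` to the obstruction. -/
lemma sum_twoPointObs_F (hc : IsSmearing c) (b : Mink → Fin 4 → ℝ) (χ : Gluon)
    {G : Fin 4 → Mink × Mink → ℂ} (hG : ∀ ν, IsTest (G ν)) :
    ∑ μ, ∑ ρ, ∑ ν, ∫ x', twoPointObs cF c b μ (some (fF ρ ν)) χ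
      (fun ξ => (if μ = ρ then (eta μ μ * eta ν ν : ℂ) else 0) * G ν (x' + ξ, x')) =
    -∑ ν, (eta ν ν : ℂ) * ∫ x', divF cF c ν χ (fun ξ => G ν (x' + ξ, x')) := by
  set D : Fin 4 → Fin 4 → ℂ := fun μ ν => ∫ x', divF cF c μ χ (fun ξ => G ν (x' + ξ, x')) with hD
  have h1 : ∀ μ ρ ν, ∫ x', twoPointObs cF c b μ (some (fF ρ ν)) χ
      (fun ξ => (if μ = ρ then (eta μ μ * eta ν ν : ℂ) else 0) * G ν (x' + ξ, x')) =
      (if μ = ρ then (eta μ μ * eta ν ν : ℂ) else 0) * (-(1 / 3) *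
        (eta μ ρ * D ν ν - eta μ ν * D ρ ν)) := by
    intro μ ρ ν
    set k : ℂ := if μ = ρ then (eta μ μ * eta ν ν : ℂ) else 0
    have hk : IsTest fun p => k * G ν p := (hG ν).mul_left contDiff_const
    have hkf : ∀ x', IsTest fun ξ => k * G ν (x' + ξ, x') := fun x' => hk.fiber x'
    simp only [fun x' => twoPointObs_F cF hc b μ ρ ν χ (hkf x')]
    rw [integral_const_mul, integral_sub ((integrable_divF cF hc ν χ hk).const_mul _)
      ((integrable_divF cF hc ρ χ hk).const_mul _), integral_const_mul, integral_const_mul,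
      integral_divF_const_mul cF hc ν χ k (hG ν), integral_divF_const_mul cF hc ρ χ k (hG ν)]
    ring
  -- For each μ the first term is the full trace and the second a single summand of it. Summed over
  -- μ they give -(4-1)/3 = -1 times the trace.
  have h2 : ∀ μ, ∑ ρ, ∑ ν, (if μ = ρ then (eta μ μ * eta ν ν : ℂ) else 0) * (-(1 / 3) *
      (eta μ ρ * D ν ν - eta μ ν * D ρ ν)) =
      -(1 / 3) * ∑ ν, (eta ν ν : ℂ) * D ν ν + (1 / 3) * ((eta μ μ : ℂ) * D μ μ) := by
    intro μ
    rw [Finset.sum_eq_single μ (fun ρ _ hρ => by simp [hρ.symm])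
      (fun h => absurd (Finset.mem_univ _) h)]
    have h3 := sum_eta_mul μ fun ν => (1 / 3) * (eta μ μ : ℂ) * ((eta ν ν : ℂ) * D μ ν)
    have h4 : (1 / 3) * ((eta μ μ : ℂ) * D μ μ) =
        eta μ μ * ((1 / 3) * (eta μ μ : ℂ) * ((eta μ μ : ℂ) * D μ μ)) := by
      linear_combination (-(1 / 3) * (eta μ μ : ℂ) * D μ μ) * eta_mul_self_complex μ
    rw [h4, ← h3, Finset.mul_sum, ← Finset.sum_add_distrib]
    refine Finset.sum_congr rfl fun ν _ => ?_
    rw [if_pos rfl]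
    linear_combination (-(1 / 3) * (eta ν ν : ℂ) * D ν ν) * eta_mul_self_complex μ
  simp only [h1, h2]
  rw [Finset.sum_add_distrib, ← Finset.mul_sum (s := Finset.univ (α := Fin 4))
    (f := fun μ => (eta μ μ : ℂ) * D μ μ), Finset.sum_const]
  simp
  ring

/-! ### The obstruction -/

/-- The values of the field strengths in a configuration. -/
def fieldF (F : Fin 4 → Fin 4 → Fin N → Mink → ℂ) (μ ν : Fin 4) (x : Mink) : Fin N → ℂ :=
  fun a => F μ ν a x

/-- The values of the potentials in a configuration. -/
def fieldA (c : Mink → ℝ) (F : Fin 4 → Fin 4 → Fin N → Mink → ℂ) (μ : Fin 4) (x : Mink) :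
    Fin N → ℂ :=
  fun a => strA c F μ a x

/-- The values of the field `w` in a configuration. -/
def fieldW (b : Mink → Fin 4 → ℝ) (F : Fin 4 → Fin 4 → Fin N → Mink → ℂ) (x : Mink) : Fin N → ℂ :=
  fun a => strW b F a x

/-- The current `i[F_{κν}, A^ν]`, with raised index. -/
def current (f : Fin N → Fin N → Fin N → ℝ) (c : Mink → ℝ)
    (F : Fin 4 → Fin 4 → Fin N → Mink → ℂ) (κ : Fin 4) (x : Mink) : Fin N → ℂ :=
  ∑ ν, (eta κ κ * eta ν ν : ℂ) • ibrL f (fieldF F κ ν x) (fieldA c F ν x)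

/-- Smooth functions with values in the Lie algebra. -/
def IsSmooth (X : Mink → Fin N → ℂ) : Prop := ∀ a, ContDiff ℝ ∞ fun x => X x a

lemma IsSmooth.ibrL {X Y : Mink → Fin N → ℂ} (hX : IsSmooth X) (hY : IsSmooth Y)
    (f : Fin N → Fin N → Fin N → ℝ) : IsSmooth fun x => ibrL f (X x) (Y x) := by
  intro d
  refine ContDiff.neg (ContDiff.sum fun a _ => ContDiff.sum fun b _ => ?_)
  exact contDiff_const.mul ((hX a).mul (hY b))

lemma IsSmooth.sum_smul {ι : Type*} (s : Finset ι) (k : ι → ℂ) {X : ι → Mink → Fin N → ℂ}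
    (hX : ∀ i, IsSmooth (X i)) : IsSmooth fun x => ∑ i ∈ s, k i • X i x := by
  intro a
  simp only [Finset.sum_apply, Pi.smul_apply, smul_eq_mul]
  exact ContDiff.sum fun i _ => contDiff_const.mul (hX i a)

lemma IsMaxwell.isSmooth_fieldF {F : Fin 4 → Fin 4 → Fin N → Mink → ℂ} (hF : IsMaxwell F)
    (μ ν : Fin 4) : IsSmooth (fieldF F μ ν) := fun a => hF.smooth μ ν a

lemma IsMaxwell.isSmooth_fieldA {F : Fin 4 → Fin 4 → Fin N → Mink → ℂ} (hF : IsMaxwell F)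
    {c : Mink → ℝ} (hc : IsSmearing c) (μ : Fin 4) : IsSmooth (fieldA c F μ) :=
  fun a => contDiff_strA hc.smooth.continuous hc.compact hF μ a

lemma IsMaxwell.isSmooth_fieldW {F : Fin 4 → Fin 4 → Fin N → Mink → ℂ} (hF : IsMaxwell F)
    {b : Mink → Fin 4 → ℝ} {δc : Mink → ℝ} (hb : IsVariation b δc) : IsSmooth (fieldW b F) :=
  fun a => contDiff_strW hb.smooth_b.continuous hb.compact_b hF a

lemma IsMaxwell.isSmooth_current {F : Fin 4 → Fin 4 → Fin N → Mink → ℂ} (hF : IsMaxwell F)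
    {c : Mink → ℝ} (hc : IsSmearing c) (f : Fin N → Fin N → Fin N → ℝ) (κ : Fin 4) :
    IsSmooth (current f c F κ) :=
  IsSmooth.sum_smul _ _ fun ν => (hF.isSmooth_fieldF κ ν).ibrL (hF.isSmooth_fieldA hc ν) f

lemma isTest_vertex {p l : Mink → ℂ} (hp : ContDiff ℝ ∞ p) (hl : ContDiff ℝ ∞ l)
    {g : Mink × Mink → ℂ} (hg : IsTest g) : IsTest fun q : Mink × Mink => p q.1 * l q.2 * g q :=
  hg.mul_left ((hp.comp contDiff_fst).mul (hl.comp contDiff_snd))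

lemma fieldF_antisymm {F : Fin 4 → Fin 4 → Fin N → Mink → ℂ} (hF : IsMaxwell F) (μ ν : Fin 4)
    (x : Mink) : fieldF F μ ν x = -fieldF F ν μ x :=
  funext fun a => hF.antisymm μ ν a x

lemma sum_three_comm {ι₁ ι₂ ι₃ ι₄ : Type*} [Fintype ι₁] [Fintype ι₂] [Fintype ι₃] [Fintype ι₄]
    (E : ι₁ → ι₂ → ι₃ → ι₄ → ℂ) :
    ∑ i, ∑ j, ∑ k, ∑ l, E i j k l = ∑ l, ∑ i, ∑ j, ∑ k, E i j k l :=
  (Finset.sum_congr rfl fun _ _ => (Finset.sum_congr rfl fun _ _ => Finset.sum_comm).trans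
    Finset.sum_comm).trans Finset.sum_comm

section

variable {f : Fin N → Fin N → Fin N → ℝ} (hf : IsStructureConstants f)
  {b : Mink → Fin 4 → ℝ} {δc : Mink → ℝ} {F : Fin 4 → Fin 4 → Fin N → Mink → ℂ}
  {g : Mink × Mink → ℂ}

/-- The contribution of `∂Q₁/∂F` and `∂L₁/∂F`. -/
lemma sum_divF_F (hf : IsStructureConstants f) (hc : IsSmearing c) (hb : IsVariation b δc)
    (hF : IsMaxwell F) (hg : IsTest g) (a : Fin N) :
    ∑ κ, ∑ ρ, -∑ ν, (eta ν ν : ℂ) * ∫ x', divF cF c ν (fF κ ρ) (fun ξ =>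
      ibrL f (fieldW b F (x' + ξ)) (fieldA c F ν (x' + ξ)) a *
        ((1 / 2) * (eta κ κ * eta ρ ρ : ℂ) * ibrL f (fieldA c F κ x') (fieldA c F ρ x') a) *
        g (x' + ξ, x')) =
    Complex.I * (1 + cF) * ∑ κ, ∑ ρ, (eta κ κ * eta ρ ρ : ℂ) * diagPair (pd1 ρ fun p =>
      ibrL f (fieldW b F p.1) (fieldA c F κ p.1) a *
        ibrL f (fieldA c F κ p.2) (fieldA c F ρ p.2) a * g p) := by
  have hA := fun μ => hF.isSmooth_fieldA hc μ
  have hW := hF.isSmooth_fieldW hb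
  set G : Fin 4 → Fin 4 → Fin 4 → Mink × Mink → ℂ := fun ν κ ρ p =>
    ibrL f (fieldW b F p.1) (fieldA c F ν p.1) a *
      ibrL f (fieldA c F κ p.2) (fieldA c F ρ p.2) a * g p with hGdef
  have hG : ∀ ν κ ρ, IsTest (G ν κ ρ) := fun ν κ ρ =>
    isTest_vertex (hW.ibrL (hA ν) f a) ((hA κ).ibrL (hA ρ) f a) hg
  set X : Fin 4 → Fin 4 → Fin 4 → Fin 4 → ℂ := fun σ ν κ ρ => diagPair (pd1 σ (G ν κ ρ)) with hX
  have hXs : ∀ σ ν κ ρ, X σ ν κ ρ = -X σ ν ρ κ := by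
    intro σ ν κ ρ
    have : G ν κ ρ = fun p => (-1) * G ν ρ κ p := by
      funext p
      simp only [hGdef]
      rw [ibrL_antisymm hf (fieldA c F κ p.2)]
      simp
    simp only [hX]
    rw [this, pd1_const_mul _ (hG ν ρ κ).differentiable, diagPair_const_mul]
    ring
  have h1 : ∀ κ ρ, -∑ ν, (eta ν ν : ℂ) * ∫ x', divF cF c ν (fF κ ρ) (fun ξ =>
      ibrL f (fieldW b F (x' + ξ)) (fieldA c F ν (x' + ξ)) a *
        ((1 / 2) * (eta κ κ * eta ρ ρ : ℂ) * ibrL f (fieldA c F κ x') (fieldA c F ρ x') a) *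
        g (x' + ξ, x')) =
      Complex.I * (1 + cF) * ((1 / 2) * ((eta κ κ * eta ρ ρ : ℂ) * X ρ κ κ ρ) +
        (1 / 2) * ((eta ρ ρ * eta κ κ : ℂ) * X κ ρ ρ κ)) := by
    intro κ ρ
    have e1 : ∀ ν, ∫ x', divF cF c ν (fF κ ρ) (fun ξ =>
      ibrL f (fieldW b F (x' + ξ)) (fieldA c F ν (x' + ξ)) a *
        ((1 / 2) * (eta κ κ * eta ρ ρ : ℂ) * ibrL f (fieldA c F κ x') (fieldA c F ρ x') a) *
        g (x' + ξ, x')) = ((1 / 2) * (eta κ κ * eta ρ ρ : ℂ)) * (-Complex.I * (1 + cF) *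
          (eta ν κ * X ρ ν κ ρ - eta ν ρ * X κ ν κ ρ)) := by
      intro ν
      rw [← integral_divF_F cF ν κ ρ (hG ν κ ρ), ← integral_divF_const_mul cF hc ν _ _ (hG ν κ ρ)]
      congr 1
      funext x'
      congr 1
      funext ξ
      simp only [hGdef]
      ring
    simp only [e1]
    have e2 := sum_eta_eta_mul κ fun ν => X ρ ν κ ρ
    have e3 := sum_eta_eta_mul ρ fun ν => X κ ν κ ρ
    have e4 : ∑ ν, (eta ν ν : ℂ) * (((1 / 2) * (eta κ κ * eta ρ ρ : ℂ)) * (-Complex.I * (1 + cF) *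
        (eta ν κ * X ρ ν κ ρ - eta ν ρ * X κ ν κ ρ))) =
        (-Complex.I * (1 + cF) * ((1 / 2) * (eta κ κ * eta ρ ρ : ℂ))) *
          (X ρ κ κ ρ - X κ ρ κ ρ) := by
      rw [← e2, ← e3, ← Finset.sum_sub_distrib, Finset.mul_sum]
      refine Finset.sum_congr rfl fun ν _ => ?_
      ring
    rw [e4, hXs κ ρ ρ κ]
    ring
  simp only [h1, ← Finset.mul_sum, Finset.sum_add_distrib]
  -- The two halves differ by relabelling κ and ρ, so together they cancel the ½ from ∂L₁/∂F.
  rw [Finset.sum_comm (f := fun κ ρ => (eta ρ ρ * eta κ κ : ℂ) * X κ ρ ρ κ)]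
  ring

/-- The contribution of `∂Q₁/∂F` and `∂L₁/∂A`. -/
lemma sum_divF_A (hc : IsSmearing c) (hb : IsVariation b δc)
    (hF : IsMaxwell F) (hg : IsTest g) (a : Fin N) (κ : Fin 4) :
    -∑ ν, (eta ν ν : ℂ) * ∫ x', divF cF c ν (fA κ) (fun ξ =>
      ibrL f (fieldW b F (x' + ξ)) (fieldA c F ν (x' + ξ)) a * (-current f c F κ x' a) *
        g (x' + ξ, x')) =
    Complex.I * diagPair (fun p => ibrL f (fieldW b F p.1) (fieldA c F κ p.1) a *
        current f c F κ p.2 a * g p) +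
      Complex.I * ∑ ν, strPair (fun e => c e * e ν) (pd1 κ fun p =>
        ibrL f (fieldW b F p.1) (fieldA c F ν p.1) a * current f c F κ p.2 a * g p) := by
  set G : Fin 4 → Mink × Mink → ℂ := fun ν p =>
    ibrL f (fieldW b F p.1) (fieldA c F ν p.1) a * current f c F κ p.2 a * g p with hGdef
  have hG : ∀ ν, IsTest (G ν) := fun ν =>
    isTest_vertex ((hF.isSmooth_fieldW hb).ibrL (hF.isSmooth_fieldA hc ν) f a)
      (hF.isSmooth_current hc f κ a) hg
  have e1 : ∀ ν, ∫ x', divF cF c ν (fA κ) (fun ξ =>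
      ibrL f (fieldW b F (x' + ξ)) (fieldA c F ν (x' + ξ)) a * (-current f c F κ x' a) *
        g (x' + ξ, x')) = (-1) * (Complex.I * (eta ν κ * diagPair (G ν) +
          eta ν ν * strPair (fun e => c e * e ν) (pd1 κ (G ν)))) := by
    intro ν
    rw [← integral_divF_A cF hc ν κ (hG ν), ← integral_divF_const_mul cF hc ν _ _ (hG ν)]
    congr 1
    funext x'
    congr 1
    funext ξ
    simp only [hGdef]
    ring
  simp only [e1]
  rw [← sum_eta_eta_mul κ fun ν => diagPair (G ν), Finset.mul_sum, Finset.mul_sum,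
    ← Finset.sum_neg_distrib, ← Finset.sum_add_distrib]
  refine Finset.sum_congr rfl fun ν _ => ?_
  linear_combination (Complex.I * strPair (fun e => c e * e ν) (pd1 κ (G ν))) *
    eta_mul_self_complex ν

/-- The contribution of `∂Q₁/∂A` and `∂L₁/∂F`. -/
lemma sum_twoPointObs_A_F (hf : IsStructureConstants f) (hc : IsSmearing c) (hb : IsVariation b δc)
    (hF : IsMaxwell F) (hg : IsTest g) (a : Fin N) (μ ν : Fin 4) :
    ∑ κ, ∑ ρ, ∫ x', twoPointObs cF c b μ (some (fA ν)) (fF κ ρ) (fun ξ =>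
      (eta μ μ * eta ν ν : ℂ) * ibrL f (fieldF F μ ν (x' + ξ)) (fieldW b F (x' + ξ)) a *
        ((1 / 2) * (eta κ κ * eta ρ ρ : ℂ) * ibrL f (fieldA c F κ x') (fieldA c F ρ x') a) *
        g (x' + ξ, x')) =
    -(cF * Complex.I / 2) * ((eta μ μ * eta ν ν : ℂ) * diagPair (fun p =>
      ibrL f (fieldF F μ ν p.1) (fieldW b F p.1) a *
        ibrL f (fieldA c F μ p.2) (fieldA c F ν p.2) a * g p)) := by
  by_cases hμν : μ = ν
  · subst hμν
    have h0 : ∀ x, fieldF F μ μ x = 0 := fun x => self_eq_neg.1 (fieldF_antisymm hF μ μ x)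
    simp [h0, twoPointObs_A_zero, diagPair]
  have hA := fun μ => hF.isSmooth_fieldA hc μ
  have hW := hF.isSmooth_fieldW hb
  set G : Fin 4 → Fin 4 → Mink × Mink → ℂ := fun κ ρ p =>
    ibrL f (fieldF F μ ν p.1) (fieldW b F p.1) a *
      ibrL f (fieldA c F κ p.2) (fieldA c F ρ p.2) a * g p with hGdef
  have hG : ∀ κ ρ, IsTest (G κ ρ) := fun κ ρ =>
    isTest_vertex ((hF.isSmooth_fieldF μ ν).ibrL hW f a) ((hA κ).ibrL (hA ρ) f a) hg
  have hGs : diagPair (G ν μ) = -diagPair (G μ ν) := by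
    have : G ν μ = fun p => (-1) * G μ ν p := by
      funext p
      simp only [hGdef]
      rw [ibrL_antisymm hf (fieldA c F ν p.2)]
      simp
    rw [this, diagPair_const_mul]
    ring
  have e1 : ∀ κ ρ, ∫ x', twoPointObs cF c b μ (some (fA ν)) (fF κ ρ) (fun ξ =>
      (eta μ μ * eta ν ν : ℂ) * ibrL f (fieldF F μ ν (x' + ξ)) (fieldW b F (x' + ξ)) a *
        ((1 / 2) * (eta κ κ * eta ρ ρ : ℂ) * ibrL f (fieldA c F κ x') (fieldA c F ρ x') a) *
        g (x' + ξ, x')) = eta μ κ * (eta ν ρ * (-(cF * Complex.I / 4) * (eta μ μ * eta ν ν) *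
          (eta κ κ * eta ρ ρ) * diagPair (G κ ρ))) -
          eta ν κ * (eta μ ρ * (-(cF * Complex.I / 4) * (eta μ μ * eta ν ν) *
          (eta κ κ * eta ρ ρ) * diagPair (G κ ρ))) := by
    intro κ ρ
    have e2 : ∀ x', twoPointObs cF c b μ (some (fA ν)) (fF κ ρ) (fun ξ =>
      (eta μ μ * eta ν ν : ℂ) * ibrL f (fieldF F μ ν (x' + ξ)) (fieldW b F (x' + ξ)) a *
        ((1 / 2) * (eta κ κ * eta ρ ρ : ℂ) * ibrL f (fieldA c F κ x') (fieldA c F ρ x') a) *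
        g (x' + ξ, x')) = (-(cF * Complex.I / 2) * (eta μ κ * eta ρ ν - eta μ ρ * eta κ ν) *
          ((1 / 2) * (eta μ μ * eta ν ν) * (eta κ κ * eta ρ ρ))) * G κ ρ (x', x') := by
      intro x'
      have ht : IsTest fun ξ => (eta μ μ * eta ν ν : ℂ) *
        ibrL f (fieldF F μ ν (x' + ξ)) (fieldW b F (x' + ξ)) a *
        ((1 / 2) * (eta κ κ * eta ρ ρ : ℂ) * ibrL f (fieldA c F κ x') (fieldA c F ρ x') a) *
        g (x' + ξ, x') := by
        have := ((hG κ ρ).fiber x').mul_left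
          (p := fun _ => ((1 / 2) * (eta μ μ * eta ν ν) * (eta κ κ * eta ρ ρ) : ℂ)) contDiff_const
        convert this using 1
        funext ξ
        simp only [hGdef]
        ring
      rw [twoPointObs_A_F cF c b hμν κ ρ ht]
      simp only [hGdef, add_zero]
      ring
    simp only [e2]
    rw [integral_const_mul, eta_comm ρ ν, eta_comm κ ν]
    change _ * diagPair (G κ ρ) = _
    ring
  simp only [e1, Finset.sum_sub_distrib, ← Finset.mul_sum]
  rw [Finset.sum_congr rfl fun κ _ => by rw [sum_eta_mul ν], sum_eta_mul μ,
    Finset.sum_congr rfl fun κ _ => by rw [sum_eta_mul μ], sum_eta_mul ν, hGs]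
  linear_combination (-(cF * Complex.I / 2) * (eta μ μ * eta ν ν) * (eta ν ν * eta ν ν) * diagPair (G μ ν)) * eta_mul_self_complex μ + (-(cF * Complex.I / 2) * (eta μ μ * eta ν ν) * diagPair (G μ ν)) * eta_mul_self_complex ν

end

end IntegratedObstructions

/-! ### The obstruction as a sum of pairings, and the conserved current. -/

section Currents

variable {N : ℕ} {f : Fin N → Fin N → Fin N → ℝ} {c : Mink → ℝ} {b : Mink → Fin 4 → ℝ}
  {δc : Mink → ℝ} {F : Fin 4 → Fin 4 → Fin N → Mink → ℂ} {g : Mink × Mink → ℂ}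

/-- The obstruction in terms of the local and the string-localized pairings. -/
lemma obstruction_eq (cF : ℂ) (hf : IsStructureConstants f) (hc : IsSmearing c)
    (hb : IsVariation b δc) (hF : IsMaxwell F) (hg : IsTest g) :
    obstruction cF c b F (Q1 f) (L1 f) g =
      Complex.I * (1 + cF) * ∑ a, ∑ κ, ∑ ρ, (eta κ κ * eta ρ ρ : ℂ) * diagPair (pd1 ρ fun p =>
        ibrL f (fieldW b F p.1) (fieldA c F κ p.1) a *
          ibrL f (fieldA c F κ p.2) (fieldA c F ρ p.2) a * g p) +
      Complex.I * ∑ a, ∑ κ, diagPair (fun p => ibrL f (fieldW b F p.1) (fieldA c F κ p.1) a *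
        current f c F κ p.2 a * g p) +
      Complex.I * ∑ a, ∑ κ, ∑ ν, strPair (fun e => c e * e ν) (pd1 κ fun p =>
        ibrL f (fieldW b F p.1) (fieldA c F ν p.1) a * current f c F κ p.2 a * g p) -
      (cF * Complex.I / 2) * ∑ a, ∑ μ, ∑ ν, (eta μ μ * eta ν ν : ℂ) * diagPair (fun p =>
        ibrL f (fieldF F μ ν p.1) (fieldW b F p.1) a *
          ibrL f (fieldA c F μ p.2) (fieldA c F ν p.2) a * g p) := by
  have hA := fun μ => hF.isSmooth_fieldA hc μ
  have hW := hF.isSmooth_fieldW hb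
  have vF : ∀ κ ρ a x', MvPolynomial.eval (valG c F x')
      (MvPolynomial.pderiv (fF κ ρ, a) (L1 f)) = (1 / 2) * (eta κ κ * eta ρ ρ : ℂ) *
        ibrL f (fieldA c F κ x') (fieldA c F ρ x') a :=
    fun κ ρ a x' => eval_pderiv_L1_F f (valG c F x') κ ρ a
  have vA : ∀ κ a x', MvPolynomial.eval (valG c F x')
      (MvPolynomial.pderiv (fA κ, a) (L1 f)) = -current f c F κ x' a := by
    intro κ a x'
    have h := eval_pderiv_L1_A hf (valG c F x')
      (fun μ ν => fieldF_antisymm hF μ ν x') κ a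
    rw [h, current, Finset.sum_apply]
    rfl
  have qF : ∀ μ ρ ν a x, MvPolynomial.eval (valGW c b F x)
      (MvPolynomial.pderiv (some (fF ρ ν), a) (Q1 f μ)) =
      (if μ = ρ then (eta μ μ * eta ν ν : ℂ) else 0) *
        ibrL f (fieldW b F x) (fieldA c F ν x) a := by
    intro μ ρ ν a x
    rw [ite_mul, zero_mul]
    exact eval_pderiv_Q1_F f (valGW c b F x) μ ρ ν a
  have qA : ∀ μ ν a x, MvPolynomial.eval (valGW c b F x)
      (MvPolynomial.pderiv (some (fA ν), a) (Q1 f μ)) =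
      (eta μ μ * eta ν ν : ℂ) * ibrL f (fieldF F μ ν x) (fieldW b F x) a :=
    fun μ ν a x => eval_pderiv_Q1_A hf (valGW c b F x) μ ν a
  have vs : ∀ χ a, ContDiff ℝ ∞ fun x' =>
      MvPolynomial.eval (valG c F x') (MvPolynomial.pderiv (χ, a) (L1 f)) := by
    intro χ a
    rcases χ with ⟨κ, ρ⟩ | κ
    · simp only [vF]
      exact contDiff_const.mul ((hA κ).ibrL (hA ρ) f a)
    · simp only [vA]
      exact (hF.isSmooth_current hc f κ a).neg
  set E : Fin 4 → GluonW → Gluon → Fin N → ℂ := fun μ φ χ a => mulDist (fun x x' =>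
    MvPolynomial.eval (valGW c b F x) (MvPolynomial.pderiv (φ, a) (Q1 f μ)) *
      MvPolynomial.eval (valG c F x') (MvPolynomial.pderiv (χ, a) (L1 f)))
      (twoPointObs cF c b μ φ χ) g with hE
  have hO : obstruction cF c b F (Q1 f) (L1 f) g = ∑ μ, ∑ φ, ∑ χ, ∑ a, E μ φ χ a := by
    simp only [obstruction, Finset.sum_apply, hE]
  have E0 : ∀ μ χ a, E μ none χ a = 0 := by
    intro μ χ a
    simp only [hE, twoPointObs_w]
    simp [mulDist]
  have EF : ∀ χ a, ∑ μ, ∑ ρ, ∑ ν, E μ (some (fF ρ ν)) χ a =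
      -∑ ν, (eta ν ν : ℂ) * ∫ x', divF cF c ν χ (fun ξ =>
        ibrL f (fieldW b F (x' + ξ)) (fieldA c F ν (x' + ξ)) a *
        MvPolynomial.eval (valG c F x') (MvPolynomial.pderiv (χ, a) (L1 f)) * g (x' + ξ, x')) := by
    intro χ a
    rw [← sum_twoPointObs_F cF hc b χ (G := fun ν p =>
        ibrL f (fieldW b F p.1) (fieldA c F ν p.1) a *
        MvPolynomial.eval (valG c F p.2) (MvPolynomial.pderiv (χ, a) (L1 f)) * g p)
      fun ν => isTest_vertex (hW.ibrL (hA ν) f a) (vs χ a) hg]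
    refine Finset.sum_congr rfl fun μ _ => Finset.sum_congr rfl fun ρ _ =>
      Finset.sum_congr rfl fun ν _ => ?_
    simp only [hE, mulDist, qF, mul_assoc]
  have EAA : ∀ μ ν κ a, E μ (some (fA ν)) (fA κ) a = 0 := by
    intro μ ν κ a
    simp only [hE, mulDist, qA, vA]
    by_cases hμν : μ = ν
    · subst hμν
      have h0 : ∀ x, fieldF F μ μ x = 0 := fun x => self_eq_neg.1 (fieldF_antisymm hF μ μ x)
      simp [h0, twoPointObs_A_zero]
    · have ht : ∀ x', IsTest fun ξ => (eta μ μ * eta ν ν : ℂ) *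
          ibrL f (fieldF F μ ν (x' + ξ)) (fieldW b F (x' + ξ)) a * -current f c F κ x' a *
          g (x' + ξ, x') := fun x' =>
        (isTest_vertex (contDiff_const.mul ((hF.isSmooth_fieldF μ ν).ibrL hW f a))
          (hF.isSmooth_current hc f κ a).neg hg).fiber x'
      simp only [fun x' => twoPointObs_A_A cF c b hμν κ (ht x'), integral_zero]
  have EAF : ∀ μ ν a, ∑ κ, ∑ ρ, E μ (some (fA ν)) (fF κ ρ) a =
      -(cF * Complex.I / 2) * ((eta μ μ * eta ν ν : ℂ) * diagPair (fun p =>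
      ibrL f (fieldF F μ ν p.1) (fieldW b F p.1) a *
        ibrL f (fieldA c F μ p.2) (fieldA c F ν p.2) a * g p)) := by
    intro μ ν a
    rw [← sum_twoPointObs_A_F cF hf hc hb hF hg a μ ν]
    simp only [hE, mulDist, qA, vF]
  have s1 : ∑ μ, ∑ φ, ∑ χ, ∑ a, E μ φ χ a =
      ∑ a, ∑ χ, ∑ μ, ∑ ρ, ∑ ν, E μ (some (fF ρ ν)) χ a +
        ∑ a, ∑ μ, ∑ ν, ∑ χ, E μ (some (fA ν)) χ a := by
    have e1 : ∀ μ, ∑ φ, ∑ χ, ∑ a, E μ φ χ a = ∑ ρ, ∑ ν, ∑ χ, ∑ a, E μ (some (fF ρ ν)) χ a +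
        ∑ ν, ∑ χ, ∑ a, E μ (some (fA ν)) χ a := by
      intro μ
      simp only [Fintype.sum_option, E0, Finset.sum_const_zero, zero_add]
      rw [Fintype.sum_sum_type, Fintype.sum_prod_type]
    simp only [e1, Finset.sum_add_distrib]
    congr 1
    · rw [sum_three_comm]
      refine (Finset.sum_congr rfl fun χ _ => ?_).trans Finset.sum_comm
      exact sum_three_comm fun μ ρ ν a => E μ (some (fF ρ ν)) χ a
    · rw [Finset.sum_congr rfl fun μ _ => Finset.sum_congr rfl fun ν _ =>
        Finset.sum_comm (f := fun χ a => E μ (some (fA ν)) χ a)]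
      exact (Finset.sum_congr rfl fun μ _ => Finset.sum_comm).trans Finset.sum_comm
  have s2 : ∀ a, ∑ χ, ∑ μ, ∑ ρ, ∑ ν, E μ (some (fF ρ ν)) χ a =
      Complex.I * (1 + cF) * (∑ κ, ∑ ρ, (eta κ κ * eta ρ ρ : ℂ) * diagPair (pd1 ρ fun p =>
        ibrL f (fieldW b F p.1) (fieldA c F κ p.1) a *
          ibrL f (fieldA c F κ p.2) (fieldA c F ρ p.2) a * g p)) +
      (Complex.I * (∑ κ, diagPair (fun p => ibrL f (fieldW b F p.1) (fieldA c F κ p.1) a *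
        current f c F κ p.2 a * g p)) +
      Complex.I * (∑ κ, ∑ ν, strPair (fun e => c e * e ν) (pd1 κ fun p =>
        ibrL f (fieldW b F p.1) (fieldA c F ν p.1) a * current f c F κ p.2 a * g p))) := by
    intro a
    rw [Fintype.sum_sum_type, Fintype.sum_prod_type]
    simp only [EF]
    congr 1
    · rw [← sum_divF_F cF hf hc hb hF hg a]
      simp only [vF]
    · rw [Finset.mul_sum, Finset.mul_sum, ← Finset.sum_add_distrib]
      refine Finset.sum_congr rfl fun κ _ => ?_
      rw [← sum_divF_A cF hc hb hF hg a κ]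
      simp only [vA]
  have s3 : ∀ a μ ν, ∑ χ, E μ (some (fA ν)) χ a = -(cF * Complex.I / 2) *
      ((eta μ μ * eta ν ν : ℂ) * diagPair (fun p =>
        ibrL f (fieldF F μ ν p.1) (fieldW b F p.1) a *
          ibrL f (fieldA c F μ p.2) (fieldA c F ν p.2) a * g p)) := by
    intro a μ ν
    rw [Fintype.sum_sum_type, Fintype.sum_prod_type, EAF]
    simp only [EAA, Finset.sum_const_zero, add_zero]
  rw [hO, s1]
  simp only [s2, s3, Finset.sum_add_distrib, ← Finset.mul_sum]
  ring

/-- The componentwise partial derivative. -/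
def pdV (μ : Fin 4) (X : Mink → Fin N → ℂ) (x : Mink) : Fin N → ℂ :=
  fun a => pd μ (fun y => X y a) x

lemma IsSmooth.pdV {X : Mink → Fin N → ℂ} (hX : IsSmooth X) (μ : Fin 4) : IsSmooth (pdV μ X) :=
  fun a => contDiff_pd (hX a) μ

lemma hasDerivAt_ibrL (f : Fin N → Fin N → Fin N → ℝ) {X Y : ℝ → Fin N → ℂ} {X' Y' : Fin N → ℂ}
    {t : ℝ} (hX : ∀ a, HasDerivAt (fun s => X s a) (X' a) t)
    (hY : ∀ a, HasDerivAt (fun s => Y s a) (Y' a) t) (d : Fin N) :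
    HasDerivAt (fun s => ibrL f (X s) (Y s) d) ((ibrL f X' (Y t) + ibrL f (X t) Y') d) t := by
  have h : HasDerivAt (fun s => ibrL f (X s) (Y s) d) (-∑ a, ∑ b, (f a b d : ℂ) •
      (X' a * Y t b + X t a * Y' b)) t :=
    (HasDerivAt.fun_sum fun a _ => HasDerivAt.fun_sum fun b _ =>
      (((hX a).mul (hY b)).const_smul (f a b d : ℂ))).neg
  refine h.congr_deriv ?_
  rw [Pi.add_apply, ← ibr_eq, ← ibr_eq]
  simp only [ibr, smul_add, Finset.sum_add_distrib, neg_add]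

lemma hasDerivAt_ipL {X Y : ℝ → Fin N → ℂ} {X' Y' : Fin N → ℂ}
    {t : ℝ} (hX : ∀ a, HasDerivAt (fun s => X s a) (X' a) t)
    (hY : ∀ a, HasDerivAt (fun s => Y s a) (Y' a) t) :
    HasDerivAt (fun s => ipL N (X s) (Y s)) (ipL N X' (Y t) + ipL N (X t) Y') t := by
  have h : HasDerivAt (fun s => ∑ a, X s a * Y s a) (∑ a, (X' a * Y t a + X t a * Y' a)) t :=
    HasDerivAt.fun_sum fun a _ => (hX a).mul (hY a)
  refine h.congr_deriv ?_
  rw [← ip_eq, ← ip_eq]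
  simp only [ip, Finset.sum_add_distrib]

lemma hasDerivAt_line {h : Mink → ℂ} (hh : ContDiff ℝ ∞ h) (μ : Fin 4) (x : Mink) :
    HasDerivAt (fun t : ℝ => h (x + t • Pi.single μ 1)) (pd μ h x) 0 :=
  (hh.differentiable (by simp) x).hasFDerivAt.hasLineDerivAt _

lemma IsSmooth.ipL {X Y : Mink → Fin N → ℂ} (hX : IsSmooth X) (hY : IsSmooth Y) :
    ContDiff ℝ ∞ fun x => ipL N (X x) (Y x) :=
  show ContDiff ℝ ∞ fun x => ∑ a, X x a * Y x a from ContDiff.sum fun a _ => (hX a).mul (hY a)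

lemma pdV_ibrL {X Y : Mink → Fin N → ℂ} (hX : IsSmooth X) (hY : IsSmooth Y) (μ : Fin 4)
    (x : Mink) : pdV μ (fun y => ibrL f (X y) (Y y)) x =
      ibrL f (pdV μ X x) (Y x) + ibrL f (X x) (pdV μ Y x) := by
  funext d
  refine (hasDerivAt_line (hX.ibrL hY f d) μ x).unique ?_
  have h := hasDerivAt_ibrL f (fun a => hasDerivAt_line (hX a) μ x)
    (fun a => hasDerivAt_line (hY a) μ x) d
  rw [zero_smul, add_zero] at h
  exact h

lemma pd_ipL {X Y : Mink → Fin N → ℂ} (hX : IsSmooth X) (hY : IsSmooth Y) (μ : Fin 4)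
    (x : Mink) : pd μ (fun y => ipL N (X y) (Y y)) x =
      ipL N (pdV μ X x) (Y x) + ipL N (X x) (pdV μ Y x) := by
  refine (hasDerivAt_line (hX.ipL hY) μ x).unique ?_
  have h := hasDerivAt_ipL (fun a => hasDerivAt_line (hX a) μ x)
    (fun a => hasDerivAt_line (hY a) μ x)
  rw [zero_smul, add_zero] at h
  exact h

lemma pdV_sum_smul {ι : Type*} (s : Finset ι) (k : ι → ℂ) {X : ι → Mink → Fin N → ℂ}
    (hX : ∀ i, IsSmooth (X i)) (μ : Fin 4) (x : Mink) :
    pdV μ (fun y => ∑ i ∈ s, k i • X i y) x = ∑ i ∈ s, k i • pdV μ (X i) x := by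
  funext a
  have h : HasDerivAt (fun t : ℝ => ∑ i ∈ s, k i * X i (x + t • Pi.single μ 1) a)
      (∑ i ∈ s, k i * pd μ (fun y => X i y a) x) 0 :=
    HasDerivAt.fun_sum fun i _ => (hasDerivAt_line (hX i a) μ x).const_mul _
  have h' := hasDerivAt_line (IsSmooth.sum_smul s k hX a) μ x
  simp only [Finset.sum_apply, Pi.smul_apply, smul_eq_mul] at h' ⊢
  have h2 := h'.unique h
  simp only [pdV, Finset.sum_apply, Pi.smul_apply, smul_eq_mul]
  exact h2

lemma curl_fieldA (hc : IsSmearing c) (hF : IsMaxwell F) (μ ν : Fin 4) (x : Mink) :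
    pdV μ (fieldA c F ν) x - pdV ν (fieldA c F μ) x = fieldF F μ ν x :=
  funext fun a => curl_strA hc hF μ ν a x

lemma divergence_fieldF (hF : IsMaxwell F) (ν : Fin 4) (x : Mink) :
    ∑ μ, (eta μ μ : ℂ) • pdV μ (fieldF F μ ν) x = 0 := by
  funext a
  rw [Finset.sum_apply, Pi.zero_apply, ← hF.divergence ν a x]
  refine Finset.sum_congr rfl fun μ _ => ?_
  rw [sum_eta_smul μ fun ρ => pd μ (F ρ ν a) x]
  rfl

/-- The current is conserved. -/
lemma divergence_current (hf : IsStructureConstants f) (hc : IsSmearing c) (hF : IsMaxwell F)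
    (x : Mink) : ∑ κ, pdV κ (current f c F κ) x = 0 := by
  have hA := fun μ => hF.isSmooth_fieldA hc μ
  have h1 : ∀ κ, pdV κ (current f c F κ) x = ∑ ν, (eta κ κ * eta ν ν : ℂ) •
      (ibrL f (pdV κ (fieldF F κ ν) x) (fieldA c F ν x) +
        ibrL f (fieldF F κ ν x) (pdV κ (fieldA c F ν) x)) := by
    intro κ
    have e : current f c F κ = fun y => ∑ ν, (eta κ κ * eta ν ν : ℂ) •
      ibrL f (fieldF F κ ν y) (fieldA c F ν y) := rfl
    rw [e, pdV_sum_smul _ _ fun ν => (hF.isSmooth_fieldF κ ν).ibrL (hA ν) f]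
    refine Finset.sum_congr rfl fun ν _ => ?_
    rw [pdV_ibrL (hF.isSmooth_fieldF κ ν) (hA ν)]
  simp only [h1, smul_add, Finset.sum_add_distrib]
  have h2 : ∑ κ, ∑ ν, (eta κ κ * eta ν ν : ℂ) •
      ibrL f (pdV κ (fieldF F κ ν) x) (fieldA c F ν x) = 0 := by
    rw [Finset.sum_comm]
    refine Finset.sum_eq_zero fun ν _ => ?_
    have : ∑ κ, (eta κ κ * eta ν ν : ℂ) • ibrL f (pdV κ (fieldF F κ ν) x) (fieldA c F ν x) =
        (eta ν ν : ℂ) • ibrL f (∑ κ, (eta κ κ : ℂ) • pdV κ (fieldF F κ ν) x) (fieldA c F ν x) := by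
      rw [map_sum, LinearMap.sum_apply, Finset.smul_sum]
      refine Finset.sum_congr rfl fun κ _ => ?_
      rw [map_smul, LinearMap.smul_apply, smul_smul, mul_comm]
    rw [this, divergence_fieldF hF, map_zero, LinearMap.zero_apply, smul_zero]
  have h3 : ∑ κ, ∑ ν, (eta κ κ * eta ν ν : ℂ) •
      ibrL f (fieldF F κ ν x) (pdV κ (fieldA c F ν) x) = 0 := by
    set S := ∑ κ, ∑ ν, (eta κ κ * eta ν ν : ℂ) •
      ibrL f (fieldF F κ ν x) (pdV κ (fieldA c F ν) x) with hS
    -- Antisymmetry of F replaces ∂_κA_ν by its curl, which is F_{κν} itself, and the bracket of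
    -- F_{κν} with itself vanishes.
    have h4 : S + S = 0 := by
      nth_rewrite 2 [hS]
      rw [Finset.sum_comm, hS, ← Finset.sum_add_distrib]
      refine Finset.sum_eq_zero fun κ _ => ?_
      rw [← Finset.sum_add_distrib]
      refine Finset.sum_eq_zero fun ν _ => ?_
      rw [fieldF_antisymm hF ν κ, map_neg, LinearMap.neg_apply, mul_comm (eta ν ν : ℂ), ← smul_add,
        ← sub_eq_add_neg, ← map_sub, curl_fieldA hc hF, ibrL_self hf, smul_zero]
    exact self_eq_neg.1 (eq_neg_of_add_eq_zero_left h4)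
  rw [h2, h3, add_zero]

lemma pd2_vertex (p : Mink → ℂ) {l : Mink → ℂ} (hl : ContDiff ℝ ∞ l) (hg : IsTest g)
    (μ : Fin 4) (q : Mink × Mink) : pd2 μ (fun q => p q.1 * l q.2 * g q) q =
      p q.1 * pd μ l q.2 * g q + p q.1 * l q.2 * pd2 μ g q := by
  have hg2 : Differentiable ℝ fun x => g (q.1, x) := hg.differentiable.comp (by fun_prop)
  have hl' : Differentiable ℝ fun x => p q.1 * l x := (hl.differentiable (by simp)).const_mul _
  have h := pd_mul hl' hg2 μ q.2
  have h' : pd μ (fun x => p q.1 * l x) q.2 = p q.1 * pd μ l q.2 := by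
    rw [pd, fderiv_const_mul (hl.differentiable (by simp) _)]
    rfl
  rw [h'] at h
  exact h

lemma pd1_vertex {p : Mink → ℂ} (l : Mink → ℂ) (hp : ContDiff ℝ ∞ p) (hg : IsTest g)
    (μ : Fin 4) (q : Mink × Mink) : pd1 μ (fun q => p q.1 * l q.2 * g q) q =
      pd μ p q.1 * l q.2 * g q + p q.1 * l q.2 * pd1 μ g q := by
  have e : pd1 μ (fun q => p q.1 * l q.2 * g q) q =
      pd2 μ (fun q => l q.1 * p q.2 * g (q.2, q.1)) (q.2, q.1) := by
    simp only [pd1, pd2, mul_comm (l _)]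
  rw [e, pd2_vertex l hp hg.swap]
  simp only [pd1, pd2]
  ring

/-- The string-localized part of the obstruction is the divergence of the one of `Q₂`. -/
lemma sum_strPair_current (hf : IsStructureConstants f) (hc : IsSmearing c)
    (hb : IsVariation b δc) (hF : IsMaxwell F) (hg : IsTest g) :
    ∑ a, ∑ κ, ∑ ν, strPair (fun e => c e * e ν) (pd1 κ fun p =>
        ibrL f (fieldW b F p.1) (fieldA c F ν p.1) a * current f c F κ p.2 a * g p) =
    -∑ κ, ∑ ν, strPair (fun e => c e * e ν) fun p =>
      ipL N (current f c F κ p.2) (ibrL f (fieldW b F p.1) (fieldA c F ν p.1)) * pd2 κ g p := by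
  have hP := fun ν => (hF.isSmooth_fieldW hb).ibrL (hF.isSmooth_fieldA hc ν) f
  have hJ := fun κ => hF.isSmooth_current hc f κ
  have hm : ∀ ν : Fin 4, Continuous fun e : Mink => c e * e ν := by
    intro ν
    have := hc.smooth.continuous
    fun_prop
  have hmc : ∀ ν : Fin 4, HasCompactSupport fun e : Mink => c e * e ν :=
    fun ν => hc.compact.mul_right
  set G : Fin N → Fin 4 → Fin 4 → Mink × Mink → ℂ := fun a κ ν p =>
    ibrL f (fieldW b F p.1) (fieldA c F ν p.1) a * current f c F κ p.2 a * g p with hGdef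
  have hG : ∀ a κ ν, IsTest (G a κ ν) := fun a κ ν => isTest_vertex (hP ν a) (hJ κ a) hg
  set H : Fin N → Fin 4 → Fin 4 → Mink × Mink → ℂ := fun a κ ν p =>
    ibrL f (fieldW b F p.1) (fieldA c F ν p.1) a * current f c F κ p.2 a * pd2 κ g p with hHdef
  have hH : ∀ a κ ν, IsTest (H a κ ν) := fun a κ ν => isTest_vertex (hP ν a) (hJ κ a) (hg.pd2 κ)
  have h1 : ∀ a ν, ∑ κ, strPair (fun e => c e * e ν) (pd1 κ (G a κ ν)) +
      ∑ κ, strPair (fun e => c e * e ν) (H a κ ν) = 0 := by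
    intro a ν
    -- Translation invariance trades the derivative at the first point for one at the second. There
    -- it acts on the current and on `g`; the sum over κ is taken under the pairing, so that
    -- conservation removes the first part.
    have h2 : ∑ κ, strPair (fun e => c e * e ν) (fun p => pd1 κ (G a κ ν) p + pd2 κ (G a κ ν) p)
        = 0 := Finset.sum_eq_zero fun κ _ => strPair_pd (hm ν) (hmc ν) (hG a κ ν) κ
    rw [← strPair_sum (hm ν) (hmc ν) _ fun κ => ((hG a κ ν).pd1 κ).add ((hG a κ ν).pd2 κ)] at h2
    rw [← strPair_sum (hm ν) (hmc ν) _ fun κ => (hG a κ ν).pd1 κ,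
      ← strPair_sum (hm ν) (hmc ν) _ fun κ => hH a κ ν,
      ← strPair_add (hm ν) (hmc ν) (IsTest.sum _ fun κ => (hG a κ ν).pd1 κ)
        (IsTest.sum _ fun κ => hH a κ ν), ← h2]
    congr 1
    funext p
    rw [Finset.sum_add_distrib]
    congr 1
    have h3 : ∀ κ, pd2 κ (G a κ ν) p = H a κ ν p +
        ibrL f (fieldW b F p.1) (fieldA c F ν p.1) a * pdV κ (current f c F κ) p.2 a * g p := by
      intro κ
      exact (pd2_vertex (fun x => ibrL f (fieldW b F x) (fieldA c F ν x) a) (hJ κ a) hg κ p).trans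
        (add_comm _ _)
    simp only [h3, Finset.sum_add_distrib, ← Finset.sum_mul, ← Finset.mul_sum]
    have h4 := congrFun (divergence_current hf hc hF p.2) a
    rw [Finset.sum_apply] at h4
    rw [h4]
    simp
  have h5 : ∀ κ ν, strPair (fun e => c e * e ν) (fun p => ipL N (current f c F κ p.2)
      (ibrL f (fieldW b F p.1) (fieldA c F ν p.1)) * pd2 κ g p) =
      ∑ a, strPair (fun e => c e * e ν) (H a κ ν) := by
    intro κ ν
    rw [← strPair_sum (hm ν) (hmc ν) _ fun a => hH a κ ν]
    congr 1
    funext p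
    rw [← ip_eq, ip, Finset.sum_mul]
    refine Finset.sum_congr rfl fun a _ => ?_
    rw [hHdef]
    ring
  simp only [h5]
  rw [eq_neg_iff_add_eq_zero]
  have h6 : ∑ κ, ∑ ν, ∑ a, strPair (fun e => c e * e ν) (H a κ ν) =
      ∑ a, ∑ κ, ∑ ν, strPair (fun e => c e * e ν) (H a κ ν) :=
    (Finset.sum_congr rfl fun _ _ => Finset.sum_comm).trans Finset.sum_comm
  rw [h6, ← Finset.sum_add_distrib]
  refine Finset.sum_eq_zero fun a _ => ?_
  rw [Finset.sum_comm, Finset.sum_comm (f := fun κ ν => strPair _ (H a κ ν)),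
    ← Finset.sum_add_distrib]
  exact Finset.sum_eq_zero fun ν _ => h1 a ν

end Currents

/-! ### The algebra of the local terms and the variation of L₂. -/

section LocalIdentities

variable {N : ℕ} {f : Fin N → Fin N → Fin N → ℝ} {c : Mink → ℝ} {b : Mink → Fin 4 → ℝ}
  {δc : Mink → ℝ} {F : Fin 4 → Fin 4 → Fin N → Mink → ℂ} {g : Mink × Mink → ℂ}

/-- The pointwise identity between the local terms. -/
lemma local_identity (hf : IsStructureConstants f) (cF : ℂ) (A : Fin 4 → Fin N → ℂ)
    (w : Fin N → ℂ) (dA : Fin 4 → Fin 4 → Fin N → ℂ) (dw : Fin 4 → Fin N → ℂ)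
    (G : Fin 4 → Fin 4 → Fin N → ℂ) (hG : ∀ μ ν, dA μ ν - dA ν μ = G μ ν) :
    Complex.I * (1 + cF) * ∑ κ, ∑ ρ, (eta κ κ * eta ρ ρ : ℂ) *
        (ipL N (ibrL f (A κ) (A ρ)) (ibrL f (dw ρ) (A κ) + ibrL f w (dA ρ κ)) -
          ipL N (ibrL f (dA ρ κ) (A ρ) + ibrL f (A κ) (dA ρ ρ)) (ibrL f w (A κ))) +
      2 * Complex.I * ∑ κ, ∑ ν, (eta κ κ * eta ν ν : ℂ) *
        ipL N (ibrL f (G κ ν) (A ν)) (ibrL f w (A κ)) -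
      cF * Complex.I * ∑ μ, ∑ ν, (eta μ μ * eta ν ν : ℂ) *
        ipL N (ibrL f (G μ ν) w) (ibrL f (A μ) (A ν)) =
    Complex.I * (-2 * (1 + cF) * ∑ μ, ∑ ν, (eta μ μ * eta ν ν : ℂ) *
        ipL N (ibrL f (A μ) (A ν)) (ibrL f (dw μ) (A ν))) +
      Complex.I * (1 + cF) * ∑ μ, ∑ ν, (eta μ μ * eta ν ν : ℂ) *
        (ipL N (ibrL f (dA μ μ) (A ν) + ibrL f (A μ) (dA μ ν)) (ibrL f w (A ν)) +
          ipL N (ibrL f (A μ) (A ν)) (ibrL f (dw μ) (A ν) + ibrL f w (dA μ ν))) := by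
  have hGs : ∀ μ ν, G ν μ = -G μ ν := fun μ ν => by rw [← hG, ← hG, neg_sub]
  set S := ∑ μ, ∑ ν, (eta μ μ * eta ν ν : ℂ) * ipL N (ibrL f (A μ) (A ν)) (ibrL f w (G μ ν))
    with hS
  set X := ∑ μ, ∑ ν, (eta μ μ * eta ν ν : ℂ) * ipL N (ibrL f (A μ) (A ν)) (ibrL f (dw μ) (A ν))
    with hX
  set T := ∑ μ, ∑ ν, (eta μ μ * eta ν ν : ℂ) *
    ipL N (ibrL f (dA μ μ) (A ν) + ibrL f (A μ) (dA μ ν)) (ibrL f w (A ν)) with hT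
  set W := ∑ μ, ∑ ν, (eta μ μ * eta ν ν : ℂ) *
    ipL N (ibrL f (A μ) (A ν)) (ibrL f w (dA μ ν)) with hW
  have swap : ∀ E : Fin 4 → Fin 4 → ℂ, ∑ μ, ∑ ν, E μ ν = ∑ μ, ∑ ν, E ν μ :=
    fun E => Finset.sum_comm
  have h1 : ∑ κ, ∑ ρ, (eta κ κ * eta ρ ρ : ℂ) *
        (ipL N (ibrL f (A κ) (A ρ)) (ibrL f (dw ρ) (A κ) + ibrL f w (dA ρ κ)) -
          ipL N (ibrL f (dA ρ κ) (A ρ) + ibrL f (A κ) (dA ρ ρ)) (ibrL f w (A κ))) =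
      T - X - W := by
    -- All terms with ∂_μA^μ sit in T, which enters both sides of the identity with the same
    -- coefficient.
    rw [swap, hT, hX, hW, ← Finset.sum_sub_distrib, ← Finset.sum_sub_distrib]
    refine Finset.sum_congr rfl fun μ _ => ?_
    rw [← Finset.sum_sub_distrib, ← Finset.sum_sub_distrib]
    refine Finset.sum_congr rfl fun ν _ => ?_
    rw [ibrL_antisymm hf (A ν) (A μ), ibrL_antisymm hf (dA μ ν) (A μ),
      ibrL_antisymm hf (A ν) (dA μ μ)]
    simp only [map_add, map_neg, LinearMap.add_apply, LinearMap.neg_apply]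
    ring
  -- The only use of the Jacobi identity: the sum and its copy with κ and ν interchanged are two of
  -- the three Jacobi terms, so twice the sum is the third, S.
  have h2 : ∑ κ, ∑ ν, (eta κ κ * eta ν ν : ℂ) *
      ipL N (ibrL f (G κ ν) (A ν)) (ibrL f w (A κ)) = (1 / 2) * S := by
    set J := ∑ κ, ∑ ν, (eta κ κ * eta ν ν : ℂ) *
      ipL N (ibrL f (G κ ν) (A ν)) (ibrL f w (A κ)) with hJ
    have : J + J = S := by
      nth_rewrite 2 [hJ]
      rw [swap, hJ, hS, ← Finset.sum_add_distrib]
      refine Finset.sum_congr rfl fun κ _ => ?_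
      rw [← Finset.sum_add_distrib]
      refine Finset.sum_congr rfl fun ν _ => ?_
      have hj := ipL_jacobi hf w (A κ) (A ν) (G κ ν)
      rw [ibrL_antisymm hf (A ν) (G κ ν), ibrL_antisymm hf (A ν) w,
        ibrL_antisymm hf (A κ) (G κ ν), map_neg, map_neg, map_neg, LinearMap.neg_apply,
        ipL_comm (ibrL f w (A κ)), ipL_comm (ibrL f w (A ν))] at hj
      rw [hGs κ ν, map_neg, LinearMap.neg_apply, map_neg, LinearMap.neg_apply]
      linear_combination (-(eta κ κ * eta ν ν : ℂ)) * hj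
    linear_combination (1 / 2 : ℂ) * this
  have h3 : ∑ μ, ∑ ν, (eta μ μ * eta ν ν : ℂ) *
        ipL N (ibrL f (G μ ν) w) (ibrL f (A μ) (A ν)) = -S := by
    rw [hS, ← Finset.sum_neg_distrib]
    refine Finset.sum_congr rfl fun μ _ => ?_
    rw [← Finset.sum_neg_distrib]
    refine Finset.sum_congr rfl fun ν _ => ?_
    rw [ipL_comm, ibrL_antisymm hf (G μ ν) w, map_neg]
    ring
  have h4 : ∑ μ, ∑ ν, (eta μ μ * eta ν ν : ℂ) *
        (ipL N (ibrL f (dA μ μ) (A ν) + ibrL f (A μ) (dA μ ν)) (ibrL f w (A ν)) +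
          ipL N (ibrL f (A μ) (A ν)) (ibrL f (dw μ) (A ν) + ibrL f w (dA μ ν))) = T + (X + W) := by
    rw [hT, hX, hW, ← Finset.sum_add_distrib, ← Finset.sum_add_distrib]
    refine Finset.sum_congr rfl fun μ _ => ?_
    rw [← Finset.sum_add_distrib, ← Finset.sum_add_distrib]
    refine Finset.sum_congr rfl fun ν _ => ?_
    simp only [map_add]
    ring
  -- Contraction with the antisymmetric i[A^μ,A^ν] sees only half the curl of A. With this, both
  -- sides reduce to i(1+c_F)(T - X + W).
  have h5 : W + W = S := by
    nth_rewrite 2 [hW]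
    rw [swap, hW, hS, ← Finset.sum_add_distrib]
    refine Finset.sum_congr rfl fun μ _ => ?_
    rw [← Finset.sum_add_distrib]
    refine Finset.sum_congr rfl fun ν _ => ?_
    rw [ibrL_antisymm hf (A ν) (A μ), ← hG μ ν, map_sub, map_sub, map_neg, LinearMap.neg_apply]
    ring
  rw [h1, h2, h3, h4, ← h5]
  ring

/-! ### The variation of `L₂` -/

/-- The potential is linear in the smearing function, and δc produces the gradient of w. Along the
variation, L₂ is therefore a polynomial in t. -/
lemma strA_add_smul (hc : IsSmearing c) (hb : IsVariation b δc) (hF : IsMaxwell F) (μ : Fin 4)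
    (x : Mink) (t : ℝ) : fieldA (fun e => c e + t * δc e) F μ x =
      fieldA c F μ x + t • pdV μ (fieldW b F) x := by
  funext a
  have hcc := hc.smooth.continuous
  have hdc := hb.smooth.continuous
  have h1 : Continuous fun e => c e + t * δc e := by fun_prop
  have h2 : HasCompactSupport fun e => c e + t * δc e := hc.compact.add hb.compact.mul_left
  have e : (fieldA c F μ x + t • pdV μ (fieldW b F) x) a = strA c F μ a x + t * strA δc F μ a x := by
    rw [strA_variation hb hF]
    rfl
  rw [e, fieldA, strA_eq h1 h2 hF, strA_eq hcc hc.compact hF, strA_eq hdc hb.compact hF,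
    Finset.mul_sum, ← Finset.sum_add_distrib]
  refine Finset.sum_congr rfl fun ν _ => ?_
  have i1 := integrable_strS (m := fun e => c e * e ν) (by fun_prop) hc.compact.mul_right 0
    (hF.isSpacelikeCompact μ ν a) x
  have i2 := integrable_strS (m := fun e => δc e * e ν) (by fun_prop) hb.compact.mul_right 0
    (hF.isSpacelikeCompact μ ν a) x
  unfold strS
  rw [← integral_const_mul, ← integral_add i1 (i2.const_mul _)]
  congr 1
  funext p
  push_cast
  ring

lemma eval_L2 (cF : ℂ) (v : Gluon × Fin N → ℂ) : MvPolynomial.eval v (L2 f cF) =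
    -(1 / 2) * (1 + cF) * ∑ μ, ∑ ν, (eta μ μ * eta ν ν : ℂ) *
      ipL N (ibrL f (fun a => v (fA μ, a)) (fun a => v (fA ν, a)))
        (ibrL f (fun a => v (fA μ, a)) (fun a => v (fA ν, a))) := by
  rw [← MvPolynomial.coe_aeval_eq_eval, RingHom.coe_coe]
  simp only [L2, map_smul, map_sum, map_ip, map_ibr, up1_eq, smul_eq_mul]
  congr 1
  refine Finset.sum_congr rfl fun μ _ => Finset.sum_congr rfl fun ν _ => ?_
  have h : ∀ μ a, MvPolynomial.aeval v ((eta μ μ • fun a => (MvPolynomial.X (fA μ, a) :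
      WickGluon N)) a) = ((eta μ μ : ℂ) • fun a => v (fA μ, a)) a := by
    intro μ a
    rw [Pi.smul_apply, RCLike.real_smul_eq_coe_smul (K := ℂ), map_smul, MvPolynomial.aeval_X]
    rfl
  simp only [h, MvPolynomial.aeval_X, ip_eq, ibr_eq]
  change ipL N (ibrL f ((eta μ μ : ℂ) • fun a => v (fA μ, a)) ((eta ν ν : ℂ) • fun a => v (fA ν, a)))
    (ibrL f (fun a => v (fA μ, a)) (fun a => v (fA ν, a))) = _
  simp only [map_smul, LinearMap.smul_apply, smul_eq_mul]
  ring

/-- L₂ is quartic in A. By symmetry of the inner product, antisymmetry of the bracket and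
relabelling, its four first-order variations are equal, which turns -½ into -2. -/
lemma deltaC_L2 (hf : IsStructureConstants f) (cF : ℂ) (hc : IsSmearing c)
    (hb : IsVariation b δc) (hF : IsMaxwell F) (x : Mink) :
    deltaC c δc F (L2 f cF) x = -2 * (1 + cF) * ∑ μ, ∑ ν, (eta μ μ * eta ν ν : ℂ) *
      ipL N (ibrL f (fieldA c F μ x) (fieldA c F ν x))
        (ibrL f (pdV μ (fieldW b F) x) (fieldA c F ν x)) := by
  set A : Fin 4 → Fin N → ℂ := fun μ => fieldA c F μ x with hA
  set B : Fin 4 → Fin N → ℂ := fun μ => pdV μ (fieldW b F) x with hB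
  have e : (fun t : ℝ => MvPolynomial.eval (valG (fun e => c e + t * δc e) F x) (L2 f cF)) =
      fun t : ℝ => -(1 / 2) * (1 + cF) * ∑ μ, ∑ ν, (eta μ μ * eta ν ν : ℂ) *
        ipL N (ibrL f (A μ + t • B μ) (A ν + t • B ν)) (ibrL f (A μ + t • B μ) (A ν + t • B ν)) := by
    funext t
    rw [eval_L2]
    simp only [hA, hB, ← strA_add_smul hc hb hF]
    rfl
  have hline : ∀ μ a, HasDerivAt (fun t : ℝ => (A μ + t • B μ) a) (B μ a) 0 := by
    intro μ a
    have : HasDerivAt (fun t : ℝ => A μ a + t • B μ a) ((1 : ℝ) • B μ a) 0 :=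
      ((hasDerivAt_id (0 : ℝ)).smul_const (B μ a)).const_add (A μ a)
    simpa using this
  have hder := (HasDerivAt.fun_sum (u := Finset.univ) fun μ _ => HasDerivAt.fun_sum (u := Finset.univ)
    fun ν _ => (hasDerivAt_ipL (hasDerivAt_ibrL f (hline μ) (hline ν))
      (hasDerivAt_ibrL f (hline μ) (hline ν))).const_mul (eta μ μ * eta ν ν : ℂ)).const_mul
      (-(1 / 2) * (1 + cF))
  rw [deltaC, e, hder.deriv]
  simp only [zero_smul, add_zero, map_add, LinearMap.add_apply]
  have h1 : ∑ μ, ∑ ν, (eta μ μ * eta ν ν : ℂ) * ipL N (ibrL f (A μ) (A ν)) (ibrL f (A μ) (B ν)) =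
      ∑ μ, ∑ ν, (eta μ μ * eta ν ν : ℂ) * ipL N (ibrL f (A μ) (A ν)) (ibrL f (B μ) (A ν)) := by
    rw [Finset.sum_comm]
    refine Finset.sum_congr rfl fun μ _ => Finset.sum_congr rfl fun ν _ => ?_
    rw [ibrL_antisymm hf (A ν) (A μ), ibrL_antisymm hf (A ν) (B μ), map_neg, map_neg,
      LinearMap.neg_apply]
    ring
  simp only [ipL_comm (ibrL f (B _) (A _)), ipL_comm (ibrL f (A _) (B _)), mul_add,
    Finset.sum_add_distrib, h1]
  ring

end LocalIdentities

/-! ### Symmetrization and assembly. -/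

section Resolution

variable {N : ℕ} {f : Fin N → Fin N → Fin N → ℝ} {c : Mink → ℝ} {b : Mink → Fin 4 → ℝ}
  {δc : Mink → ℝ} {F : Fin 4 → Fin 4 → Fin N → Mink → ℂ} {g : Mink × Mink → ℂ}

/-! ### Symmetrized local pairings -/

/-- On the diagonal the first-point derivatives of `g` and of its reflection add up to the total
derivative of g(x,x). Integrating this by parts removes all derivatives from `g`. -/
lemma diagPair_pd1_symm {p l : Mink → ℂ} (hp : ContDiff ℝ ∞ p) (hl : ContDiff ℝ ∞ l)
    (hg : IsTest g) (ρ : Fin 4) :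
    diagPair (pd1 ρ fun q => p q.1 * l q.2 * g q) +
      diagPair (pd1 ρ fun q => p q.1 * l q.2 * g (q.2, q.1)) =
    ∫ x, (l x * pd ρ p x - pd ρ l x * p x) * g (x, x) := by
  have t1 := (isTest_vertex hp hl hg).pd1 ρ
  have t2 := (isTest_vertex hp hl hg.swap).pd1 ρ
  have hd := hg.diag
  have h := integral_mul_pd (hl.mul hp) hd ρ
  have i1 : Integrable fun x => 2 * l x * pd ρ p x * g (x, x) :=
    (hd.mul_left ((contDiff_const.mul hl).mul (contDiff_pd hp ρ))).integrable
  have i2 : Integrable fun x => l x * p x * pd ρ (fun x => g (x, x)) x :=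
    ((hd.pd ρ).mul_left (hl.mul hp)).integrable
  have i3 : Integrable fun x => pd ρ (fun x => l x * p x) x * g (x, x) :=
    (hd.mul_left (contDiff_pd (hl.mul hp) ρ)).integrable
  rw [diagPair, diagPair, ← integral_add t1.diag.integrable t2.diag.integrable]
  have e : ∀ x, pd1 ρ (fun q => p q.1 * l q.2 * g q) (x, x) +
      pd1 ρ (fun q => p q.1 * l q.2 * g (q.2, q.1)) (x, x) =
      2 * l x * pd ρ p x * g (x, x) + l x * p x * pd ρ (fun x => g (x, x)) x := by
    intro x
    rw [pd1_vertex l hp hg, pd1_vertex l hp hg.swap, pd_diag hg.differentiable]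
    have : pd1 ρ (fun q => g (q.2, q.1)) (x, x) = pd2 ρ g (x, x) := rfl
    rw [this]
    ring
  simp only [e]
  rw [integral_add i1 i2, h, ← sub_eq_add_neg, ← integral_sub i1 i3]
  congr 1
  funext x
  rw [pd_mul (hl.differentiable (by simp)) (hp.differentiable (by simp))]
  ring

lemma diagPair_mul_pd1_symm {B : Mink → ℂ} (hB : ContDiff ℝ ∞ B) (hg : IsTest g) (μ : Fin 4) :
    diagPair (fun q => B q.1 * pd1 μ g q) +
      diagPair (fun q => B q.1 * pd1 μ (fun q => g (q.2, q.1)) q) =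
    -∫ x, pd μ B x * g (x, x) := by
  have hB1 : ContDiff ℝ ∞ fun q : Mink × Mink => B q.1 := hB.comp contDiff_fst
  rw [diagPair, diagPair, ← integral_add ((hg.pd1 μ).mul_left hB1).diag.integrable
    ((hg.swap.pd1 μ).mul_left hB1).diag.integrable, ← integral_mul_pd hB hg.diag]
  congr 1
  funext x
  rw [pd_diag hg.differentiable, mul_add]
  rfl

lemma sum_integral_mul {ι : Type*} (s : Finset ι) (k : ι → ℂ) {φ : ι → Mink → ℂ}
    (hφ : ∀ i, ContDiff ℝ ∞ (φ i)) {d : Mink → ℂ} (hd : IsTest d) :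
    ∑ i ∈ s, k i * ∫ x, φ i x * d x = ∫ x, (∑ i ∈ s, k i * φ i x) * d x := by
  simp only [← integral_const_mul]
  rw [← integral_finsetSum _ fun i _ => (hd.mul_left (hφ i)).integrable.const_mul (k i)]
  congr 1
  funext x
  rw [Finset.sum_mul]
  exact Finset.sum_congr rfl fun i _ => (mul_assoc _ _ _).symm

lemma sum_sum_integral_mul {ι κ : Type*} (s : Finset ι) (t : Finset κ) (k : ι → κ → ℂ)
    {φ : ι → κ → Mink → ℂ} (hφ : ∀ i j, ContDiff ℝ ∞ (φ i j)) {d : Mink → ℂ} (hd : IsTest d) :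
    ∑ i ∈ s, ∑ j ∈ t, k i j * ∫ x, φ i j x * d x =
      ∫ x, (∑ i ∈ s, ∑ j ∈ t, k i j * φ i j x) * d x := by
  simp only [sum_integral_mul t _ (hφ _) hd]
  have h := sum_integral_mul s (fun _ => 1)
    (φ := fun i x => ∑ j ∈ t, k i j * φ i j x)
    (fun i => ContDiff.sum fun j _ => contDiff_const.mul (hφ i j)) hd
  simpa only [one_mul] using h

/-- The sum of the obstruction and of the one with the arguments interchanged. -/
lemma obstruction_symm (cF : ℂ) (hf : IsStructureConstants f) (hc : IsSmearing c)
    (hb : IsVariation b δc) (hF : IsMaxwell F) (hg : IsTest g) :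
    obstruction cF c b F (Q1 f) (L1 f) g +
        obstruction cF c b F (Q1 f) (L1 f) (fun p => g (p.2, p.1)) =
      Complex.I * (1 + cF) * (∫ x, (∑ κ, ∑ ρ, (eta κ κ * eta ρ ρ : ℂ) *
        (ipL N (ibrL f (fieldA c F κ x) (fieldA c F ρ x))
            (pdV ρ (fun x => ibrL f (fieldW b F x) (fieldA c F κ x)) x) -
          ipL N (pdV ρ (fun x => ibrL f (fieldA c F κ x) (fieldA c F ρ x)) x)
            (ibrL f (fieldW b F x) (fieldA c F κ x)))) * g (x, x)) +
      2 * Complex.I * (∫ x, (∑ κ, ∑ ν, (eta κ κ * eta ν ν : ℂ) *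
        ipL N (ibrL f (fieldF F κ ν x) (fieldA c F ν x))
          (ibrL f (fieldW b F x) (fieldA c F κ x))) * g (x, x)) -
      cF * Complex.I * (∫ x, (∑ μ, ∑ ν, (eta μ μ * eta ν ν : ℂ) *
        ipL N (ibrL f (fieldF F μ ν x) (fieldW b F x))
          (ibrL f (fieldA c F μ x) (fieldA c F ν x))) * g (x, x)) -
      Complex.I * ∑ κ, ∑ ν, (strPair (fun e => c e * e ν) (fun p =>
        ipL N (current f c F κ p.2) (ibrL f (fieldW b F p.1) (fieldA c F ν p.1)) * pd2 κ g p) +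
        strPair (fun e => c e * e ν) (fun p =>
        ipL N (current f c F κ p.2) (ibrL f (fieldW b F p.1) (fieldA c F ν p.1)) *
          pd2 κ (fun p => g (p.2, p.1)) p)) := by
  have hA := fun μ => hF.isSmooth_fieldA hc μ
  have hW := hF.isSmooth_fieldW hb
  have hFs := hF.isSmooth_fieldF
  have hP := fun ν => hW.ibrL (hA ν) f
  have hR := fun κ ρ => (hA κ).ibrL (hA ρ) f
  have hd := hg.diag
  have e1 : ∑ a, ∑ κ, ∑ ρ, (eta κ κ * eta ρ ρ : ℂ) * diagPair (pd1 ρ fun p =>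
        ibrL f (fieldW b F p.1) (fieldA c F κ p.1) a *
          ibrL f (fieldA c F κ p.2) (fieldA c F ρ p.2) a * g p) +
      ∑ a, ∑ κ, ∑ ρ, (eta κ κ * eta ρ ρ : ℂ) * diagPair (pd1 ρ fun p =>
        ibrL f (fieldW b F p.1) (fieldA c F κ p.1) a *
          ibrL f (fieldA c F κ p.2) (fieldA c F ρ p.2) a * g (p.2, p.1)) =
      ∫ x, (∑ κ, ∑ ρ, (eta κ κ * eta ρ ρ : ℂ) *
        (ipL N (ibrL f (fieldA c F κ x) (fieldA c F ρ x))
            (pdV ρ (fun x => ibrL f (fieldW b F x) (fieldA c F κ x)) x) -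
          ipL N (pdV ρ (fun x => ibrL f (fieldA c F κ x) (fieldA c F ρ x)) x)
            (ibrL f (fieldW b F x) (fieldA c F κ x)))) * g (x, x) := by
    rw [← sum_sum_integral_mul _ _ _ (fun κ ρ => ((hR κ ρ).ipL ((hP κ).pdV ρ)).sub
      (((hR κ ρ).pdV ρ).ipL (hP κ))) hd, ← Finset.sum_add_distrib]
    simp only [← Finset.sum_add_distrib, ← mul_add,
      diagPair_pd1_symm (hP _ _) (hR _ _ _) hg]
    rw [Finset.sum_comm]
    refine Finset.sum_congr rfl fun κ _ => ?_
    rw [Finset.sum_comm]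
    refine Finset.sum_congr rfl fun ρ _ => ?_
    rw [← Finset.mul_sum]
    congr 1
    have h := sum_integral_mul Finset.univ (fun _ : Fin N => 1) (fun a =>
      ((hR κ ρ a).mul (((hP κ).pdV ρ) a)).sub ((((hR κ ρ).pdV ρ) a).mul (hP κ a))) hd
    simp only [one_mul] at h
    refine h.trans ?_
    congr 1
    funext x
    rw [Finset.sum_sub_distrib]
    rfl
  have e2 : ∀ h : Mink × Mink → ℂ, IsTest h → (∀ x, h (x, x) = g (x, x)) →
      ∑ a, ∑ κ, diagPair (fun p => ibrL f (fieldW b F p.1) (fieldA c F κ p.1) a *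
        current f c F κ p.2 a * h p) = ∫ x, (∑ κ, ∑ ν, (eta κ κ * eta ν ν : ℂ) *
        ipL N (ibrL f (fieldF F κ ν x) (fieldA c F ν x))
          (ibrL f (fieldW b F x) (fieldA c F κ x))) * g (x, x) := by
    intro h _ hh
    simp only [diagPair, hh]
    have h1 := sum_sum_integral_mul Finset.univ Finset.univ (fun (_ : Fin N) (_ : Fin 4) => 1)
      (fun a κ => (hP κ a).mul (hF.isSmooth_current hc f κ a)) hd
    simp only [one_mul] at h1
    refine h1.trans ?_
    congr 1
    funext x
    congr 1
    rw [Finset.sum_comm]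
    refine Finset.sum_congr rfl fun κ _ => ?_
    have h2 : ∑ a, ibrL f (fieldW b F x) (fieldA c F κ x) a * current f c F κ x a =
      ipL N (ibrL f (fieldW b F x) (fieldA c F κ x)) (current f c F κ x) := rfl
    rw [h2, ipL_comm, current, map_sum, LinearMap.sum_apply]
    refine Finset.sum_congr rfl fun ν _ => ?_
    rw [map_smul, LinearMap.smul_apply, smul_eq_mul]
  have e3 : ∀ h : Mink × Mink → ℂ, IsTest h → (∀ x, h (x, x) = g (x, x)) →
      ∑ a, ∑ μ, ∑ ν, (eta μ μ * eta ν ν : ℂ) * diagPair (fun p =>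
        ibrL f (fieldF F μ ν p.1) (fieldW b F p.1) a *
          ibrL f (fieldA c F μ p.2) (fieldA c F ν p.2) a * h p) =
      ∫ x, (∑ μ, ∑ ν, (eta μ μ * eta ν ν : ℂ) *
        ipL N (ibrL f (fieldF F μ ν x) (fieldW b F x))
          (ibrL f (fieldA c F μ x) (fieldA c F ν x))) * g (x, x) := by
    intro h _ hh
    simp only [diagPair, hh]
    rw [← sum_sum_integral_mul _ _ _ (fun μ ν => ((hFs μ ν).ibrL hW f).ipL (hR μ ν)) hd,
      Finset.sum_comm]
    refine Finset.sum_congr rfl fun μ _ => ?_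
    rw [Finset.sum_comm]
    refine Finset.sum_congr rfl fun ν _ => ?_
    rw [← Finset.mul_sum]
    congr 1
    have h1 := sum_integral_mul Finset.univ (fun _ : Fin N => 1)
      (fun a => (((hFs μ ν).ibrL hW f) a).mul (hR μ ν a)) hd
    simp only [one_mul] at h1
    exact h1
  rw [obstruction_eq cF hf hc hb hF hg, obstruction_eq cF hf hc hb hF hg.swap,
    sum_strPair_current hf hc hb hF hg, sum_strPair_current hf hc hb hF hg.swap, ← e1,
    e2 g hg (fun _ => rfl), e2 _ hg.swap (fun _ => rfl), e3 g hg (fun _ => rfl),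
    e3 _ hg.swap (fun _ => rfl)]
  simp only [Finset.sum_add_distrib]
  ring

/-- The divergence of `Q₂`. -/
lemma dX_Q2 (cF : ℂ) (hc : IsSmearing c)
    (hb : IsVariation b δc) (hF : IsMaxwell F) (hg : IsTest g) :
    (∑ μ, dX μ (Q2 f cF c b F μ)) g =
      2 * (1 + cF) * ∑ μ, diagPair (fun q => (∑ ν, (eta μ μ * eta ν ν : ℂ) *
        ipL N (ibrL f (fieldA c F μ q.1) (fieldA c F ν q.1))
          (ibrL f (fieldW b F q.1) (fieldA c F ν q.1))) * pd1 μ g q) +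
      2 * ∑ μ, ∑ ν, strPair (fun e => c e * e ν) (fun p =>
        ipL N (current f c F μ p.2) (ibrL f (fieldW b F p.1) (fieldA c F ν p.1)) *
          pd2 μ (fun p => g (p.2, p.1)) p) := by
  have h1 : ∀ μ x, ∑ ν, ip (ibr f (up1 (fun ν => fieldA c F ν x) μ)
      (up1 (fun ν => fieldA c F ν x) ν)) (ibr f (fieldW b F x) (fieldA c F ν x)) =
      ∑ ν, (eta μ μ * eta ν ν : ℂ) * ipL N (ibrL f (fieldA c F μ x) (fieldA c F ν x))
          (ibrL f (fieldW b F x) (fieldA c F ν x)) := by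
    intro μ x
    refine Finset.sum_congr rfl fun ν _ => ?_
    rw [up1_eq, up1_eq, ip_eq, ibr_eq, ibr_eq, RCLike.real_smul_eq_coe_smul (K := ℂ),
      RCLike.real_smul_eq_coe_smul (K := ℂ) (eta ν ν)]
    simp only [map_smul, LinearMap.smul_apply, smul_eq_mul]
    rw [← mul_assoc]
    congr 1
    exact mul_comm _ _
  have h2 : ∀ μ x, ∑ ν, ibr f (up2 (fun κ ρ => fieldF F κ ρ x) μ ν) (fieldA c F ν x) =
      current f c F μ x := by
    intro μ x
    refine Finset.sum_congr rfl fun ν _ => ?_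
    rw [up2_eq, ibr_eq, RCLike.real_smul_eq_coe_smul (K := ℂ), map_smul, LinearMap.smul_apply]
    simp
  have h3 : ∀ μ ρ, mulDist (fun x x' => ip (∑ ν, ibr f (up2 (fun κ ρ => fieldF F κ ρ x) μ ν)
      (fieldA c F ν x)) (ibr f (fieldW b F x') (fieldA c F ρ x'))) (strI c ρ delta) (pd1 μ g) =
      strPair (fun e => c e * e ρ) (fun p =>
        ipL N (current f c F μ p.2) (ibrL f (fieldW b F p.1) (fieldA c F ρ p.1)) *
          pd2 μ (fun p => g (p.2, p.1)) p) := by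
    intro μ ρ
    simp only [h2]
    have ht : IsTest fun p : Mink × Mink =>
        ip (current f c F μ p.1) (ibr f (fieldW b F p.2) (fieldA c F ρ p.2)) * pd1 μ g p := by
      refine (hg.pd1 μ).mul_left ?_
      have hJ := hF.isSmooth_current hc f μ
      have hP := (hF.isSmooth_fieldW hb).ibrL (hF.isSmooth_fieldA hc ρ) f
      exact ContDiff.sum fun a _ => ((hJ a).comp contDiff_fst).mul ((hP a).comp contDiff_snd)
    exact integral_strI_delta hc.smooth.continuous hc.compact ρ ht
  have h4 : ∀ μ, mulDist (fun x _ => ∑ ν, ip (ibr f (up1 (fun ν => fieldA c F ν x) μ)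
      (up1 (fun ν => fieldA c F ν x) ν)) (ibr f (fieldW b F x) (fieldA c F ν x))) delta
      (pd1 μ g) = diagPair (fun q => (∑ ν, (eta μ μ * eta ν ν : ℂ) *
        ipL N (ibrL f (fieldA c F μ q.1) (fieldA c F ν q.1))
          (ibrL f (fieldW b F q.1) (fieldA c F ν q.1))) * pd1 μ g q) := by
    intro μ
    simp only [h1, mulDist, delta, diagPair, add_zero]
  have h5 : ∀ μ, dX μ (Q2 f cF c b F μ) g = -((-2 * (1 + cF)) *
      mulDist (fun x _ => ∑ ν, ip (ibr f (up1 (fun ν => fieldA c F ν x) μ)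
      (up1 (fun ν => fieldA c F ν x) ν)) (ibr f (fieldW b F x) (fieldA c F ν x))) delta
      (pd1 μ g) - 2 * ∑ ρ, mulDist (fun x x' => ip (∑ ν, ibr f
      (up2 (fun κ ρ => fieldF F κ ρ x) μ ν)
      (fieldA c F ν x)) (ibr f (fieldW b F x') (fieldA c F ρ x'))) (strI c ρ delta) (pd1 μ g)) := by
    intro μ
    rw [dX, Q2]
    simp only [Pi.sub_apply, Pi.smul_apply, smul_eq_mul, Finset.sum_apply]
    rfl
  rw [Finset.sum_apply]
  simp only [h5, h3, h4]
  rw [Finset.mul_sum, Finset.mul_sum, ← Finset.sum_add_distrib]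
  refine Finset.sum_congr rfl fun μ _ => ?_
  ring

lemma combine_integrals {u v w : Mink → ℂ} (hu : Integrable u) (hv : Integrable v)
    (hw : Integrable w) (k l m : ℂ) :
    k * (∫ x, u x) + l * (∫ x, v x) - m * (∫ x, w x) = ∫ x, (k * u x + l * v x - m * w x) := by
  have h : Integrable fun x => k * u x + l * v x := (hu.const_mul k).add (hv.const_mul l)
  rw [integral_sub h (hw.const_mul m), integral_add (hu.const_mul k) (hv.const_mul l),
    integral_const_mul, integral_const_mul, integral_const_mul]

/-- The second-order obstruction is resolved. -/
theorem O2_eq (hfs : IsStructureConstants f) (cF : ℂ) (hc : IsSmearing c)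
    (hb : IsVariation b δc) (hF : IsMaxwell F) (hgt : IsTest g) :
    O2 f cF c b F g = mulDist (fun x _ => deltaC c δc F (L2 f cF) x) (Complex.I • delta) g -
      Complex.I * symm (∑ μ, dX μ (Q2 f cF c b F μ)) g := by
  have hd := hgt.diag
  have hA := fun μ => hF.isSmooth_fieldA hc μ
  have hW := hF.isSmooth_fieldW hb
  have hP := fun ν => hW.ibrL (hA ν) f
  have hR := fun κ ρ => (hA κ).ibrL (hA ρ) f
  have hO : O2 f cF c b F g = obstruction cF c b F (Q1 f) (L1 f) g +
      obstruction cF c b F (Q1 f) (L1 f) (fun p => g (p.2, p.1)) := by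
    simp only [O2, symm, Pi.smul_apply, smul_eq_mul]
    ring
  have hS : symm (∑ μ, dX μ (Q2 f cF c b F μ)) g = (1 / 2) * ((∑ μ, dX μ (Q2 f cF c b F μ)) g +
      (∑ μ, dX μ (Q2 f cF c b F μ)) (fun p => g (p.2, p.1))) := rfl
  set B : Fin 4 → Mink → ℂ := fun μ x => ∑ ν, (eta μ μ * eta ν ν : ℂ) *
    ipL N (ibrL f (fieldA c F μ x) (fieldA c F ν x)) (ibrL f (fieldW b F x) (fieldA c F ν x))
    with hBdef
  have hB : ∀ μ, ContDiff ℝ ∞ (B μ) := fun μ =>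
    ContDiff.sum fun ν _ => contDiff_const.mul ((hR μ ν).ipL (hP ν))
  have hBd : ∀ μ x, pd μ (B μ) x = ∑ ν, (eta μ μ * eta ν ν : ℂ) *
      (ipL N (ibrL f (pdV μ (fieldA c F μ) x) (fieldA c F ν x) +
          ibrL f (fieldA c F μ x) (pdV μ (fieldA c F ν) x))
          (ibrL f (fieldW b F x) (fieldA c F ν x)) +
        ipL N (ibrL f (fieldA c F μ x) (fieldA c F ν x))
          (ibrL f (pdV μ (fieldW b F) x) (fieldA c F ν x) +
            ibrL f (fieldW b F x) (pdV μ (fieldA c F ν) x))) := by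
    intro μ x
    rw [hBdef, pd_sum _ fun ν => contDiff_const.mul ((hR μ ν).ipL (hP ν))]
    refine Finset.sum_congr rfl fun ν _ => ?_
    rw [← pdV_ibrL (hA μ) (hA ν), ← pdV_ibrL hW (hA ν), ← pd_ipL (hR μ ν) (hP ν), pd,
      fderiv_const_mul (((hR μ ν).ipL (hP ν)).differentiable (by simp) x)]
    rfl
  have hD : mulDist (fun x _ => deltaC c δc F (L2 f cF) x) (Complex.I • delta) g =
      Complex.I * ∫ x, deltaC c δc F (L2 f cF) x * g (x, x) := by
    simp only [mulDist, Pi.smul_apply, delta, add_zero, smul_eq_mul, integral_const_mul]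
  have hBsum : ∑ μ, diagPair (fun q => B μ q.1 * pd1 μ g q) +
      ∑ μ, diagPair (fun q => B μ q.1 * pd1 μ (fun p => g (p.2, p.1)) q) =
      -∫ x, (∑ μ, pd μ (B μ) x) * g (x, x) := by
    have h := sum_integral_mul Finset.univ (fun _ : Fin 4 => 1)
      (fun μ => contDiff_pd (hB μ) μ) hd
    simp only [one_mul] at h
    rw [← h, ← Finset.sum_add_distrib, ← Finset.sum_neg_distrib]
    exact Finset.sum_congr rfl fun μ _ => diagPair_mul_pd1_symm (hB μ) hgt μ
  rw [hO, obstruction_symm cF hfs hc hb hF hgt, hS, dX_Q2 cF hc hb hF hgt,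
    dX_Q2 cF hc hb hF hgt.swap, hD]
  have i1 : Integrable fun x => (∑ κ, ∑ ρ, (eta κ κ * eta ρ ρ : ℂ) *
      (ipL N (ibrL f (fieldA c F κ x) (fieldA c F ρ x))
          (pdV ρ (fun x => ibrL f (fieldW b F x) (fieldA c F κ x)) x) -
        ipL N (pdV ρ (fun x => ibrL f (fieldA c F κ x) (fieldA c F ρ x)) x)
          (ibrL f (fieldW b F x) (fieldA c F κ x)))) * g (x, x) :=
    (hd.mul_left (ContDiff.sum fun κ _ => ContDiff.sum fun ρ _ => contDiff_const.mul
      (((hR κ ρ).ipL ((hP κ).pdV ρ)).sub (((hR κ ρ).pdV ρ).ipL (hP κ))))).integrable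
  have i2 : Integrable fun x => (∑ κ, ∑ ν, (eta κ κ * eta ν ν : ℂ) *
      ipL N (ibrL f (fieldF F κ ν x) (fieldA c F ν x))
        (ibrL f (fieldW b F x) (fieldA c F κ x))) * g (x, x) :=
    (hd.mul_left (ContDiff.sum fun κ _ => ContDiff.sum fun ν _ => contDiff_const.mul
      (((hF.isSmooth_fieldF κ ν).ibrL (hA ν) f).ipL (hP κ)))).integrable
  have i3 : Integrable fun x => (∑ μ, ∑ ν, (eta μ μ * eta ν ν : ℂ) *
      ipL N (ibrL f (fieldF F μ ν x) (fieldW b F x))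
        (ibrL f (fieldA c F μ x) (fieldA c F ν x))) * g (x, x) :=
    (hd.mul_left (ContDiff.sum fun μ _ => ContDiff.sum fun ν _ => contDiff_const.mul
      (((hF.isSmooth_fieldF μ ν).ibrL hW f).ipL (hR μ ν)))).integrable
  have i4 : Integrable fun x => deltaC c δc F (L2 f cF) x * g (x, x) := by
    simp only [deltaC_L2 hfs cF hc hb hF]
    exact (hd.mul_left (contDiff_const.mul (ContDiff.sum fun μ _ => ContDiff.sum fun ν _ =>
      contDiff_const.mul ((hR μ ν).ipL ((hW.pdV μ).ibrL (hA ν) f))))).integrable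
  have i5 : Integrable fun x => (∑ μ, pd μ (B μ) x) * g (x, x) :=
    (hd.mul_left (ContDiff.sum fun μ _ => contDiff_pd (hB μ) μ)).integrable
  have hL : Complex.I * (1 + cF) * (∫ x, (∑ κ, ∑ ρ, (eta κ κ * eta ρ ρ : ℂ) *
        (ipL N (ibrL f (fieldA c F κ x) (fieldA c F ρ x))
            (pdV ρ (fun x => ibrL f (fieldW b F x) (fieldA c F κ x)) x) -
          ipL N (pdV ρ (fun x => ibrL f (fieldA c F κ x) (fieldA c F ρ x)) x)
            (ibrL f (fieldW b F x) (fieldA c F κ x)))) * g (x, x)) +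
      2 * Complex.I * (∫ x, (∑ κ, ∑ ν, (eta κ κ * eta ν ν : ℂ) *
        ipL N (ibrL f (fieldF F κ ν x) (fieldA c F ν x))
          (ibrL f (fieldW b F x) (fieldA c F κ x))) * g (x, x)) -
      cF * Complex.I * (∫ x, (∑ μ, ∑ ν, (eta μ μ * eta ν ν : ℂ) *
        ipL N (ibrL f (fieldF F μ ν x) (fieldW b F x))
          (ibrL f (fieldA c F μ x) (fieldA c F ν x))) * g (x, x)) =
      Complex.I * (∫ x, deltaC c δc F (L2 f cF) x * g (x, x)) +
        Complex.I * (1 + cF) * ∫ x, (∑ μ, pd μ (B μ) x) * g (x, x) := by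
    -- All local terms are now integrals against the same g(x,x), so the comparison is pointwise and
    -- purely algebraic, with the curl of A as the only field equation.
    rw [combine_integrals i1 i2 i3, ← integral_const_mul, ← integral_const_mul,
      ← integral_add (i4.const_mul _) (i5.const_mul _)]
    congr 1
    funext x
    have h := local_identity hfs cF (fun μ => fieldA c F μ x) (fieldW b F x)
      (fun μ ν => pdV μ (fieldA c F ν) x) (fun μ => pdV μ (fieldW b F) x)
      (fun μ ν => fieldF F μ ν x) fun μ ν => curl_fieldA hc hF μ ν x
    simp only [deltaC_L2 hfs cF hc hb hF, hBd, pdV_ibrL hW (hA _),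
      pdV_ibrL (hA _) (hA _)]
    linear_combination g (x, x) * h
  rw [hL]
  simp only [hBdef] at hBsum ⊢
  simp only [Finset.sum_add_distrib]
  -- The string pairings for `g` and for its reflection occur on both sides, interchanged by the
  -- reflection in Q₂, and cancel under symmetrization. Only the divergence of the local part of Q₂
  -- is left to match.
  linear_combination (Complex.I * (1 + cF)) * hBsum

end Resolution

end StringYM

end

theorem propositionp {N : ℕ} {𝔤 : Type*} [LieRing 𝔤] [LieAlgebra ℂ 𝔤]
    (ξ : Module.Basis (Fin N) ℂ 𝔤) (f : Fin N → Fin N → Fin N → ℝ)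
    (hξ : ∀ a b, ⁅ξ a, ξ b⁆ = ∑ d, (Complex.I * (f a b d : ℂ)) • ξ d)
    (hf : ∀ a b d, f a b d = -f a d b)
    (cF : ℂ)
    (c : StringYM.Mink → ℝ) (hc : StringYM.IsSmearing c)
    (b : StringYM.Mink → Fin 4 → ℝ) (δc : StringYM.Mink → ℝ) (hb : StringYM.IsVariation b δc)
    (F : Fin 4 → Fin 4 → Fin N → StringYM.Mink → ℂ) (hF : StringYM.IsMaxwell F)
    (g : StringYM.Mink × StringYM.Mink → ℂ) (hg : ContDiff ℝ ∞ g) (hg' : HasCompactSupport g) :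
    StringYM.O2 f cF c b F g =
      StringYM.mulDist (fun x _ => StringYM.deltaC c δc F (StringYM.L2 f cF) x)
          (Complex.I • StringYM.delta) g
        - Complex.I *
          StringYM.symm (∑ μ, StringYM.dX μ (StringYM.Q2 f cF c b F μ)) g := by
  exact StringYM.O2_eq (StringYM.isStructureConstants ξ f hξ hf) cF hc hb hF ⟨hg, hg'⟩
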